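/- Let $(X,g)$ be a smooth Riemannian manifold (without boundary, second countable, not necessarily complete or connected) with Riemannian distance $d$, and let $B_r(p)=\{x : d(p,x)<r\}$. By an $n$-rectifiable current we mean an integer multiplicity $n$-rectifiable current $C$ on $X$ of locally finite mass; $|C|\in[0,\infty]$ denotes its mass, $\partial C$ its boundary, and $C\llcorner B$ its restriction to a Borel set $B\subset X$. A function $\varphi:[0,\infty)\to[0,\infty)$ is a *filling function* for $X$ if, for every $\varepsilon>0$, every $1$-rectifiable current $\gamma$ with $|\gamma|<\infty$ and $\partial\gamma=0$ is the boundary of a $2$-rectifiable current $C'$ with $|C'|<\varphi(|\gamma|)+\varepsilon$. For $Q\ge 1$, a $2$-rectifiable current $C$ is *$Q$-quasiminimizing* if $\partial C=0$ and $|C\llcorner B|\le Q\,|C'|$ for every Borel set $B\subset X$ with $|C\llcorner B|<\infty$ and every $2$-rectifiable current $C'$ with $|C'|<\infty$ and $\partial C'=\partial(C\llcorner B)$. **Proposition (lower area bound).** Let $\varphi$ be a strictly increasing filling function for $X$, let $Q\ge1$, and let $C$ be a $Q$-quasiminimizing $2$-rectifiable current in $X$. Let $p\in X$ and $a>0$ be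 such that $A_p(a):=|C\llcorner B_a(p)|>0$, and let $b>a$ be such that $A_p(b):=|C\llcorner B_b(p)|<\infty$. Set $$f(s):=\int_{A_p(a)}^{s}\frac{dt}{\varphi^{-1}(t/Q)}\in[0,\infty]\qquad (A_p(a)\le s<\infty),$$ where $\varphi^{-1}(y):=\inf\{x\ge 0:\varphi(x)\ge y\}\in[0,\infty]$ is the monotone extension of the inverse of $\varphi$ (with $\inf\emptyset=\infty$, $1/\infty=0$, $1/0=\infty$). Then $$f\big(|C\llcorner B_b(p)|\big)\ \ge\ b-a .$$ Moreover $f\big(|C\llcorner B_b(p)|\big)<\infty$ whenever $\varphi^{-1}(A_p(a)/Q)>0$. -/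

import Mathlib

open MeasureTheory Manifold Bundle Set
open scoped ENNReal NNReal ContDiff

noncomputable section

namespace Plateau

section Forms

/-- A (not necessarily smooth) differential `n`-form on the `m`-dimensional manifold `X`. -/
abbrev DiffForm (m n : ℕ) (X : Type*) [TopologicalSpace X]
    [ChartedSpace (EuclideanSpace ℝ (Fin m)) X] : Type _ :=
  (x : X) → (TangentSpace (𝓡 m) x) [⋀^Fin n]→L[ℝ] ℝ

variable {m n : ℕ} {X : Type*} [TopologicalSpace X]
  [ChartedSpace (EuclideanSpace ℝ (Fin m)) X]

/-- The expression of the form `η` in the preferred chart at `c`: its pullback to (the target of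
the chart in) Euclidean space under the inverse of the chart. -/
def DiffForm.inChart (η : DiffForm m n X) (c : X) (y : EuclideanSpace ℝ (Fin m)) :
    (EuclideanSpace ℝ (Fin m)) [⋀^Fin n]→L[ℝ] ℝ :=
  (η ((extChartAt (𝓡 m) c).symm y)).compContinuousLinearMap
    (mfderiv 𝓘(ℝ, EuclideanSpace ℝ (Fin m)) (𝓡 m) (extChartAt (𝓡 m) c).symm y)

/-- Smooth forms with compact support. -/
structure DiffForm.IsTest (η : DiffForm m n X) : Prop where
  smooth : ∀ c : X, ContDiffOn ℝ ∞ (η.inChart c) (extChartAt (𝓡 m) c).target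
  compact_support : ∃ K : Set X, IsCompact K ∧ ∀ x ∉ K, η x = 0

/-- The exterior derivative, computed at `x` in the preferred chart at `x`. -/
def DiffForm.d (η : DiffForm m n X) : DiffForm m (n + 1) X := fun x =>
  ContinuousAlternatingMap.compContinuousLinearMap
    (extDeriv (η.inChart x) (extChartAt (𝓡 m) x x))
    (mfderiv (𝓡 m) 𝓘(ℝ, EuclideanSpace ℝ (Fin m)) (extChartAt (𝓡 m) x) x)

/-- Comass at most one: `|η_x(v₁, …, vₙ)| ≤ 1` for all tangent vectors of length at most one. -/
def DiffForm.ComassLEOne [RiemannianBundle (fun x : X => TangentSpace (𝓡 m) x)]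
    (η : DiffForm m n X) : Prop :=
  ∀ (x : X) (v : Fin n → TangentSpace (𝓡 m) x), (∀ i, ‖v i‖ ≤ 1) → |η x v| ≤ 1

end Forms

section Currents

/-- The vectors `∂₁f(u), …, ∂ₙf(u)`, for a map `f` from a subset `s` of `ℝⁿ` to `X`. -/
def partials (m : ℕ) {n : ℕ} {X : Type*} [TopologicalSpace X]
    [ChartedSpace (EuclideanSpace ℝ (Fin m)) X]
    (f : EuclideanSpace ℝ (Fin n) → X) (s : Set (EuclideanSpace ℝ (Fin n)))
    (u : EuclideanSpace ℝ (Fin n)) (j : Fin n) : TangentSpace (𝓡 m) (f u) :=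
  mfderivWithin 𝓘(ℝ, EuclideanSpace ℝ (Fin n)) (𝓡 m) f s u
    (EuclideanSpace.single j (1 : ℝ) : EuclideanSpace ℝ (Fin n))

/-- The Jacobian `|∂₁f ∧ ⋯ ∧ ∂ₙf| = √(det ⟨∂ᵢf, ∂ⱼf⟩)` of `f : s → X`. -/
def jacobian (m : ℕ) {n : ℕ} {X : Type*} [TopologicalSpace X]
    [ChartedSpace (EuclideanSpace ℝ (Fin m)) X]
    [RiemannianBundle (fun x : X => TangentSpace (𝓡 m) x)]
    (f : EuclideanSpace ℝ (Fin n) → X) (s : Set (EuclideanSpace ℝ (Fin n)))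
    (u : EuclideanSpace ℝ (Fin n)) : ℝ :=
  √ (Matrix.gram ℝ (partials m f s u)).det

/-- An (integer multiplicity) `n`-rectifiable current on the Riemannian manifold `X`, of locally
finite mass: integration over a countable union of pieces `f i '' s i`, each the image of a
measurable set `s i ⊆ ℝⁿ` under a Lipschitz map, oriented by the tangent `n`-vector
`∂₁f ∧ ⋯ ∧ ∂ₙf`, with integer multiplicities `θ i` (a negative multiplicity reverses the
orientation) whose total mass over each compact set is finite.
The current itself is the functional `RectCurrent.eval` below; two presentations that induce
the same functional are the same current. -/
structure RectCurrent (m n : ℕ) (X : Type*) [EMetricSpace X]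
    [ChartedSpace (EuclideanSpace ℝ (Fin m)) X]
    [RiemannianBundle (fun x : X => TangentSpace (𝓡 m) x)] where
  s : ℕ → Set (EuclideanSpace ℝ (Fin n))
  f : ℕ → EuclideanSpace ℝ (Fin n) → X
  θ : ℕ → EuclideanSpace ℝ (Fin n) → ℤ
  measurableSet_s : ∀ i, MeasurableSet (s i)
  lipschitz_f : ∀ i, ∃ L : ℝ≥0, LipschitzOnWith L (f i) (s i)
  measurable_θ : ∀ i, Measurable (θ i)
  locally_finite : ∀ K : Set X, IsCompact K →
    ∑' i, ∫⁻ u in s i ∩ f i ⁻¹' K, ENNReal.ofReal (|(θ i u : ℝ)| * jacobian m (f i) (s i) u) < ⊤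

variable {m n : ℕ} {X : Type*} [EMetricSpace X]
  [ChartedSpace (EuclideanSpace ℝ (Fin m)) X]
  [RiemannianBundle (fun x : X => TangentSpace (𝓡 m) x)]

namespace RectCurrent

/-- The value `C(η)` of the current on a test form. -/
def eval (C : RectCurrent m n X) (η : DiffForm m n X) : ℝ :=
  ∑' i, ∫ u in C.s i, (C.θ i u : ℝ) * η (C.f i u) (partials m (C.f i) (C.s i) u)

/-- The mass `|C|`: the supremum of `C(η)` over test forms of comass at most one. -/
def mass (C : RectCurrent m n X) : ℝ≥0∞ :=
  ⨆ (η : DiffForm m n X) (_ : η.IsTest) (_ : η.ComassLEOne), ENNReal.ofReal (C.eval η)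

/-- `∂C = 0`. -/
def IsCycle (C : RectCurrent m (n + 1) X) : Prop :=
  ∀ α : DiffForm m n X, α.IsTest → C.eval α.d = 0

/-- `∂C = ∂C'`. -/
def SameBoundary (C C' : RectCurrent m (n + 1) X) : Prop :=
  ∀ α : DiffForm m n X, α.IsTest → C.eval α.d = C'.eval α.d

/-- `∂C = γ`. -/
def HasBoundary (C : RectCurrent m (n + 1) X) (γ : RectCurrent m n X) : Prop :=
  ∀ α : DiffForm m n X, α.IsTest → C.eval α.d = γ.eval α

lemma measurableSet_inter_preimage [MeasurableSpace X] [BorelSpace X] (C : RectCurrent m n X)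
    {B : Set X} (hB : MeasurableSet B) (i : ℕ) : MeasurableSet (C.s i ∩ C.f i ⁻¹' B) := by
  obtain ⟨L, hL⟩ := C.lipschitz_f i
  have h : Measurable fun u : C.s i => C.f i u := hL.continuousOn.domRestrict.measurable
  have := (C.measurableSet_s i).subtype_image (h hB)
  convert this using 1
  ext u
  simp [and_comm]

/-- The restriction `C ⌞ B` to a Borel set `B`: the multiplicity is set to zero outside of `B`. -/
def restrict [MeasurableSpace X] [BorelSpace X] (C : RectCurrent m n X) (B : Set X)
    (hB : MeasurableSet B) : RectCurrent m n X where
  s := C.s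
  f := C.f
  θ i := (C.s i ∩ C.f i ⁻¹' B).indicator (C.θ i)
  measurableSet_s := C.measurableSet_s
  lipschitz_f := C.lipschitz_f
  measurable_θ i := (C.measurable_θ i).indicator (C.measurableSet_inter_preimage hB i)
  locally_finite K hK := by
    refine lt_of_le_of_lt (ENNReal.tsum_le_tsum fun i => lintegral_mono fun u => ?_)
      (C.locally_finite K hK)
    refine ENNReal.ofReal_le_ofReal (mul_le_mul_of_nonneg_right ?_ (Real.sqrt_nonneg _))
    by_cases hu : u ∈ C.s i ∩ C.f i ⁻¹' B
    · simp [Set.indicator_of_mem hu]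
    · simp [Set.indicator_of_notMem hu]

/-- The restriction `C ⌞ B_r(p)` to the open metric ball of radius `r` around `p`. -/
def restrictBall [MeasurableSpace X] [BorelSpace X] (C : RectCurrent m n X) (p : X) (r : ℝ) :
    RectCurrent m n X :=
  C.restrict (Metric.eball p (ENNReal.ofReal r)) Metric.isOpen_eball.measurableSet

/-- `C` is `Q`-quasiminimizing: it is closed, and each of its restrictions `C ⌞ B` of finite mass
has mass at most `Q` times that of any rectifiable current of finite mass with the same
boundary. -/
structure IsQuasiminimizing [MeasurableSpace X] [BorelSpace X] (C : RectCurrent m (n + 1) X)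
    (Q : ℝ≥0) : Prop where
  isCycle : C.IsCycle
  mass_le : ∀ (B : Set X) (hB : MeasurableSet B), (C.restrict B hB).mass < ⊤ →
    ∀ C' : RectCurrent m (n + 1) X, C'.mass < ⊤ → (C.restrict B hB).SameBoundary C' →
      (C.restrict B hB).mass ≤ Q * C'.mass

end RectCurrent

/-- `φ` is a filling function for `X`: for every `ε > 0`, every `1`-rectifiable cycle `γ` of finite
mass bounds a `2`-rectifiable current of mass less than `φ(|γ|) + ε`. -/
def IsFillingFunction (m : ℕ) (X : Type*) [EMetricSpace X]
    [ChartedSpace (EuclideanSpace ℝ (Fin m)) X]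
    [RiemannianBundle (fun x : X => TangentSpace (𝓡 m) x)] (φ : ℝ≥0 → ℝ≥0) : Prop :=
  ∀ ε : ℝ≥0, 0 < ε → ∀ γ : RectCurrent m 1 X, γ.mass < ⊤ → γ.IsCycle →
    ∃ C : RectCurrent m 2 X, C.HasBoundary γ ∧ C.mass < φ γ.mass.toNNReal + ε

end Currents

section Inverse

/-- The inverse of a strictly increasing function `φ : [0,∞) → [0,∞)`, extended monotonically to
all real `y`: it is `inf {x | y ≤ φ x}`, which is `∞` if `φ` stays below `y`. -/
def extInv (φ : ℝ≥0 → ℝ≥0) (y : ℝ) : ℝ≥0∞ :=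
  ⨅ (x : ℝ≥0) (_ : y ≤ φ x), (x : ℝ≥0∞)

/-- On the range of `φ` this is the inverse function. -/
lemma extInv_apply {φ : ℝ≥0 → ℝ≥0} (hφ : StrictMono φ) (x : ℝ≥0) : extInv φ (φ x) = x := by
  refine le_antisymm (iInf₂_le_of_le x le_rfl le_rfl) (le_iInf₂ fun y hy => ?_)
  exact_mod_cast hφ.le_iff_le.1 (by exact_mod_cast hy)

/-- `∫_{s₀}^{s} dt / φ⁻¹(t / Q)` for `s₀ ≤ s`, as a Lebesgue integral with values in `[0,∞]`
(with `1 / 0 = ∞` and `1 / ∞ = 0`). -/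
def inverseIntegral (φ : ℝ≥0 → ℝ≥0) (Q : ℝ≥0) (s₀ s : ℝ) : ℝ≥0∞ :=
  ∫⁻ t in Ioc s₀ s, (extInv φ (t / Q))⁻¹

end Inverse

end Plateau

end

/-! Suppose first that the distance `ρ` to `p` is smooth, and let `A(r)` be the area of `C` in `{ρ <
r}`. For almost every `r` the boundary of `C ⌞ {ρ < r}` is a rectifiable curve `γ`, the slice of `C`
by `{ρ = r}`, and `|γ| ≤ A'(r)` because `ρ` is `1`-Lipschitz. Filling `γ` gives a competitor for `C
⌞ {ρ < r}`, so quasiminimality yields `A(r) ≤ Q φ(|γ|)`. Hence `φ⁻¹(A(r)/Q) ≤ |γ| ≤ A'(r)`, that is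
`1 ≤ A'(r) / φ⁻¹(A(r)/Q)`. Integrating over `(a,b)` and substituting `t = A(r)` bounds `b - a` by
the integral `f`. Since `A` is only monotone, the substitution is an inequality; jumps of `A` can
only enlarge the integral. The finiteness claim holds because the integrand is nonincreasing.

The distance need not be smooth, so it is replaced by a smooth `g` with `|g - ρ| ≤ ε` and gradient
at most `1 + ε` (`exists_smooth_approx`). This shortens the interval by `2ε` and costs a factor `1 +
ε`; both losses vanish as `ε → 0` (`ofReal_le_of_forall_approx`).

The main work is the slicing theorem `ae_exists_hasBoundary_restrict_sublevel`. Up to a set where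
`g` is critical on the surface, the parameter domains split into countably many pieces on which `g ∘
f` and a linear function are bi-Lipschitz coordinates (`exists_slicePieces`). In these coordinates
the slices are lines, Fubini is the coarea formula, and almost every slice is a rectifiable current
of locally finite mass. That the slice is the boundary follows by testing `∂C = 0` on `Ψ(g) α`,
first for almost every `r` with `α` fixed (`ae_sublevelEval_eq`), then for all `α` at once by
separability (`exists_countable_dense_testForms`).

The bound `|γ| ≤ M A'(r)` for a gradient bound `M` (`mass_le_of_hasDerivAt`) uses only the
definition of mass: `C` is tested on `dg ∧ α` cut off to a thin annulus, and mass is superadditive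
over a sublevel set and the remaining annulus. The differential inequality is
`one_le_deriv_mul_inv_extInv`, its integration `ofReal_sub_le_lintegral_of_monotoneOn`. -/

noncomputable section

namespace Plateau

set_option linter.unusedSectionVars false

/-! ### Linear algebra: Gram determinants and comass in degrees one and two. -/

section LinearAlgebra

variable {V : Type*} [NormedAddCommGroup V] [InnerProductSpace ℝ V]

lemma det_gram_two (v : Fin 2 → V) :
    (Matrix.gram ℝ v).det = ‖v 0‖ ^ 2 * ‖v 1‖ ^ 2 - inner ℝ (v 0) (v 1) ^ 2 := by
  rw [Matrix.det_fin_two]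
  simp only [Matrix.gram_apply, real_inner_self_eq_norm_sq, real_inner_comm (v 0) (v 1)]
  ring

lemma det_gram_one (v : Fin 1 → V) : (Matrix.gram ℝ v).det = ‖v 0‖ ^ 2 := by
  simp [Matrix.gram_apply]

/-- The right side minus the left side is exactly the Gram determinant of `p, a, b`, which is
nonnegative. -/
lemma det_gram_three_nonneg (p a b : V) :
    ‖inner ℝ p a • b - inner ℝ p b • a‖ ^ 2 ≤
      ‖p‖ ^ 2 * (‖a‖ ^ 2 * ‖b‖ ^ 2 - inner ℝ a b ^ 2) := by
  have h : 0 ≤ (Matrix.gram ℝ ![p, a, b]).det := (Matrix.posSemidef_gram ℝ ![p, a, b]).det_nonneg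
  rw [Matrix.det_fin_three] at h
  simp [Matrix.gram_apply] at h
  simp only [real_inner_comm p a, real_inner_comm p b,
    real_inner_comm a b] at h
  rw [norm_sub_sq_real]
  simp only [norm_smul, inner_smul_left, inner_smul_right, mul_pow, Real.norm_eq_abs, sq_abs]
  rw [conj_trivial, real_inner_comm a b]
  nlinarith [h]

/-- The vector `β(a) b - β(b) a`, which spans the kernel of `β` in the plane spanned by
`a` and `b`. -/
def kernelVector {V : Type*} [AddCommGroup V] [Module ℝ V] [TopologicalSpace V] (β : V →L[ℝ] ℝ)
    (v : Fin 2 → V) : V :=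
  β (v 0) • v 1 - β (v 1) • v 0

/-- This is the pointwise coarea inequality: the length element of a level set is at most the
Lipschitz constant times the area element. By Riesz `β` is the inner product with a vector of length
at most `L`, and the Gram inequality applies. -/
lemma norm_kernelVector_le [FiniteDimensional ℝ V] {β : V →L[ℝ] ℝ} {L : ℝ} (hL : 0 ≤ L)
    (hβ : ∀ v, |β v| ≤ L * ‖v‖) (v : Fin 2 → V) :
    ‖kernelVector β v‖ ≤ L * √(Matrix.gram ℝ v).det := by
  have : CompleteSpace V := FiniteDimensional.complete ℝ V
  obtain ⟨p, rfl⟩ := (InnerProductSpace.toDual ℝ V).surjective β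
  have hp : ‖p‖ ≤ L := by
    rw [← (InnerProductSpace.toDual ℝ V).norm_map p]
    exact ContinuousLinearMap.opNorm_le_bound _ hL hβ
  have h := det_gram_three_nonneg p (v 0) (v 1)
  rw [← det_gram_two] at h
  have h0 : 0 ≤ (Matrix.gram ℝ v).det := (Matrix.posSemidef_gram ℝ v).det_nonneg
  calc ‖kernelVector (InnerProductSpace.toDual ℝ V p) v‖
      = √(‖inner ℝ p (v 0) • v 1 - inner ℝ p (v 1) • v 0‖ ^ 2) := by
        rw [Real.sqrt_sq (norm_nonneg _)]; simp [kernelVector]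
    _ ≤ √(‖p‖ ^ 2 * (Matrix.gram ℝ v).det) := Real.sqrt_le_sqrt h
    _ = ‖p‖ * √(Matrix.gram ℝ v).det := by
        rw [Real.sqrt_mul (sq_nonneg _), Real.sqrt_sq (norm_nonneg _)]
    _ ≤ L * √(Matrix.gram ℝ v).det := by gcongr

lemma sqrt_det_gram_le_one {v : Fin 2 → V} (hv : ∀ i, ‖v i‖ ≤ 1) :
    √(Matrix.gram ℝ v).det ≤ 1 := by
  rw [Real.sqrt_le_left zero_le_one, one_pow, det_gram_two]
  have h0 := pow_le_one₀ (norm_nonneg _) (hv 0) (n := 2)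
  have h1 := pow_le_one₀ (norm_nonneg _) (hv 1) (n := 2)
  nlinarith [sq_nonneg (inner ℝ (v 0) (v 1)), sq_nonneg ‖v 0‖, sq_nonneg ‖v 1‖]

/-- Gram–Schmidt: subtracting from `v 1` its projection to `v 0` changes neither `η v` nor the Gram
determinant, and for an orthogonal pair the area is the product of the lengths. -/
lemma abs_alternating_two_le {η : V [⋀^Fin 2]→L[ℝ] ℝ} {M : ℝ}
    (hη : ∀ v : Fin 2 → V, (∀ i, ‖v i‖ ≤ 1) → |η v| ≤ M) (v : Fin 2 → V) :
    |η v| ≤ M * √(Matrix.gram ℝ v).det := by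
  have hM : 0 ≤ M := (abs_nonneg _).trans (hη 0 (by simp))
  have hom : ∀ w : Fin 2 → V, |η w| ≤ M * (‖w 0‖ * ‖w 1‖) := by
    intro w
    by_cases h0 : w 0 = 0
    · rw [η.map_coord_zero 0 h0]; simp; positivity
    by_cases h1 : w 1 = 0
    · rw [η.map_coord_zero 1 h1]; simp; positivity
    have hu := hη (fun i => ‖w i‖⁻¹ • w i) fun i => by
      rw [norm_smul, norm_inv, norm_norm]; exact inv_mul_le_one
    rw [η.map_smul_univ (fun i => ‖w i‖⁻¹) w] at hu
    rw [Fin.prod_univ_two, smul_eq_mul, abs_mul, abs_mul, abs_inv, abs_inv, abs_norm, abs_norm] at hu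
    have h0' : 0 < ‖w 0‖ := norm_pos_iff.2 h0
    have h1' : 0 < ‖w 1‖ := norm_pos_iff.2 h1
    field_simp at hu
    linarith
  by_cases h0 : v 0 = 0
  · rw [η.map_coord_zero 0 h0]; simp; positivity
  have h0' : 0 < ‖v 0‖ := norm_pos_iff.2 h0
  set c := inner ℝ (v 0) (v 1) / ‖v 0‖ ^ 2
  have key : η v = η ![v 0, v 1 - c • v 0] := by
    have e1 : ![v 0, v 1 - c • v 0] = Function.update v 1 (v 1 - c • v 0) := by
      ext i; fin_cases i <;> simp
    rw [e1, η.map_update_sub, η.map_update_smul, Function.update_eq_self]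
    rw [η.map_eq_zero_of_eq (Function.update v 1 (v 0)) (i := 0) (j := 1) (by simp) (by decide)]
    simp
  rw [key]
  refine (hom _).trans (mul_le_mul_of_nonneg_left ?_ hM)
  apply Real.le_sqrt_of_sq_le
  rw [det_gram_two, mul_pow]
  simp only [Matrix.cons_val_zero, Matrix.cons_val_one]
  rw [norm_sub_sq_real, norm_smul, inner_smul_right, real_inner_comm, mul_pow, Real.norm_eq_abs, sq_abs]
  simp only [c]
  field_simp
  rw [real_inner_comm]
  nlinarith

lemma abs_alternating_one_le {η : V [⋀^Fin 1]→L[ℝ] ℝ} {M : ℝ}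
    (hη : ∀ v : Fin 1 → V, (∀ i, ‖v i‖ ≤ 1) → |η v| ≤ M) (v : Fin 1 → V) :
    |η v| ≤ M * √(Matrix.gram ℝ v).det := by
  have hM : 0 ≤ M := (abs_nonneg _).trans (hη 0 (by simp))
  rw [det_gram_one, Real.sqrt_sq (norm_nonneg _)]
  by_cases h0 : v 0 = 0
  · rw [η.map_coord_zero 0 h0]; simp; positivity
  have hu := hη (fun i => ‖v i‖⁻¹ • v i) fun i => by
      rw [norm_smul, norm_inv, norm_norm]; exact inv_mul_le_one
  rw [η.map_smul_univ (fun i => ‖v i‖⁻¹) v] at hu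
  rw [Fin.prod_univ_one, smul_eq_mul, abs_mul, abs_inv, abs_norm] at hu
  have h0' : 0 < ‖v 0‖ := norm_pos_iff.2 h0
  field_simp at hu
  linarith

end LinearAlgebra

/-! ### Differential forms in charts: independence of the chart, `d ∘ d = 0`, Leibniz rule. -/

section Charts

open scoped Topology

variable {m n : ℕ} {X : Type*} [TopologicalSpace X]
  [ChartedSpace (EuclideanSpace ℝ (Fin m)) X] [IsManifold (𝓡 m) ∞ X]

/-- The derivative at `y` of the preferred chart at `c`. -/
def dchart (c y : X) : TangentSpace (𝓡 m) y →L[ℝ] EuclideanSpace ℝ (Fin m) :=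
  (trivializationAt (EuclideanSpace ℝ (Fin m)) (TangentSpace (𝓡 m)) c).continuousLinearMapAt ℝ y

/-- The inverse of `dchart`. -/
def dsymm (c y : X) : EuclideanSpace ℝ (Fin m) →L[ℝ] TangentSpace (𝓡 m) y :=
  (trivializationAt (EuclideanSpace ℝ (Fin m)) (TangentSpace (𝓡 m)) c).symmL ℝ y

lemma dsymm_dchart {c y : X} (hy : y ∈ (extChartAt (𝓡 m) c).source) (v : TangentSpace (𝓡 m) y) :
    dsymm c y (dchart c y v) = v :=
  Trivialization.symmL_continuousLinearMapAt _ (by simpa using hy) v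

lemma dchart_dsymm {c y : X} (hy : y ∈ (extChartAt (𝓡 m) c).source) (v : EuclideanSpace ℝ (Fin m)) :
    dchart c y (dsymm c y v) = v :=
  Trivialization.continuousLinearMapAt_symmL _ (by simpa using hy) v

lemma dchart_eq_mfderiv {c y : X} (hy : y ∈ (extChartAt (𝓡 m) c).source) :
    dchart c y = mfderiv (𝓡 m) 𝓘(ℝ, EuclideanSpace ℝ (Fin m)) (extChartAt (𝓡 m) c) y :=
  TangentBundle.continuousLinearMapAt_trivializationAt (by simpa using hy)

lemma dsymm_eq_mfderiv {c y : X} (hy : y ∈ (extChartAt (𝓡 m) c).source) :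
    dsymm c y = mfderiv 𝓘(ℝ, EuclideanSpace ℝ (Fin m)) (𝓡 m) (extChartAt (𝓡 m) c).symm
      (extChartAt (𝓡 m) c y) := by
  have h := TangentBundle.symmL_trivializationAt (𝕜 := ℝ) (I := 𝓡 m) (x₀ := c) (x := y)
    (by simpa using hy)
  rw [ModelWithCorners.range_eq_univ, mfderivWithin_univ] at h
  exact h

lemma hasMFDerivAt_extChartAt {c y : X} (hy : y ∈ (extChartAt (𝓡 m) c).source) :
    HasMFDerivAt (𝓡 m) 𝓘(ℝ, EuclideanSpace ℝ (Fin m)) (extChartAt (𝓡 m) c) y (dchart c y) := by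
  rw [dchart_eq_mfderiv hy]
  exact (mdifferentiableAt_extChartAt (by simpa using hy)).hasMFDerivAt

lemma hasMFDerivAt_extChartAt_symm {c y : X} (hy : y ∈ (extChartAt (𝓡 m) c).source) :
    HasMFDerivAt 𝓘(ℝ, EuclideanSpace ℝ (Fin m)) (𝓡 m) (extChartAt (𝓡 m) c).symm
      (extChartAt (𝓡 m) c y) (dsymm c y) := by
  rw [dsymm_eq_mfderiv hy]
  refine MDifferentiableAt.hasMFDerivAt ?_
  have := mdifferentiableWithinAt_extChartAt_symm (I := 𝓡 m) (x := c)
    ((extChartAt (𝓡 m) c).map_source hy)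
  rwa [ModelWithCorners.range_eq_univ, mdifferentiableWithinAt_univ] at this

lemma two_le_infty : (2 : WithTop ℕ∞) ≤ (∞ : WithTop ℕ∞) := by
  exact WithTop.coe_le_coe.2 (le_top : (2 : ℕ∞) ≤ ⊤)

lemma isOpen_target (c : X) : IsOpen (extChartAt (𝓡 m) c).target :=
  isOpen_extChartAt_target c

lemma DiffForm.inChart_eq (η : DiffForm m n X) {c y : X} (hy : y ∈ (extChartAt (𝓡 m) c).source) :
    η.inChart c (extChartAt (𝓡 m) c y) = (η y).compContinuousLinearMap (dsymm c y) := by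
  rw [dsymm_eq_mfderiv hy]
  unfold DiffForm.inChart
  rw [(extChartAt (𝓡 m) c).left_inv hy]

lemma DiffForm.inChart_apply (η : DiffForm m n X) {c y : X}
    (hy : y ∈ (extChartAt (𝓡 m) c).source) (v : Fin n → EuclideanSpace ℝ (Fin m)) :
    η.inChart c (extChartAt (𝓡 m) c y) v = η y fun i => dsymm c y (v i) := by
  rw [η.inChart_eq hy]; rfl

lemma DiffForm.apply_eq_inChart (η : DiffForm m n X) {c y : X}
    (hy : y ∈ (extChartAt (𝓡 m) c).source) (v : Fin n → TangentSpace (𝓡 m) y) :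
    η y v = η.inChart c (extChartAt (𝓡 m) c y) fun i => dchart c y (v i) := by
  rw [η.inChart_apply hy]
  simp_rw [dsymm_dchart hy]

/-- The change of coordinates between two preferred charts. -/
def transition (c x : X) : EuclideanSpace ℝ (Fin m) → EuclideanSpace ℝ (Fin m) :=
  extChartAt (𝓡 m) x ∘ (extChartAt (𝓡 m) c).symm

lemma contDiffAt_transition {c x y : X} (hc : y ∈ (extChartAt (𝓡 m) c).source)
    (hx : y ∈ (extChartAt (𝓡 m) x).source) :
    ContDiffAt ℝ ∞ (transition c x) (extChartAt (𝓡 m) c y) := by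
  have h := contDiffWithinAt_ext_coord_change (I := 𝓡 m) (n := ∞) x c
    (y := extChartAt (𝓡 m) c y) (by
      rw [PartialEquiv.trans_source, PartialEquiv.symm_source]
      refine ⟨(extChartAt (𝓡 m) c).map_source hc, ?_⟩
      rw [mem_preimage, (extChartAt (𝓡 m) c).left_inv hc]
      exact hx)
  rwa [ModelWithCorners.range_eq_univ, contDiffWithinAt_univ] at h

lemma hasFDerivAt_transition {c x y : X} (hc : y ∈ (extChartAt (𝓡 m) c).source)
    (hx : y ∈ (extChartAt (𝓡 m) x).source) :
    HasFDerivAt (transition c x) (dchart x y ∘L dsymm c y) (extChartAt (𝓡 m) c y) := by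
  have h1 : HasMFDerivAt (𝓡 m) 𝓘(ℝ, EuclideanSpace ℝ (Fin m)) (extChartAt (𝓡 m) x)
      ((extChartAt (𝓡 m) c).symm (extChartAt (𝓡 m) c y)) (dchart x y) := by
    rw [(extChartAt (𝓡 m) c).left_inv hc]; exact hasMFDerivAt_extChartAt hx
  exact (HasMFDerivAt.comp _ h1 (hasMFDerivAt_extChartAt_symm hc)).hasFDerivAt

/-- Expressions in two charts are related by pullback under the transition map, on a whole
neighbourhood, so that the identity may be differentiated. -/
lemma DiffForm.inChart_eventuallyEq (η : DiffForm m n X) {c x y : X}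
    (hc : y ∈ (extChartAt (𝓡 m) c).source) (hx : y ∈ (extChartAt (𝓡 m) x).source) :
    η.inChart c =ᶠ[𝓝 (extChartAt (𝓡 m) c y)] fun z =>
      (η.inChart x (transition c x z)).compContinuousLinearMap (fderiv ℝ (transition c x) z) := by
  have h1 : (extChartAt (𝓡 m) c).target ∈ 𝓝 (extChartAt (𝓡 m) c y) :=
    (isOpen_target c).mem_nhds ((extChartAt (𝓡 m) c).map_source hc)
  have h2 : (extChartAt (𝓡 m) c).symm ⁻¹' (extChartAt (𝓡 m) x).source ∈
      𝓝 (extChartAt (𝓡 m) c y) := by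
    refine (continuousAt_extChartAt_symm' hc).preimage_mem_nhds ?_
    rw [(extChartAt (𝓡 m) c).left_inv hc]
    exact (isOpen_extChartAt_source x).mem_nhds hx
  filter_upwards [h1, h2] with z hz hz'
  set w := (extChartAt (𝓡 m) c).symm z with hw
  have hwc : w ∈ (extChartAt (𝓡 m) c).source := (extChartAt (𝓡 m) c).map_target hz
  have hzw : z = extChartAt (𝓡 m) c w := ((extChartAt (𝓡 m) c).right_inv hz).symm
  rw [hzw, (hasFDerivAt_transition hwc hz').fderiv]
  have : transition c x (extChartAt (𝓡 m) c w) = extChartAt (𝓡 m) x w := by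
    simp only [transition, Function.comp_apply, (extChartAt (𝓡 m) c).left_inv hwc]
  ext v
  rw [this, η.inChart_apply hwc, ContinuousAlternatingMap.compContinuousLinearMap_apply,
    η.apply_eq_inChart hz']
  rfl

lemma DiffForm.IsTest.contDiffAt_inChart {η : DiffForm m n X} (hη : η.IsTest) {c : X}
    {z : EuclideanSpace ℝ (Fin m)} (hz : z ∈ (extChartAt (𝓡 m) c).target) :
    ContDiffAt ℝ ∞ (η.inChart c) z :=
  (hη.smooth c).contDiffAt ((isOpen_target c).mem_nhds hz)

/-- The form `η.d` is defined at each point through that point's own chart. Naturality of the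
exterior derivative under the transition map shows that any chart computes it; smoothness of `η.d`
and `d ∘ d = 0` depend on this. -/
lemma DiffForm.IsTest.d_inChart {η : DiffForm m n X} (hη : η.IsTest) {c : X}
    {z : EuclideanSpace ℝ (Fin m)} (hz : z ∈ (extChartAt (𝓡 m) c).target) :
    η.d.inChart c z = extDeriv (η.inChart c) z := by
  set y := (extChartAt (𝓡 m) c).symm z with hy
  have hyc : y ∈ (extChartAt (𝓡 m) c).source := (extChartAt (𝓡 m) c).map_target hz
  have hzy : z = extChartAt (𝓡 m) c y := ((extChartAt (𝓡 m) c).right_inv hz).symm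
  have hyy : y ∈ (extChartAt (𝓡 m) y).source := mem_extChartAt_source y
  have ht : transition c y (extChartAt (𝓡 m) c y) = extChartAt (𝓡 m) y y := by
    simp only [transition, Function.comp_apply, (extChartAt (𝓡 m) c).left_inv hyc]
  rw [hzy, (η.inChart_eventuallyEq hyc hyy).extDeriv_eq,
    extDeriv_pullback (r := ∞) _ (contDiffAt_transition hyc hyy)
      (by simpa using two_le_infty), ht,
    (hasFDerivAt_transition hyc hyy).fderiv]
  · ext v
    rw [η.d.inChart_apply hyc]
    simp only [DiffForm.d, ← dchart_eq_mfderiv hyy]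
    rfl
  · rw [ht]
    exact (hη.contDiffAt_inChart ((extChartAt (𝓡 m) y).map_source hyy)).differentiableAt (by simp)

lemma contDiffAt_extDeriv {E : Type*} [NormedAddCommGroup E] [NormedSpace ℝ E]
    {ξ : E → E [⋀^Fin n]→L[ℝ] ℝ} {z : E} (h : ContDiffAt ℝ ∞ ξ z) :
    ContDiffAt ℝ ∞ (extDeriv ξ) z :=
  ContDiffAt.comp z (g := ContinuousAlternatingMap.alternatizeUncurryFinCLM ℝ E ℝ (n := n))
    (ContinuousLinearMap.contDiff _).contDiffAt (h.fderiv_right (m := ∞) (by simp))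

lemma DiffForm.inChart_eventuallyEq_zero [T2Space X] {η : DiffForm m n X} {K : Set X}
    (hK : IsCompact K) (h0 : ∀ x ∉ K, η x = 0) {x c : X} (hx : x ∉ K)
    (hc : x ∈ (extChartAt (𝓡 m) c).source) :
    η.inChart c =ᶠ[𝓝 (extChartAt (𝓡 m) c x)] 0 := by
  have h2 : (extChartAt (𝓡 m) c).symm ⁻¹' Kᶜ ∈ 𝓝 (extChartAt (𝓡 m) c x) := by
    refine (continuousAt_extChartAt_symm' hc).preimage_mem_nhds ?_
    rw [(extChartAt (𝓡 m) c).left_inv hc]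
    exact hK.isClosed.isOpen_compl.mem_nhds hx
  filter_upwards [h2] with z hz
  simp only [DiffForm.inChart, h0 _ hz]
  rfl

lemma DiffForm.d_eq_zero [T2Space X] {η : DiffForm m n X} {K : Set X}
    (hK : IsCompact K) (h0 : ∀ x ∉ K, η x = 0) {x : X} (hx : x ∉ K) : η.d x = 0 := by
  have hxx : x ∈ (extChartAt (𝓡 m) x).source := mem_extChartAt_source x
  have h : extDeriv (η.inChart x) (extChartAt (𝓡 m) x x) = 0 := by
    rw [(DiffForm.inChart_eventuallyEq_zero hK h0 hx hxx).extDeriv_eq]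
    ext v
    rw [extDeriv_apply (by exact differentiableAt_const 0)]
    simp
  simp only [DiffForm.d, h]
  rfl

lemma DiffForm.IsTest.d [T2Space X] {η : DiffForm m n X} (hη : η.IsTest) : η.d.IsTest := by
  constructor
  · intro c
    refine ContDiffOn.congr (f := extDeriv (η.inChart c)) ?_ fun z hz => hη.d_inChart hz
    exact fun z hz => (contDiffAt_extDeriv (hη.contDiffAt_inChart hz)).contDiffWithinAt
  · obtain ⟨K, hK, h0⟩ := hη.compact_support
    exact ⟨K, hK, fun x hx => DiffForm.d_eq_zero hK h0 hx⟩

lemma DiffForm.IsTest.d_d [T2Space X] {η : DiffForm m n X} (hη : η.IsTest) (x : X) :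
    η.d.d x = 0 := by
  have hxx : x ∈ (extChartAt (𝓡 m) x).source := mem_extChartAt_source x
  have ht := (extChartAt (𝓡 m) x).map_source hxx
  have h : extDeriv (η.d.inChart x) (extChartAt (𝓡 m) x x) = 0 := by
    have : η.d.inChart x =ᶠ[𝓝 (extChartAt (𝓡 m) x x)] extDeriv (η.inChart x) := by
      filter_upwards [(isOpen_target x).mem_nhds ht] with z hz using hη.d_inChart hz
    rw [this.extDeriv_eq]
    exact extDeriv_extDeriv_apply (hη.contDiffAt_inChart ht) (by simpa using two_le_infty)
  simp only [DiffForm.d.eq_1 η.d, h]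
  rfl

/-- The derivative of a real function on `X`. -/
def dfun (g : X → ℝ) (x : X) : TangentSpace (𝓡 m) x →L[ℝ] ℝ :=
  mfderiv (𝓡 m) 𝓘(ℝ, ℝ) g x

lemma contDiffAt_comp_chart_symm {g : X → ℝ} {c y : X}
    (hy : y ∈ (extChartAt (𝓡 m) c).source) (hg : ContMDiffAt (𝓡 m) 𝓘(ℝ, ℝ) ∞ g y) :
    ContDiffAt ℝ ∞ (g ∘ (extChartAt (𝓡 m) c).symm) (extChartAt (𝓡 m) c y) := by
  have h := contMDiffWithinAt_extChartAt_symm_target (I := 𝓡 m) (n := ∞) c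
    ((extChartAt (𝓡 m) c).map_source hy)
  have h' := h.contMDiffAt ((isOpen_target c).mem_nhds ((extChartAt (𝓡 m) c).map_source hy))
  rw [← (extChartAt (𝓡 m) c).left_inv hy] at hg
  exact (ContMDiffAt.comp _ hg h').contDiffAt

lemma hasFDerivAt_comp_chart_symm {g : X → ℝ} {c y : X}
    (hy : y ∈ (extChartAt (𝓡 m) c).source) (hg : MDifferentiableAt (𝓡 m) 𝓘(ℝ, ℝ) g y) :
    HasFDerivAt (g ∘ (extChartAt (𝓡 m) c).symm) (dfun g y ∘L dsymm c y)
      (extChartAt (𝓡 m) c y) := by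
  have h1 : HasMFDerivAt (𝓡 m) 𝓘(ℝ, ℝ) g
      ((extChartAt (𝓡 m) c).symm (extChartAt (𝓡 m) c y)) (dfun g y) := by
    rw [(extChartAt (𝓡 m) c).left_inv hy]; exact hg.hasMFDerivAt
  exact (HasMFDerivAt.comp _ h1 (hasMFDerivAt_extChartAt_symm hy)).hasFDerivAt

lemma dfun_comp {g : X → ℝ} {h : ℝ → ℝ} {x : X} (hg : MDifferentiableAt (𝓡 m) 𝓘(ℝ, ℝ) g x)
    (hh : DifferentiableAt ℝ h (g x)) (v : TangentSpace (𝓡 m) x) :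
    dfun (fun y => h (g y)) x v = deriv h (g x) * dfun g x v := by
  have := (HasMFDerivAt.comp x hh.hasFDerivAt.hasMFDerivAt hg.hasMFDerivAt).mfderiv
  have e : dfun (fun y => h (g y)) x = (fderiv ℝ h (g x)) ∘L (dfun g x) := this
  rw [e, ContinuousLinearMap.comp_apply, fderiv_eq_smul_deriv, smul_eq_mul, mul_comm]

/-- The product of a function and a form. -/
def DiffForm.fsmul (g : X → ℝ) (η : DiffForm m n X) : DiffForm m n X := fun x => g x • η x

lemma DiffForm.inChart_fsmul (g : X → ℝ) (η : DiffForm m n X) (c : X) (z) :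
    (η.fsmul g).inChart c z = g ((extChartAt (𝓡 m) c).symm z) • η.inChart c z := by
  ext v; rfl

lemma DiffForm.inChart_add (η ζ : DiffForm m n X) (c : X) (z) :
    (η + ζ).inChart c z = η.inChart c z + ζ.inChart c z := by
  ext v; rfl

lemma DiffForm.IsTest.fsmul {η : DiffForm m n X} (hη : η.IsTest) {g : X → ℝ}
    (hg : ContMDiff (𝓡 m) 𝓘(ℝ, ℝ) ∞ g) : (η.fsmul g).IsTest := by
  constructor
  · intro c z hz
    have hy := (extChartAt (𝓡 m) c).map_target hz
    have h1 := contDiffAt_comp_chart_symm hy (hg _)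
    rw [(extChartAt (𝓡 m) c).right_inv hz] at h1
    exact ((h1.smul (hη.contDiffAt_inChart hz)).contDiffWithinAt).congr
      (fun z _ => η.inChart_fsmul g c z) (η.inChart_fsmul g c z)
  · obtain ⟨K, hK, h0⟩ := hη.compact_support
    exact ⟨K, hK, fun x hx => by simp [DiffForm.fsmul, h0 x hx]⟩

lemma DiffForm.IsTest.add {η ζ : DiffForm m n X} (hη : η.IsTest) (hζ : ζ.IsTest) :
    (η + ζ).IsTest := by
  constructor
  · intro c
    exact ((hη.smooth c).add (hζ.smooth c)).congr (fun z _ => η.inChart_add ζ c z)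
  · obtain ⟨K, hK, h0⟩ := hη.compact_support
    obtain ⟨K', hK', h0'⟩ := hζ.compact_support
    refine ⟨K ∪ K', hK.union hK', fun x hx => ?_⟩
    rw [mem_union, not_or] at hx
    simp [h0 x hx.1, h0' x hx.2]

lemma extDeriv_smul_one {E : Type*} [NormedAddCommGroup E] [NormedSpace ℝ E]
    {h : E → ℝ} {ξ : E → E [⋀^Fin 1]→L[ℝ] ℝ} {z : E} (hh : DifferentiableAt ℝ h z)
    (hξ : DifferentiableAt ℝ ξ z) (v : Fin 2 → E) :
    extDeriv (fun z => h z • ξ z) z v = h z * extDeriv ξ z v +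
      (fderiv ℝ h z (v 0) * ξ z (fun _ => v 1) - fderiv ℝ h z (v 1) * ξ z (fun _ => v 0)) := by
  rw [extDeriv_apply (hh.fun_smul hξ), extDeriv_apply hξ]
  have e0 : Fin.removeNth 0 v = fun _ => v 1 := by
    ext i; fin_cases i; rfl
  have e1 : Fin.removeNth 1 v = fun _ => v 0 := by
    ext i; fin_cases i; rfl
  have key : ∀ w u, fderiv ℝ (fun y => (h y • ξ y) w) z u
      = fderiv ℝ h z u * ξ z w + h z * fderiv ℝ (fun y => ξ y w) z u := by
    intro w u
    have hd : DifferentiableAt ℝ (fun y => ξ y w) z :=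
      hξ.continuousAlternatingMap_apply_const w
    simp only [ContinuousAlternatingMap.smul_apply, smul_eq_mul]
    rw [fderiv_fun_mul hh hd]
    simp; ring
  rw [Fin.sum_univ_two, Fin.sum_univ_two, e0, e1, key, key]
  simp only [Fin.val_zero, Fin.val_one, pow_zero, pow_one, one_smul, neg_smul]
  ring

/-- Leibniz rule `d(gα) = g dα + dg ∧ α`. By linearity of `α`, the value `dg(v₀) α(v₁) - dg(v₁)
α(v₀)` of `dg ∧ α` is `α` applied to the single vector `kernelVector`. -/
lemma DiffForm.IsTest.d_fsmul [T2Space X] {α : DiffForm m 1 X} (hα : α.IsTest) {g : X → ℝ}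
    (hg : ContMDiff (𝓡 m) 𝓘(ℝ, ℝ) ∞ g) (x : X) (v : Fin 2 → TangentSpace (𝓡 m) x) :
    (α.fsmul g).d x v = g x * α.d x v + α x (fun _ => kernelVector (dfun g x) v) := by
  have hxx : x ∈ (extChartAt (𝓡 m) x).source := mem_extChartAt_source x
  have ht := (extChartAt (𝓡 m) x).map_source hxx
  have hw := hα.fsmul hg
  rw [DiffForm.apply_eq_inChart _ hxx, hw.d_inChart ht]
  have e : (α.fsmul g).inChart x = fun z =>
      (g ∘ (extChartAt (𝓡 m) x).symm) z • α.inChart x z := by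
    ext1 z; exact α.inChart_fsmul g x z
  have hgx : MDifferentiableAt (𝓡 m) 𝓘(ℝ, ℝ) g x := (hg x).mdifferentiableAt (by simp)
  have hd := hasFDerivAt_comp_chart_symm hxx hgx
  rw [e, extDeriv_smul_one hd.differentiableAt
    ((hα.contDiffAt_inChart ht).differentiableAt (by simp)), hd.fderiv]
  rw [α.d.apply_eq_inChart hxx, hα.d_inChart ht, α.apply_eq_inChart hxx]
  simp only [Function.comp_apply, (extChartAt (𝓡 m) x).left_inv hxx,
    ContinuousLinearMap.comp_apply, dsymm_dchart hxx, kernelVector, map_sub, map_smul]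
  congr 1
  have lin : ∀ (η : EuclideanSpace ℝ (Fin m) [⋀^Fin 1]→L[ℝ] ℝ) (a b : ℝ)
      (u w : EuclideanSpace ℝ (Fin m)), η (fun _ => a • u - b • w) =
        a * η (fun _ => u) - b * η (fun _ => w) := by
    intro η a b u w
    have h : ∀ u, η (fun _ => u) =
      (ContinuousAlternatingMap.ofSubsingleton ℝ (EuclideanSpace ℝ (Fin m)) ℝ (0 : Fin 1)).symm η u :=
      fun u => rfl
    simp only [h, map_sub, map_smul, smul_eq_mul]
  rw [lin]

end Charts

/-! ### Charts compared with the Riemannian distance. -/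

section LocalGeometry

open scoped Topology

variable {m n : ℕ} {X : Type*} [EMetricSpace X]
  [ChartedSpace (EuclideanSpace ℝ (Fin m)) X] [IsManifold (𝓡 m) ∞ X]
  [RiemannianBundle (fun x : X => TangentSpace (𝓡 m) x)]

lemma isContinuousRiemannianBundle_of_contMDiff
    [h : IsContMDiffRiemannianBundle (𝓡 m) ∞ (EuclideanSpace ℝ (Fin m))
      (fun x : X => TangentSpace (𝓡 m) x)] :
    IsContinuousRiemannianBundle (EuclideanSpace ℝ (Fin m))
      (fun x : X => TangentSpace (𝓡 m) x) := by
  obtain ⟨g, hg, h⟩ := h.exists_contMDiff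
  exact ⟨g, hg.continuous, h⟩

/-- The Riemannian norm at the center of a chart, as a norm on the model space. -/
def chartNorm (c : X) (w : EuclideanSpace ℝ (Fin m)) : ℝ := ‖dsymm c c w‖

lemma chartNorm_nonneg (c : X) (w : EuclideanSpace ℝ (Fin m)) : 0 ≤ chartNorm c w := norm_nonneg _

lemma chartNorm_smul (c : X) (r : ℝ) (w : EuclideanSpace ℝ (Fin m)) :
    chartNorm c (r • w) = |r| * chartNorm c w := by
  simp [chartNorm, norm_smul]

lemma chartNorm_le (c : X) : ∃ K : ℝ, 0 ≤ K ∧ ∀ w : EuclideanSpace ℝ (Fin m),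
    chartNorm c w ≤ K * ‖w‖ :=
  ⟨‖dsymm (m := m) c c‖, ContinuousLinearMap.opNorm_nonneg _, fun w => (dsymm (m := m) c c).le_opNorm w⟩

lemma le_chartNorm (c : X) : ∃ K : ℝ, 0 ≤ K ∧ ∀ w : EuclideanSpace ℝ (Fin m),
    ‖w‖ ≤ K * chartNorm c w := by
  refine ⟨‖dchart (m := m) c c‖, ContinuousLinearMap.opNorm_nonneg _, fun w => ?_⟩
  have := (dchart (m := m) c c).le_opNorm (dsymm c c w)
  rwa [dchart_dsymm (mem_extChartAt_source c)] at this

/-- The open set `U` lies in the domain of the preferred chart at `c`, and there the Riemannian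
norm agrees with the norm at `c` up to a factor `κ`. -/
structure IsAdapted (m : ℕ) {X : Type*} [EMetricSpace X]
  [ChartedSpace (EuclideanSpace ℝ (Fin m)) X] [IsManifold (𝓡 m) ∞ X]
  [RiemannianBundle (fun x : X => TangentSpace (𝓡 m) x)] (κ : ℝ) (c : X) (U : Set X) : Prop where
  isOpen : IsOpen U
  subset_source : U ⊆ (extChartAt (𝓡 m) c).source
  chartNorm_dchart_le : ∀ y ∈ U, ∀ v : TangentSpace (𝓡 m) y, chartNorm c (dchart c y v) ≤ κ * ‖v‖
  norm_dsymm_le : ∀ y ∈ U, ∀ w : EuclideanSpace ℝ (Fin m), ‖dsymm c y w‖ ≤ κ * chartNorm c w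

variable [IsContinuousRiemannianBundle (EuclideanSpace ℝ (Fin m))
      (fun x : X => TangentSpace (𝓡 m) x)]

lemma exists_isAdapted {κ : ℝ} (hκ : 1 < κ) (c : X) :
    ∃ U : Set X, c ∈ U ∧ IsAdapted m κ c U := by
  have h1 := eventually_norm_symmL_trivializationAt_self_comp_lt (EuclideanSpace ℝ (Fin m))
    (fun x : X => TangentSpace (𝓡 m) x) c hκ
  have h2 := eventually_norm_symmL_trivializationAt_comp_self_lt (EuclideanSpace ℝ (Fin m))
    (fun x : X => TangentSpace (𝓡 m) x) c hκ
  have h3 := extChartAt_source_mem_nhds (I := 𝓡 m) c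
  obtain ⟨U, hU, hUo, hc⟩ := mem_nhds_iff.1 (Filter.inter_mem (Filter.inter_mem h1 h2) h3)
  refine ⟨U, hc, hUo, fun y hy => (hU hy).2, fun y hy v => ?_, fun y hy w => ?_⟩
  · refine (ContinuousLinearMap.le_opNorm (dsymm c c ∘L dchart (m := m) c y) v).trans ?_
    exact mul_le_mul_of_nonneg_right (hU hy).1.1.le (norm_nonneg _)
  · have := ContinuousLinearMap.le_opNorm (dsymm c y ∘L dchart (m := m) c c) (dsymm c c w)
    rw [ContinuousLinearMap.comp_apply, dchart_dsymm (mem_extChartAt_source c)] at this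
    exact this.trans (mul_le_mul_of_nonneg_right (hU hy).1.2.le (norm_nonneg _))

variable [IsRiemannianManifold (𝓡 m) X]

lemma edist_le_pathELength {γ : ℝ → X} (hγ : ContMDiff 𝓘(ℝ, ℝ) (𝓡 m) 1 γ) {t : ℝ}
    (h0 : 0 ≤ t) : edist (γ 0) (γ t) ≤ pathELength (𝓡 m) γ 0 t := by
  rw [IsRiemannianManifold.out (I := 𝓡 m)]
  exact riemannianEDist_le_pathELength hγ.contMDiffOn rfl rfl h0

/-- Almost shortest paths between points near `c` stay in the adapted neighbourhood, where the chart
stretches lengths by a bounded factor. -/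
lemma exists_lipschitzOnWith_extChartAt (c : X) :
    ∃ U : Set X, c ∈ U ∧ IsOpen U ∧ ∃ K : ℝ≥0, LipschitzOnWith K (extChartAt (𝓡 m) c) U := by
  obtain ⟨V, hcV, hV⟩ := exists_isAdapted (m := m) one_lt_two c
  obtain ⟨K, hK0, hK⟩ := le_chartNorm (m := m) c
  obtain ⟨r, hr, hrV⟩ := EMetric.mem_nhds_iff.1 (hV.isOpen.mem_nhds hcV)
  set K' : ℝ≥0 := ⟨K * 2, by positivity⟩
  have hK' : (K' : ℝ) = K * 2 := rfl
  refine ⟨Metric.eball c (r / 3), Metric.mem_eball_self (by simpa using hr.ne'),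
    Metric.isOpen_eball, K', fun y hy z hz => ?_⟩
  have hyz : edist y z < r / 3 + r / 3 := by
    calc edist y z ≤ edist y c + edist z c := edist_triangle_right _ _ _
      _ < _ := ENNReal.add_lt_add hy hz
  -- A path from `y` of length less than `ℓ ≤ 2r/3`, with `y` within `r/3` of `c`, cannot leave the
  -- ball of radius `r`.
  have key : ∀ ℓ : ℝ≥0∞, edist y z < ℓ → ℓ ≤ r / 3 + r / 3 →
      edist (extChartAt (𝓡 m) c y) (extChartAt (𝓡 m) c z) ≤ K' * ℓ := by
    intro ℓ hℓ hℓr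
    rw [IsRiemannianManifold.out (I := 𝓡 m)] at hℓ
    obtain ⟨γ, h0, h1, hγ, hlen, -⟩ := exists_lt_locally_constant_of_riemannianEDist_lt hℓ zero_lt_one
    have hmem : ∀ t ∈ Icc (0 : ℝ) 1, γ t ∈ V := by
      intro t ht
      apply hrV
      have h2 : edist y (γ t) < ℓ := by
        rw [← h0]
        exact ((edist_le_pathELength hγ ht.1).trans (pathELength_mono le_rfl ht.2)).trans_lt hlen
      calc edist (γ t) c ≤ edist y (γ t) + edist y c := edist_triangle_left _ _ _
        _ < (r / 3 + r / 3) + r / 3 := ENNReal.add_lt_add (h2.trans_le hℓr) hy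
        _ = r := ENNReal.add_thirds r
    have hder : ∀ t ∈ Icc (0 : ℝ) 1, HasDerivAt (fun t => extChartAt (𝓡 m) c (γ t))
        (dchart c (γ t) (mfderiv 𝓘(ℝ, ℝ) (𝓡 m) γ t (1 : ℝ))) t := by
      intro t ht
      have h1 := hasMFDerivAt_extChartAt (hV.subset_source (hmem t ht))
      have h2 := (hγ.mdifferentiable one_ne_zero t).hasMFDerivAt
      have h3 : HasFDerivAt (fun t => extChartAt (𝓡 m) c (γ t))
          (dchart c (γ t) ∘L (mfderiv 𝓘(ℝ, ℝ) (𝓡 m) γ t : ℝ →L[ℝ] TangentSpace (𝓡 m) (γ t))) t :=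
        (h1.comp t h2).hasFDerivAt
      exact h3.hasDerivAt
    have hsm : ContDiffOn ℝ 1 (fun t => extChartAt (𝓡 m) c (γ t)) (Icc 0 1) := by
      rw [← contMDiffOn_iff_contDiffOn]
      exact contMDiffOn_extChartAt.comp (t := (chartAt _ c).source) hγ.contMDiffOn
        fun t ht => by simpa using hV.subset_source (hmem t ht)
    calc edist (extChartAt (𝓡 m) c y) (extChartAt (𝓡 m) c z)
        = ‖extChartAt (𝓡 m) c (γ 1) - extChartAt (𝓡 m) c (γ 0)‖ₑ := by
          rw [h0, h1, edist_comm, edist_eq_enorm_sub]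
      _ ≤ ∫⁻ t in Icc (0 : ℝ) 1, ‖derivWithin (fun t => extChartAt (𝓡 m) c (γ t)) (Icc 0 1) t‖ₑ :=
          enorm_sub_le_lintegral_derivWithin_Icc_of_contDiffOn_Icc hsm zero_le_one
      _ ≤ ∫⁻ t in Icc (0 : ℝ) 1, K' * ‖mfderiv 𝓘(ℝ, ℝ) (𝓡 m) γ t (1 : ℝ)‖ₑ := by
          refine setLIntegral_mono' measurableSet_Icc fun t ht => ?_
          rw [(hder t ht).hasDerivWithinAt.derivWithin (uniqueDiffOn_Icc zero_lt_one t ht)]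
          have hb : ‖dchart c (γ t) (mfderiv 𝓘(ℝ, ℝ) (𝓡 m) γ t (1 : ℝ))‖ ≤
              K' * ‖mfderiv 𝓘(ℝ, ℝ) (𝓡 m) γ t (1 : ℝ)‖ := by
            refine (hK _).trans ?_
            have := hV.chartNorm_dchart_le _ (hmem t ht) (mfderiv 𝓘(ℝ, ℝ) (𝓡 m) γ t (1 : ℝ))
            calc _ ≤ K * (2 * ‖mfderiv 𝓘(ℝ, ℝ) (𝓡 m) γ t (1 : ℝ)‖) := by gcongr
              _ = _ := by rw [hK']; ring
          rw [← ofReal_norm, ← ofReal_norm, ← ENNReal.ofReal_coe_nnreal,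
            ← ENNReal.ofReal_mul (by positivity)]
          exact ENNReal.ofReal_le_ofReal hb
      _ = K' * pathELength (𝓡 m) γ 0 1 := by
          rw [lintegral_const_mul' _ _ ENNReal.coe_ne_top, pathELength_eq_lintegral_mfderiv_Icc]
          rfl
      _ ≤ K' * ℓ := by gcongr
  -- The infimum of lengths need not be attained, so `ℓ` decreases to the distance.
  have hlim : Filter.Tendsto (fun ℓ : ℝ≥0∞ => K' * ℓ) (𝓝[>] (edist y z)) (𝓝 (K' * edist y z)) :=
    (ENNReal.Tendsto.const_mul Filter.tendsto_id (Or.inr ENNReal.coe_ne_top)).mono_left nhdsWithin_le_nhds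
  have : (𝓝[>] (edist y z)).NeBot := nhdsGT_neBot_of_exists_gt ⟨_, hyz⟩
  refine ge_of_tendsto hlim ?_
  filter_upwards [Ioo_mem_nhdsGT hyz] with ℓ hℓ using key ℓ hℓ.1 hℓ.2.le

/-- The straight segment in the chart is a path of at most this length. Measuring with the norm at
`c` keeps the constant `κ` close to one, which the approximation with gradient `1 + ε` requires. -/
lemma edist_extChartAt_symm_le {κ r : ℝ} {c : X} {U : Set X} (hU : IsAdapted m κ c U)
    {z₀ : EuclideanSpace ℝ (Fin m)}
    (hr : ∀ z ∈ Metric.ball z₀ r, z ∈ (extChartAt (𝓡 m) c).target ∧ (extChartAt (𝓡 m) c).symm z ∈ U)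
    {z w : EuclideanSpace ℝ (Fin m)} (hz : z ∈ Metric.ball z₀ r) (hw : w ∈ Metric.ball z₀ r) :
    edist ((extChartAt (𝓡 m) c).symm z) ((extChartAt (𝓡 m) c).symm w) ≤
      ENNReal.ofReal (κ * chartNorm c (w - z)) := by
  set η : ℝ → EuclideanSpace ℝ (Fin m) := fun t => z + t • (w - z) with hη
  have hmem : ∀ t ∈ Icc (0 : ℝ) 1, η t ∈ Metric.ball z₀ r := by
    intro t ht
    have := (convex_ball z₀ r).segment_subset hz hw
    rw [segment_eq_image'] at this
    exact this ⟨t, ht, rfl⟩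
  have hηd : ContDiff ℝ 1 η := by fun_prop
  set γ : ℝ → X := (extChartAt (𝓡 m) c).symm ∘ η with hγ
  have hder : ∀ t ∈ Icc (0 : ℝ) 1, HasMFDerivAt 𝓘(ℝ, ℝ) (𝓡 m) γ t
      (dsymm c (γ t) ∘L fderiv ℝ η t) := by
    intro t ht
    have hb := (hr _ (hmem t ht)).1
    have h1 := hasMFDerivAt_extChartAt_symm ((extChartAt (𝓡 m) c).map_target hb)
    rw [(extChartAt (𝓡 m) c).right_inv hb] at h1
    have h2 := (hηd.differentiable one_ne_zero t).hasFDerivAt.hasMFDerivAt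
    exact h1.comp t h2
  have hη' : ∀ t, fderiv ℝ η t 1 = w - z := by
    intro t
    have : HasDerivAt η (w - z) t := by
      simpa [hη] using ((hasDerivAt_id t).smul_const (w - z)).const_add z
    rw [this.hasFDerivAt.fderiv]; simp
  have hsm : ContMDiffOn 𝓘(ℝ, ℝ) (𝓡 m) 1 γ (Icc 0 1) :=
    (contMDiffOn_extChartAt_symm c).comp hηd.contMDiff.contMDiffOn fun t ht => (hr _ (hmem t ht)).1
  rw [IsRiemannianManifold.out (I := 𝓡 m)]
  refine (riemannianEDist_le_pathELength hsm (by simp [hγ, hη]) (by simp [hγ, hη])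
    zero_le_one).trans ?_
  rw [pathELength_eq_lintegral_mfderiv_Icc]
  calc ∫⁻ t in Icc (0 : ℝ) 1, ‖mfderiv 𝓘(ℝ, ℝ) (𝓡 m) γ t (1 : ℝ)‖ₑ
      ≤ ∫⁻ t in Icc (0 : ℝ) 1, ENNReal.ofReal (κ * chartNorm c (w - z)) := by
        refine setLIntegral_mono' measurableSet_Icc fun t ht => ?_
        rw [(hder t ht).mfderiv, ← ofReal_norm]
        refine ENNReal.ofReal_le_ofReal ?_
        have := hU.norm_dsymm_le (γ t) (hr _ (hmem t ht)).2 (fderiv ℝ η t 1)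
        rw [hη'] at this
        refine le_trans (le_of_eq ?_) this
        show ‖dsymm c (γ t) (fderiv ℝ η t 1)‖ = _
        rw [hη' t]
    _ = _ := by simp

end LocalGeometry

/-! ### Bounds for compactly supported forms and for differentials on compact sets. -/

section ComassBounds

open scoped Topology

variable {m n : ℕ} {X : Type*} [EMetricSpace X]
  [ChartedSpace (EuclideanSpace ℝ (Fin m)) X] [IsManifold (𝓡 m) ∞ X]
  [RiemannianBundle (fun x : X => TangentSpace (𝓡 m) x)]
  [IsContinuousRiemannianBundle (EuclideanSpace ℝ (Fin m))
      (fun x : X => TangentSpace (𝓡 m) x)]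

variable (m) in
lemma exists_norm_dchart_le (c : X) : ∃ U : Set X, c ∈ U ∧ IsOpen U ∧
    U ⊆ (extChartAt (𝓡 m) c).source ∧ ∃ B : ℝ, 0 ≤ B ∧ ∀ y ∈ U, ∀ v : TangentSpace (𝓡 m) y,
      ‖dchart c y v‖ ≤ B * ‖v‖ := by
  obtain ⟨V, hcV, hV⟩ := exists_isAdapted (m := m) one_lt_two c
  obtain ⟨K, hK0, hK⟩ := le_chartNorm (m := m) c
  refine ⟨V, hcV, hV.isOpen, hV.subset_source, K * 2, by positivity, fun y hy v => ?_⟩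
  rw [mul_assoc]
  exact (hK _).trans (mul_le_mul_of_nonneg_left (hV.chartNorm_dchart_le y hy v) hK0)

lemma DiffForm.abs_apply_le_norm_inChart {B : ℝ} {c y : X}
    (hy : y ∈ (extChartAt (𝓡 m) c).source)
    (hB : ∀ v : TangentSpace (𝓡 m) y, ‖dchart c y v‖ ≤ B * ‖v‖) (hB0 : 0 ≤ B)
    (η : DiffForm m n X) (v : Fin n → TangentSpace (𝓡 m) y) (hv : ∀ i, ‖v i‖ ≤ 1) :
    |η y v| ≤ ‖η.inChart c (extChartAt (𝓡 m) c y)‖ * B ^ n := by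
  rw [η.apply_eq_inChart hy, ← Real.norm_eq_abs]
  refine (ContinuousAlternatingMap.le_opNorm _ _).trans ?_
  gcongr
  calc ∏ i, ‖dchart c y (v i)‖ ≤ ∏ _i : Fin n, B := by
        refine Finset.prod_le_prod (fun _ _ => norm_nonneg _) fun i _ => (hB _).trans ?_
        exact mul_le_of_le_one_right hB0 (hv i)
    _ = B ^ n := by simp

/-- Forms with continuous coefficients and compact support. -/
structure DiffForm.IsContTest (η : DiffForm m n X) : Prop where
  continuousOn : ∀ c : X, ContinuousOn (η.inChart c) (extChartAt (𝓡 m) c).target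
  compact_support : ∃ K : Set X, IsCompact K ∧ ∀ x ∉ K, η x = 0

lemma DiffForm.IsTest.isContTest {η : DiffForm m n X} (hη : η.IsTest) : η.IsContTest :=
  ⟨fun c => (hη.smooth c).continuousOn, hη.compact_support⟩

lemma exists_bound_of_locally {P : X → ℝ → Prop} (hmono : ∀ x, ∀ a b, a ≤ b → P x a → P x b)
    (hloc : ∀ x, ∃ M, ∀ᶠ y in 𝓝 x, P y M) {K : Set X} (hK : IsCompact K) :
    ∃ M, 0 ≤ M ∧ ∀ x ∈ K, P x M := by
  choose M hM using hloc
  obtain ⟨t, -, ht⟩ := hK.elim_nhds_subcover (fun x => {y | P y (M x)}) fun x _ => hM x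
  -- The sum of absolute values dominates every local bound and is nonnegative even if the subcover
  -- is empty.
  refine ⟨∑ x ∈ t, |M x|, Finset.sum_nonneg fun _ _ => abs_nonneg _, fun y hy => ?_⟩
  obtain ⟨x, hx, hyx⟩ := mem_iUnion₂.1 (ht hy)
  refine hmono y _ _ ((le_abs_self _).trans ?_) hyx
  exact Finset.single_le_sum (f := fun x => |M x|) (fun _ _ => abs_nonneg _) hx

lemma DiffForm.IsContTest.exists_comass_le {η : DiffForm m n X} (hη : η.IsContTest) :
    ∃ M : ℝ, 0 ≤ M ∧ ∀ (x : X) (v : Fin n → TangentSpace (𝓡 m) x), (∀ i, ‖v i‖ ≤ 1) →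
      |η x v| ≤ M := by
  obtain ⟨K, hK, h0⟩ := hη.compact_support
  have hloc : ∀ c : X, ∃ M, ∀ᶠ y in 𝓝 c, ∀ v : Fin n → TangentSpace (𝓡 m) y,
      (∀ i, ‖v i‖ ≤ 1) → |η y v| ≤ M := by
    intro c
    obtain ⟨U, hcU, hU, hUs, B, hB0, hB⟩ := exists_norm_dchart_le m c
    have hs := hUs hcU
    have hcont : ContinuousAt (fun y => ‖η.inChart c (extChartAt (𝓡 m) c y)‖) c := by
      refine ContinuousAt.norm (ContinuousAt.comp (g := η.inChart c) ?_ (continuousAt_extChartAt c))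
      exact (hη.continuousOn c).continuousAt
        ((isOpen_target c).mem_nhds ((extChartAt (𝓡 m) c).map_source hs))
    refine ⟨(‖η.inChart c (extChartAt (𝓡 m) c c)‖ + 1) * B ^ n, ?_⟩
    filter_upwards [hU.mem_nhds hcU, hcont.eventually_lt_const (lt_add_one _)] with y hy hy' v hv
    refine (η.abs_apply_le_norm_inChart (hUs hy) (hB y hy) hB0 v hv).trans ?_
    gcongr
  obtain ⟨M, hM0, hM⟩ := exists_bound_of_locally
    (P := fun x M => ∀ v : Fin n → TangentSpace (𝓡 m) x, (∀ i, ‖v i‖ ≤ 1) → |η x v| ≤ M)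
    (fun x a b hab h v hv => (h v hv).trans hab) hloc hK
  refine ⟨M, hM0, fun x v hv => ?_⟩
  by_cases hx : x ∈ K
  · exact hM x hx v hv
  · rw [h0 x hx]; simpa using hM0

lemma exists_abs_dfun_le {g : X → ℝ} (hg : ContMDiff (𝓡 m) 𝓘(ℝ, ℝ) ∞ g) {K : Set X}
    (hK : IsCompact K) : ∃ M : ℝ, 0 ≤ M ∧ ∀ x ∈ K, ∀ v : TangentSpace (𝓡 m) x,
      |dfun g x v| ≤ M * ‖v‖ := by
  refine exists_bound_of_locally (P := fun x M => ∀ v : TangentSpace (𝓡 m) x,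
      |dfun g x v| ≤ M * ‖v‖)
    (fun x a b hab h v => (h v).trans (by gcongr)) (fun c => ?_) hK
  obtain ⟨U, hcU, hU, hUs, B, hB0, hB⟩ := exists_norm_dchart_le m c
  have hs := hUs hcU
  have hcont : ContinuousAt (fun y => ‖fderiv ℝ (g ∘ (extChartAt (𝓡 m) c).symm)
      (extChartAt (𝓡 m) c y)‖) c := by
    refine ContinuousAt.norm (ContinuousAt.comp
      (g := fderiv ℝ (g ∘ (extChartAt (𝓡 m) c).symm)) ?_ (continuousAt_extChartAt c))
    exact ((contDiffAt_comp_chart_symm hs (hg c)).fderiv_right (m := ∞) (by simp)).continuousAt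
  refine ⟨(‖fderiv ℝ (g ∘ (extChartAt (𝓡 m) c).symm) (extChartAt (𝓡 m) c c)‖ + 1) * B, ?_⟩
  filter_upwards [hU.mem_nhds hcU, hcont.eventually_lt_const (lt_add_one _)] with y hy hy' v
  have hd := hasFDerivAt_comp_chart_symm (hUs hy) ((hg y).mdifferentiableAt (by simp))
  have e : dfun g y v = fderiv ℝ (g ∘ (extChartAt (𝓡 m) c).symm) (extChartAt (𝓡 m) c y)
      (dchart c y v) := by
    rw [hd.fderiv, ContinuousLinearMap.comp_apply, dsymm_dchart (hUs hy)]
  rw [e, ← Real.norm_eq_abs, mul_assoc]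
  refine (ContinuousLinearMap.le_opNorm _ _).trans ?_
  gcongr
  exact hB y hy v

end ComassBounds

/-! ### Lipschitz maps into `X`: almost everywhere differentiability and measurability of the
derivative. -/

section Rademacher

open scoped Topology

variable {m n : ℕ} {X : Type*} [EMetricSpace X]
  [ChartedSpace (EuclideanSpace ℝ (Fin m)) X] [IsManifold (𝓡 m) ∞ X]
  [RiemannianBundle (fun x : X => TangentSpace (𝓡 m) x)]
  [IsContinuousRiemannianBundle (EuclideanSpace ℝ (Fin m))
      (fun x : X => TangentSpace (𝓡 m) x)]

/-- The derivative of `f : s → X`, read in the preferred chart at `c`. -/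
def chartDeriv (c : X) (f : EuclideanSpace ℝ (Fin n) → X) (s : Set (EuclideanSpace ℝ (Fin n)))
    (u : EuclideanSpace ℝ (Fin n)) : EuclideanSpace ℝ (Fin n) →L[ℝ] EuclideanSpace ℝ (Fin m) :=
  dchart c (f u) ∘L
    (mfderivWithin 𝓘(ℝ, EuclideanSpace ℝ (Fin n)) (𝓡 m) f s u :
      EuclideanSpace ℝ (Fin n) →L[ℝ] TangentSpace (𝓡 m) (f u))

lemma DiffForm.apply_partials (η : DiffForm m n X) {c : X} (f : EuclideanSpace ℝ (Fin n) → X)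
    (s : Set (EuclideanSpace ℝ (Fin n))) {u : EuclideanSpace ℝ (Fin n)}
    (hu : f u ∈ (extChartAt (𝓡 m) c).source) :
    η (f u) (partials m f s u) = η.inChart c (extChartAt (𝓡 m) c (f u))
      fun j => chartDeriv c f s u (EuclideanSpace.single j (1 : ℝ)) := by
  rw [η.apply_eq_inChart hu]; rfl

lemma hasFDerivWithinAt_chart {c : X} {f : EuclideanSpace ℝ (Fin n) → X}
    {s : Set (EuclideanSpace ℝ (Fin n))} {u : EuclideanSpace ℝ (Fin n)}
    (hu : f u ∈ (extChartAt (𝓡 m) c).source)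
    (hf : MDifferentiableWithinAt 𝓘(ℝ, EuclideanSpace ℝ (Fin n)) (𝓡 m) f s u) :
    HasFDerivWithinAt (extChartAt (𝓡 m) c ∘ f) (chartDeriv c f s u) s u :=
  (HasMFDerivAt.comp_hasMFDerivWithinAt u (hasMFDerivAt_extChartAt hu)
    hf.hasMFDerivWithinAt).hasFDerivWithinAt

lemma mdifferentiableWithinAt_of_chart {c : X} {f : EuclideanSpace ℝ (Fin n) → X}
    {s : Set (EuclideanSpace ℝ (Fin n))} {u : EuclideanSpace ℝ (Fin n)}
    (hu : f u ∈ (extChartAt (𝓡 m) c).source) (hc : ContinuousWithinAt f s u)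
    {D : EuclideanSpace ℝ (Fin n) →L[ℝ] EuclideanSpace ℝ (Fin m)}
    (hd : HasFDerivWithinAt (extChartAt (𝓡 m) c ∘ f) D s u) :
    HasMFDerivWithinAt 𝓘(ℝ, EuclideanSpace ℝ (Fin n)) (𝓡 m) f s u (dsymm c (f u) ∘L D) := by
  have h1 := hasMFDerivAt_extChartAt_symm hu
  have h2 := HasMFDerivAt.comp_hasMFDerivWithinAt u h1 hd.hasMFDerivWithinAt
  have h3 : f =ᶠ[𝓝[s] u] (extChartAt (𝓡 m) c).symm ∘ (extChartAt (𝓡 m) c ∘ f) := by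
    filter_upwards [hc.preimage_mem_nhdsWithin ((isOpen_extChartAt_source c).mem_nhds hu)] with v hv
    exact ((extChartAt (𝓡 m) c).left_inv hv).symm
  exact h2.congr_of_eventuallyEq h3 ((extChartAt (𝓡 m) c).left_inv hu).symm

lemma continuous_alternating_eval {E : Type*} [NormedAddCommGroup E] [NormedSpace ℝ E] :
    Continuous fun p : (E [⋀^Fin n]→L[ℝ] ℝ) × (Fin n → E) => p.1 p.2 := by
  have h : Continuous fun p : (ContinuousMultilinearMap ℝ (fun _ : Fin n => E) ℝ) × (Fin n → E) =>
      p.1 p.2 := by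
    exact continuous_eval
  exact h.comp ((ContinuousAlternatingMap.toContinuousMultilinearMapCLM ℝ).continuous.prodMap
    continuous_id)

variable [IsRiemannianManifold (𝓡 m) X] [SecondCountableTopology X]

/-- Rademacher's theorem in countably many charts that are Lipschitz on open sets covering `X`. The
preimage of such a set is a neighbourhood within `s` of each of its points in `s`, so
differentiability there is differentiability within `s`. -/
lemma ae_mdifferentiableWithinAt {f : EuclideanSpace ℝ (Fin n) → X}
    {s : Set (EuclideanSpace ℝ (Fin n))} (hs : MeasurableSet s) {L : ℝ≥0}
    (hf : LipschitzOnWith L f s) :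
    ∀ᵐ u ∂volume.restrict s,
      MDifferentiableWithinAt 𝓘(ℝ, EuclideanSpace ℝ (Fin n)) (𝓡 m) f s u := by
  choose U hcU hU K hK using fun c : X => exists_lipschitzOnWith_extChartAt (m := m) c
  obtain ⟨T, hT, hTU⟩ := TopologicalSpace.countable_cover_nhds
    fun c : X => Filter.inter_mem ((hU c).mem_nhds (hcU c)) (extChartAt_source_mem_nhds (I := 𝓡 m) c)
  have hae : ∀ᵐ u, ∀ c ∈ T, u ∈ s ∩ f ⁻¹' (U c) →
      DifferentiableWithinAt ℝ (extChartAt (𝓡 m) c ∘ f) (s ∩ f ⁻¹' (U c)) u := by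
    rw [ae_ball_iff hT]
    intro c _
    refine LipschitzOnWith.ae_differentiableWithinAt_of_mem (C := K c * L) ?_
    exact (hK c).comp (hf.mono inter_subset_left) fun u hu => hu.2
  rw [ae_restrict_iff' hs]
  filter_upwards [hae] with u hu hus
  obtain ⟨c, hcT, hc⟩ := mem_iUnion₂.1 (hTU.symm ▸ mem_univ (f u) : f u ∈ ⋃ c ∈ T, _)
  have hcont : ContinuousWithinAt f s u := hf.continuousOn u hus
  have hd := hu c hcT ⟨hus, hc.1⟩
  have hd' : DifferentiableWithinAt ℝ (extChartAt (𝓡 m) c ∘ f) s u := by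
    refine hd.mono_of_mem_nhdsWithin (Filter.inter_mem self_mem_nhdsWithin ?_)
    exact hcont.preimage_mem_nhdsWithin ((hU c).mem_nhds hc.1)
  exact (mdifferentiableWithinAt_of_chart hc.2 hcont
    hd'.hasFDerivWithinAt).mdifferentiableWithinAt

variable [MeasurableSpace X] [BorelSpace X]

lemma measurableSet_inter_preimage_of_continuousOn {E : Type*} [TopologicalSpace E]
    [MeasurableSpace E] [OpensMeasurableSpace E] {f : E → X} {s : Set E} (hs : MeasurableSet s)
    (hf : ContinuousOn f s) {B : Set X} (hB : MeasurableSet B) : MeasurableSet (s ∩ f ⁻¹' B) := by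
  have h : Measurable fun u : s => f u := hf.domRestrict.measurable
  have := hs.subtype_image (h hB)
  convert this using 1
  ext u
  simp [and_comm]

/-- Measurability of the derivative is used for maps from a space to itself, so each coordinate of
`f` is multiplied by a fixed basis vector `e` of the source. For `n = 0` there is no such vector,
but the source is a point. -/
lemma aemeasurable_fderivWithin_apply {f : EuclideanSpace ℝ (Fin n) → EuclideanSpace ℝ (Fin m)}
    {D : EuclideanSpace ℝ (Fin n) → EuclideanSpace ℝ (Fin n) →L[ℝ] EuclideanSpace ℝ (Fin m)}
    {P : Set (EuclideanSpace ℝ (Fin n))} (hP : MeasurableSet P)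
    (hd : ∀ u ∈ P, HasFDerivWithinAt f (D u) P u) (v : EuclideanSpace ℝ (Fin n)) :
    AEMeasurable (fun u => D u v) (volume.restrict P) := by
  rcases n with _ | n
  · exact (Subsingleton.measurable).aemeasurable
  set e : EuclideanSpace ℝ (Fin (n + 1)) := EuclideanSpace.single 0 1
  have key : ∀ i, AEMeasurable (fun u => D u v i) (volume.restrict P) := by
    intro i
    have h1 : ∀ u ∈ P, HasFDerivWithinAt (fun u => f u i • e)
        ((EuclideanSpace.proj i ∘L D u).smulRight e) P u := fun u hu =>
      ((EuclideanSpace.proj (𝕜 := ℝ) i).hasFDerivAt.comp_hasFDerivWithinAt u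
        (hd u hu)).smul_const e
    have h2 := aemeasurable_fderivWithin volume hP h1
    have h3 : Continuous fun A : EuclideanSpace ℝ (Fin (n + 1)) →L[ℝ]
        EuclideanSpace ℝ (Fin (n + 1)) => A v 0 := by fun_prop
    refine (h3.measurable.comp_aemeasurable h2).congr (Filter.Eventually.of_forall fun u => ?_)
    simp [e]
  have h := aemeasurable_pi_lambda (fun u => fun i => D u v i) key
  exact (PiLp.continuous_toLp 2 _).measurable.comp_aemeasurable h

lemma aemeasurable_chartDeriv {f : EuclideanSpace ℝ (Fin n) → X}
    {s : Set (EuclideanSpace ℝ (Fin n))} (hs : MeasurableSet s) {L : ℝ≥0}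
    (hf : LipschitzOnWith L f s) (c : X) {P : Set (EuclideanSpace ℝ (Fin n))}
    (hP : MeasurableSet P) (hPs : P ⊆ s) (hPc : ∀ u ∈ P, f u ∈ (extChartAt (𝓡 m) c).source)
    (v : EuclideanSpace ℝ (Fin n)) :
    AEMeasurable (fun u => chartDeriv (m := m) c f s u v) (volume.restrict P) := by
  have hae := ae_mdifferentiableWithinAt (m := m) hs hf
  rw [ae_restrict_iff' hs] at hae
  -- A measurable null set `N` containing the bad points is removed, so that the derivative exists
  -- at every remaining point.
  obtain ⟨N, hN, hNm, hN0⟩ := exists_measurable_superset_of_null hae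
  have hd : ∀ u ∈ P \ N, HasFDerivWithinAt (extChartAt (𝓡 m) c ∘ f) (chartDeriv c f s u)
      (P \ N) u := by
    intro u hu
    have h : MDifferentiableWithinAt 𝓘(ℝ, EuclideanSpace ℝ (Fin n)) (𝓡 m) f s u := by
      by_contra h
      exact hu.2 (hN fun h' => h (h' (hPs hu.1)))
    exact (hasFDerivWithinAt_chart (hPc u hu.1) h).mono (sdiff_subset.trans hPs)
  have := aemeasurable_fderivWithin_apply (hP.diff hNm) hd v
  rwa [Measure.restrict_congr_set (sdiff_null_ae_eq_self hN0)] at this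

lemma aestronglyMeasurable_apply_partials {f : EuclideanSpace ℝ (Fin n) → X}
    {s : Set (EuclideanSpace ℝ (Fin n))} (hs : MeasurableSet s) {L : ℝ≥0}
    (hf : LipschitzOnWith L f s) {η : DiffForm m n X}
    (hη : ∀ c : X, ContinuousOn (η.inChart c) (extChartAt (𝓡 m) c).target) :
    AEStronglyMeasurable (fun u => η (f u) (partials m f s u)) (volume.restrict s) := by
  obtain ⟨T, hT, hTU⟩ := TopologicalSpace.countable_cover_nhds
    fun c : X => extChartAt_source_mem_nhds (I := 𝓡 m) c
  have hcov : s = ⋃ c : T, s ∩ f ⁻¹' (extChartAt (𝓡 m) (c : X)).source := by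
    rw [← inter_iUnion, ← preimage_iUnion, ← biUnion_eq_iUnion T fun c _ => (extChartAt (𝓡 m) c).source,
      hTU, preimage_univ, inter_univ]
  have : Countable T := hT.to_subtype
  suffices h : AEStronglyMeasurable (fun u => η (f u) (partials m f s u))
      (volume.restrict (⋃ c : T, s ∩ f ⁻¹' (extChartAt (𝓡 m) (c : X)).source)) by
    rwa [← hcov] at h
  rw [aestronglyMeasurable_iUnion_iff]
  rintro ⟨c, -⟩
  simp only
  have hP : MeasurableSet (s ∩ f ⁻¹' (extChartAt (𝓡 m) c).source) :=
    measurableSet_inter_preimage_of_continuousOn hs hf.continuousOn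
      (isOpen_extChartAt_source c).measurableSet
  have hD := aemeasurable_chartDeriv (m := m) hs hf c hP inter_subset_left fun u hu => hu.2
  have h1 : AEStronglyMeasurable (fun u => η.inChart c (extChartAt (𝓡 m) c (f u)))
      (volume.restrict (s ∩ f ⁻¹' (extChartAt (𝓡 m) c).source)) := by
    refine ContinuousOn.aestronglyMeasurable ?_ hP
    refine (hη c).comp ((continuousOn_extChartAt c).comp (hf.continuousOn.mono inter_subset_left)
      fun u hu => hu.2) fun u hu => (extChartAt (𝓡 m) c).map_source hu.2
  have h2 : AEStronglyMeasurable (fun u => fun j : Fin n =>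
      chartDeriv (m := m) c f s u (EuclideanSpace.single j (1 : ℝ)))
      (volume.restrict (s ∩ f ⁻¹' (extChartAt (𝓡 m) c).source)) := by
    refine AEMeasurable.aestronglyMeasurable ?_
    exact aemeasurable_pi_lambda _ fun j => hD (EuclideanSpace.single j (1 : ℝ))
  refine (continuous_alternating_eval.comp_aestronglyMeasurable (h1.prodMk h2)).congr ?_
  filter_upwards [ae_restrict_mem hP] with u hu
  exact (η.apply_partials f s hu.2).symm

end Rademacher

/-! ### A current as one integral over the disjoint union of its parameter domains. -/

section EvalIntegral

open scoped Topology

variable {m n : ℕ} {X : Type*} [EMetricSpace X]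
  [ChartedSpace (EuclideanSpace ℝ (Fin m)) X]
  [RiemannianBundle (fun x : X => TangentSpace (𝓡 m) x)]

/-- Only curves and surfaces occur. The `Fact` lets both degrees share the lemmas that follow. -/
lemma abs_alternating_le [hn : Fact (n = 1 ∨ n = 2)] {V : Type*} [NormedAddCommGroup V]
    [InnerProductSpace ℝ V] {η : V [⋀^Fin n]→L[ℝ] ℝ} {M : ℝ}
    (hη : ∀ v : Fin n → V, (∀ i, ‖v i‖ ≤ 1) → |η v| ≤ M) (v : Fin n → V) :
    |η v| ≤ M * √(Matrix.gram ℝ v).det := by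
  obtain rfl | rfl := hn.out
  · exact abs_alternating_one_le hη v
  · exact abs_alternating_two_le hη v

instance fact_one : Fact (1 = 1 ∨ 1 = 2) := ⟨Or.inl rfl⟩
instance fact_two : Fact (2 = 1 ∨ 2 = 2) := ⟨Or.inr rfl⟩

namespace RectCurrent

/-- The disjoint union of the parameter domains, as a measure space. -/
def meas (C : RectCurrent m n X) : Measure (ℕ × EuclideanSpace ℝ (Fin n)) :=
  Measure.sum fun i => (volume.restrict (C.s i)).map (Prod.mk i)

/-- The map from the parameter domains to `X`. -/
def pos (C : RectCurrent m n X) (p : ℕ × EuclideanSpace ℝ (Fin n)) : X := C.f p.1 p.2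

/-- The function on the parameter domains whose integral is `C(η)`. -/
def integrand (C : RectCurrent m n X) (η : DiffForm m n X) (p : ℕ × EuclideanSpace ℝ (Fin n)) : ℝ :=
  (C.θ p.1 p.2 : ℝ) * η (C.f p.1 p.2) (partials m (C.f p.1) (C.s p.1) p.2)

/-- The density of the total mass of the presentation. -/
def massDensity (C : RectCurrent m n X) (p : ℕ × EuclideanSpace ℝ (Fin n)) : ℝ :=
  |(C.θ p.1 p.2 : ℝ)| * jacobian m (C.f p.1) (C.s p.1) p.2

lemma massDensity_nonneg (C : RectCurrent m n X) (p : ℕ × EuclideanSpace ℝ (Fin n)) :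
    0 ≤ C.massDensity p := mul_nonneg (abs_nonneg _) (Real.sqrt_nonneg _)

/-- The total mass of the pieces of the presentation over `K`. -/
def presMass (C : RectCurrent m n X) (K : Set X) : ℝ≥0∞ :=
  ∑' i, ∫⁻ u in C.s i ∩ C.f i ⁻¹' K,
    ENNReal.ofReal (|(C.θ i u : ℝ)| * jacobian m (C.f i) (C.s i) u)

instance sFinite_meas (C : RectCurrent m n X) : SFinite C.meas := by
  unfold meas; infer_instance

lemma measurableEmbedding_prodMk (i : ℕ) :
    MeasurableEmbedding (Prod.mk i : EuclideanSpace ℝ (Fin n) → ℕ × EuclideanSpace ℝ (Fin n)) :=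
  measurableEmbedding_prodMk_left i

lemma ae_meas_iff (C : RectCurrent m n X) {P : ℕ × EuclideanSpace ℝ (Fin n) → Prop} :
    (∀ᵐ p ∂C.meas, P p) ↔ ∀ i, ∀ᵐ u ∂volume.restrict (C.s i), P (i, u) := by
  unfold meas
  rw [Measure.ae_sum_iff]
  exact forall_congr' fun i => (measurableEmbedding_prodMk i).ae_map_iff

lemma lintegral_meas (C : RectCurrent m n X) (F : ℕ × EuclideanSpace ℝ (Fin n) → ℝ≥0∞) :
    ∫⁻ p, F p ∂C.meas = ∑' i, ∫⁻ u in C.s i, F (i, u) := by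
  unfold meas
  rw [lintegral_sum_measure]
  exact tsum_congr fun i => (measurableEmbedding_prodMk i).lintegral_map _

lemma hasSum_integral_meas (C : RectCurrent m n X) {F : ℕ × EuclideanSpace ℝ (Fin n) → ℝ}
    (hF : Integrable F C.meas) :
    HasSum (fun i => ∫ u in C.s i, F (i, u)) (∫ p, F p ∂C.meas) := by
  have h := hasSum_integral_measure hF
  simp_rw [(measurableEmbedding_prodMk _).integral_map] at h
  exact h

lemma aestronglyMeasurable_meas_iff (C : RectCurrent m n X) {Y : Type*} [TopologicalSpace Y]
    [TopologicalSpace.PseudoMetrizableSpace Y] {F : ℕ × EuclideanSpace ℝ (Fin n) → Y} :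
    AEStronglyMeasurable F C.meas ↔
      ∀ i, AEStronglyMeasurable (fun u => F (i, u)) (volume.restrict (C.s i)) := by
  unfold meas
  rw [aestronglyMeasurable_sum_measure_iff]
  exact forall_congr' fun i => (measurableEmbedding_prodMk i).aestronglyMeasurable_map_iff

lemma eval_eq_integral (C : RectCurrent m n X) {η : DiffForm m n X}
    (h : Integrable (C.integrand η) C.meas) : C.eval η = ∫ p, C.integrand η p ∂C.meas :=
  (C.hasSum_integral_meas h).tsum_eq

lemma abs_integrand_le [Fact (n = 1 ∨ n = 2)] (C : RectCurrent m n X) {η : DiffForm m n X}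
    {M : ℝ} (p : ℕ × EuclideanSpace ℝ (Fin n))
    (hM : ∀ v : Fin n → TangentSpace (𝓡 m) (C.pos p), (∀ i, ‖v i‖ ≤ 1) → |η (C.pos p) v| ≤ M) :
    |C.integrand η p| ≤ M * C.massDensity p := by
  have := abs_alternating_le hM (partials m (C.f p.1) (C.s p.1) p.2)
  calc |C.integrand η p|
      = |(C.θ p.1 p.2 : ℝ)| * |η (C.f p.1 p.2) (partials m (C.f p.1) (C.s p.1) p.2)| := abs_mul _ _
    _ ≤ |(C.θ p.1 p.2 : ℝ)| * (M * jacobian m (C.f p.1) (C.s p.1) p.2) := by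
        gcongr; exact this
    _ = M * C.massDensity p := by unfold massDensity; ring

variable [IsManifold (𝓡 m) ∞ X]
  [IsContinuousRiemannianBundle (EuclideanSpace ℝ (Fin m))
      (fun x : X => TangentSpace (𝓡 m) x)]
  [IsRiemannianManifold (𝓡 m) X] [SecondCountableTopology X]
  [MeasurableSpace X] [BorelSpace X]

lemma aemeasurable_pos (C : RectCurrent m n X) : AEMeasurable C.pos C.meas := by
  have : AEStronglyMeasurable C.pos C.meas := by
    rw [aestronglyMeasurable_meas_iff]
    intro i
    obtain ⟨L, hL⟩ := C.lipschitz_f i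
    exact hL.continuousOn.aestronglyMeasurable (C.measurableSet_s i)
  exact this.aemeasurable

lemma aestronglyMeasurable_integrand (C : RectCurrent m n X) {η : DiffForm m n X}
    (hη : ∀ c : X, ContinuousOn (η.inChart c) (extChartAt (𝓡 m) c).target) :
    AEStronglyMeasurable (C.integrand η) C.meas := by
  rw [aestronglyMeasurable_meas_iff]
  intro i
  obtain ⟨L, hL⟩ := C.lipschitz_f i
  have h1 : Measurable fun u => (C.θ i u : ℝ) := measurable_from_top.comp (C.measurable_θ i)
  exact h1.aestronglyMeasurable.mul
    (aestronglyMeasurable_apply_partials (C.measurableSet_s i) hL hη)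

/-- This makes the series and integrals defining `eval` absolutely convergent on test forms, since
the presentation has finite mass over compact sets. -/
lemma lintegral_enorm_integrand_le [Fact (n = 1 ∨ n = 2)] (C : RectCurrent m n X)
    {η : DiffForm m n X} {M : ℝ} {K : Set X} (hK : MeasurableSet K) (h0 : ∀ x ∉ K, η x = 0)
    (hM : ∀ x (v : Fin n → TangentSpace (𝓡 m) x), (∀ i, ‖v i‖ ≤ 1) → |η x v| ≤ M) :
    ∫⁻ p, ‖C.integrand η p‖ₑ ∂C.meas ≤ ENNReal.ofReal M * C.presMass K := by
  rw [lintegral_meas, presMass, ← ENNReal.tsum_mul_left]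
  refine ENNReal.tsum_le_tsum fun i => ?_
  rw [← lintegral_const_mul' _ _ ENNReal.ofReal_ne_top]
  have hm := C.measurableSet_inter_preimage hK i
  calc ∫⁻ u in C.s i, ‖C.integrand η (i, u)‖ₑ
      ≤ ∫⁻ u in C.s i, (C.s i ∩ C.f i ⁻¹' K).indicator (fun u => ENNReal.ofReal M *
          ENNReal.ofReal (|(C.θ i u : ℝ)| * jacobian m (C.f i) (C.s i) u)) u := by
        refine setLIntegral_mono' (C.measurableSet_s i) fun u hu => ?_
        by_cases huK : C.f i u ∈ K
        · rw [indicator_of_mem (show u ∈ C.s i ∩ C.f i ⁻¹' K from ⟨hu, huK⟩)]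
          change _ ≤ ENNReal.ofReal M * ENNReal.ofReal (C.massDensity (i, u))
          rw [← ENNReal.ofReal_mul' (C.massDensity_nonneg _), ← ofReal_norm, Real.norm_eq_abs]
          exact ENNReal.ofReal_le_ofReal (C.abs_integrand_le (i, u) (hM _))
        · have : C.integrand η (i, u) = 0 := by simp [integrand, h0 _ huK]
          rw [this]; simp
    _ ≤ ∫⁻ u, (C.s i ∩ C.f i ⁻¹' K).indicator (fun u => ENNReal.ofReal M *
          ENNReal.ofReal (|(C.θ i u : ℝ)| * jacobian m (C.f i) (C.s i) u)) u :=
        setLIntegral_le_lintegral _ _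
    _ = _ := lintegral_indicator hm _

lemma integrable_integrand [Fact (n = 1 ∨ n = 2)] (C : RectCurrent m n X)
    {η : DiffForm m n X} (hη : η.IsContTest) : Integrable (C.integrand η) C.meas := by
  refine ⟨C.aestronglyMeasurable_integrand hη.continuousOn, ?_⟩
  obtain ⟨M, -, hM⟩ := hη.exists_comass_le
  obtain ⟨K, hK, h0⟩ := hη.compact_support
  exact (C.lintegral_enorm_integrand_le hK.isClosed.measurableSet h0 hM).trans_lt
    (ENNReal.mul_lt_top ENNReal.ofReal_lt_top (C.locally_finite K hK))

lemma eval_eq [Fact (n = 1 ∨ n = 2)] (C : RectCurrent m n X) {η : DiffForm m n X}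
    (hη : η.IsTest) : C.eval η = ∫ p, C.integrand η p ∂C.meas :=
  C.eval_eq_integral (C.integrable_integrand hη.isContTest)

lemma abs_eval_le [Fact (n = 1 ∨ n = 2)] (C : RectCurrent m n X)
    {η : DiffForm m n X} (hη : η.IsTest) {M : ℝ} (hM0 : 0 ≤ M) {K : Set X} (hK : IsCompact K)
    (h0 : ∀ x ∉ K, η x = 0)
    (hM : ∀ x (v : Fin n → TangentSpace (𝓡 m) x), (∀ i, ‖v i‖ ≤ 1) → |η x v| ≤ M) :
    |C.eval η| ≤ M * (C.presMass K).toReal := by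
  rw [C.eval_eq hη, ← Real.norm_eq_abs]
  refine (norm_integral_le_lintegral_norm _).trans ?_
  rw [← ENNReal.toReal_ofReal hM0, ← ENNReal.toReal_mul]
  refine ENNReal.toReal_mono (ENNReal.mul_lt_top ENNReal.ofReal_lt_top (C.locally_finite K hK)).ne ?_
  simp_rw [ofReal_norm]
  exact C.lintegral_enorm_integrand_le hK.isClosed.measurableSet h0 hM

lemma integrand_add (C : RectCurrent m n X) (η ζ : DiffForm m n X) (p) :
    C.integrand (η + ζ) p = C.integrand η p + C.integrand ζ p := by
  simp only [integrand, Pi.add_apply, ContinuousAlternatingMap.add_apply, mul_add]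

lemma integrand_fsmul (C : RectCurrent m n X) (g : X → ℝ) (η : DiffForm m n X) (p) :
    C.integrand (η.fsmul g) p = g (C.pos p) * C.integrand η p := by
  simp only [integrand, DiffForm.fsmul, ContinuousAlternatingMap.smul_apply, smul_eq_mul, pos]
  ring

lemma eval_add [Fact (n = 1 ∨ n = 2)] (C : RectCurrent m n X) {η ζ : DiffForm m n X}
    (hη : η.IsTest) (hζ : ζ.IsTest) : C.eval (η + ζ) = C.eval η + C.eval ζ := by
  rw [C.eval_eq hη, C.eval_eq hζ, C.eval_eq (hη.add hζ), ← integral_add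
    (C.integrable_integrand hη.isContTest) (C.integrable_integrand hζ.isContTest)]
  simp_rw [integrand_add]

lemma eval_fsmul [Fact (n = 1 ∨ n = 2)] (C : RectCurrent m n X) {η : DiffForm m n X}
    (hη : η.IsTest) {g : X → ℝ} (hg : ContMDiff (𝓡 m) 𝓘(ℝ, ℝ) ∞ g) :
    C.eval (η.fsmul g) = ∫ p, g (C.pos p) * C.integrand η p ∂C.meas := by
  rw [C.eval_eq (hη.fsmul hg)]
  simp_rw [integrand_fsmul]

lemma contMDiff_const_fun (r : ℝ) : ContMDiff (𝓡 m) 𝓘(ℝ, ℝ) ∞ fun _ : X => r := contMDiff_const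

lemma eval_const_fsmul [Fact (n = 1 ∨ n = 2)] (C : RectCurrent m n X) {η : DiffForm m n X}
    (hη : η.IsTest) (r : ℝ) : C.eval (η.fsmul fun _ => r) = r * C.eval η := by
  rw [C.eval_fsmul hη (contMDiff_const_fun r), C.eval_eq hη, integral_const_mul]

lemma ae_mem_s (C : RectCurrent m n X) : ∀ᵐ p ∂C.meas, p.2 ∈ C.s p.1 := by
  rw [ae_meas_iff]; exact fun i => ae_restrict_mem (C.measurableSet_s i)

lemma integrand_restrict_ae (C : RectCurrent m n X) {B : Set X} (hB : MeasurableSet B)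
    (η : DiffForm m n X) : (C.restrict B hB).integrand η =ᵐ[C.meas]
      fun p => B.indicator (fun _ => 1) (C.pos p) * C.integrand η p := by
  filter_upwards [C.ae_mem_s] with p hp
  simp only [integrand, restrict, pos]
  by_cases h : C.f p.1 p.2 ∈ B
  · rw [indicator_of_mem (show p.2 ∈ C.s p.1 ∩ C.f p.1 ⁻¹' B from ⟨hp, h⟩), indicator_of_mem h,
      one_mul]
    rfl
  · rw [indicator_of_notMem (fun h' => h h'.2), indicator_of_notMem h]
    simp

lemma eval_restrict [Fact (n = 1 ∨ n = 2)] (C : RectCurrent m n X) {B : Set X}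
    (hB : MeasurableSet B) {η : DiffForm m n X} (hη : η.IsTest) :
    (C.restrict B hB).eval η =
      ∫ p, B.indicator (fun _ => (1 : ℝ)) (C.pos p) * C.integrand η p ∂C.meas := by
  rw [RectCurrent.eval_eq _ hη]
  exact integral_congr_ae (C.integrand_restrict_ae hB η)

/-- Dominated convergence: if smooth functions `χ j : X → [0,1]` converge pointwise to the
indicator of `B`, then `C(χ j η)` converges to `(C ⌞ B)(η)`. -/
lemma tendsto_eval_fsmul [Fact (n = 1 ∨ n = 2)] (C : RectCurrent m n X) {B : Set X}
    (hB : MeasurableSet B) {η : DiffForm m n X} (hη : η.IsTest) {ι : Type*} {l : Filter ι}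
    [l.IsCountablyGenerated] {χ : ι → X → ℝ} (hχ : ∀ j, ContMDiff (𝓡 m) 𝓘(ℝ, ℝ) ∞ (χ j))
    (h01 : ∀ j x, |χ j x| ≤ 1)
    (hlim : ∀ x, Filter.Tendsto (fun j => χ j x) l (𝓝 (B.indicator (fun _ => (1 : ℝ)) x))) :
    Filter.Tendsto (fun j => C.eval (η.fsmul (χ j))) l (𝓝 ((C.restrict B hB).eval η)) := by
  rw [C.eval_restrict hB hη]
  simp_rw [C.eval_fsmul hη (hχ _)]
  have hint := C.integrable_integrand hη.isContTest
  refine tendsto_integral_filter_of_dominated_convergence (fun p => ‖C.integrand η p‖)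
    (Filter.Eventually.of_forall fun j => ?_) (Filter.Eventually.of_forall fun j =>
      Filter.Eventually.of_forall fun p => ?_) hint.norm
    (Filter.Eventually.of_forall fun p => (hlim (C.pos p)).mul_const _)
  · exact ((hχ j).continuous.measurable.comp_aemeasurable
      C.aemeasurable_pos).aestronglyMeasurable.mul hint.aestronglyMeasurable
  · rw [norm_mul]
    exact mul_le_of_le_one_left (norm_nonneg _) (h01 j _)

lemma le_mass_of_comassLEOne (C : RectCurrent m n X) {η : DiffForm m n X} (hη : η.IsTest)
    (h1 : η.ComassLEOne) : ENNReal.ofReal (C.eval η) ≤ C.mass :=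
  le_iSup₂_of_le η hη (le_iSup (fun _ : η.ComassLEOne => ENNReal.ofReal (C.eval η)) h1)

/-- A bound for the comass gives a bound for the value in terms of the mass. -/
lemma eval_le_mul_mass [Fact (n = 1 ∨ n = 2)] (C : RectCurrent m n X) (hC : C.mass < ⊤)
    {η : DiffForm m n X} (hη : η.IsTest) {M : ℝ}
    (hM : ∀ x (v : Fin n → TangentSpace (𝓡 m) x), (∀ i, ‖v i‖ ≤ 1) → |η x v| ≤ M) (hM0 : 0 ≤ M) :
    C.eval η ≤ M * C.mass.toReal := by
  refine le_of_forall_gt_imp_ge_of_dense fun b hb => ?_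
  -- The form is normalised by some `N > M` and not by `M`, which may be zero; then `N` decreases to
  -- `M`.
  have key : ∀ N > M, C.eval η ≤ N * C.mass.toReal := by
    intro N hN
    have hN0 : 0 < N := hM0.trans_lt hN
    have h1 : (η.fsmul fun _ => N⁻¹).ComassLEOne := by
      intro x v hv
      simp only [DiffForm.fsmul, ContinuousAlternatingMap.smul_apply, smul_eq_mul, abs_mul, abs_inv,
        abs_of_pos hN0]
      rw [inv_mul_le_iff₀ hN0, mul_one]
      exact (hM x v hv).trans hN.le
    have h2 := C.le_mass_of_comassLEOne (hη.fsmul (contMDiff_const_fun _)) h1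
    rw [C.eval_const_fsmul hη, ENNReal.ofReal_le_iff_le_toReal hC.ne, inv_mul_le_iff₀ hN0] at h2
    exact h2
  have hlim : Filter.Tendsto (fun N : ℝ => N * C.mass.toReal) (𝓝[>] M) (𝓝 (M * C.mass.toReal)) :=
    (Filter.Tendsto.mul_const _ Filter.tendsto_id).mono_left nhdsWithin_le_nhds
  refine (ge_of_tendsto hlim ?_).trans hb.le
  filter_upwards [self_mem_nhdsWithin] with N hN using key N hN

end RectCurrent
end EvalIntegral

/-! ### Mass on open sets: monotonicity and superadditivity. -/

section Mass

open scoped Topology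

variable {m n : ℕ} {X : Type*} [EMetricSpace X]
  [ChartedSpace (EuclideanSpace ℝ (Fin m)) X]
  [RiemannianBundle (fun x : X => TangentSpace (𝓡 m) x)]
  [IsManifold (𝓡 m) ∞ X] [SecondCountableTopology X]

variable (m) in
lemma sigmaCompactSpace_of_chartedSpace (X : Type*) [EMetricSpace X]
    [ChartedSpace (EuclideanSpace ℝ (Fin m)) X] [SecondCountableTopology X] :
    SigmaCompactSpace X := by
  have : LocallyCompactSpace X := ChartedSpace.locallyCompactSpace (EuclideanSpace ℝ (Fin m)) X
  infer_instance

variable (m) in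
/-- Smooth functions with values in `[0,1]`, vanishing off the open set `U`, that converge
to its indicator. -/
lemma exists_smooth_tendsto_indicator {U : Set X} (hU : IsOpen U) :
    ∃ χ : ℕ → X → ℝ, (∀ j, ContMDiff (𝓡 m) 𝓘(ℝ, ℝ) ∞ (χ j)) ∧ (∀ j x, |χ j x| ≤ 1) ∧
      (∀ j, ∀ x ∉ U, χ j x = 0) ∧
      ∀ x, Filter.Tendsto (fun j => χ j x) Filter.atTop (𝓝 (U.indicator (fun _ => (1 : ℝ)) x)) := by
  have := sigmaCompactSpace_of_chartedSpace m X
  obtain ⟨f, hf, hfs, hf0⟩ := hU.exists_contMDiff_support_eq (𝓡 m) (n := ⊤)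
  -- Here `f` is a nonnegative smooth function whose support is exactly `U`. The transition function
  -- is `0` at `0` and `1` from `1` on, so each point of `U` has value one as soon as `j ≥ 1 / f x`.
  refine ⟨fun j x => Real.smoothTransition (j * f x), fun j => ?_, fun j x => ?_, fun j x hx => ?_,
    fun x => ?_⟩
  · have h1 : ContMDiff (𝓡 m) 𝓘(ℝ, ℝ) ∞ fun x => (j : ℝ) * f x := contMDiff_const.mul hfs
    exact Real.smoothTransition.contDiff.contMDiff.comp h1
  · rw [abs_of_nonneg (Real.smoothTransition.nonneg _)]
    exact Real.smoothTransition.le_one _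
  · rw [← hf, Function.notMem_support] at hx
    simp [hx]
  · by_cases hx : x ∈ U
    · rw [indicator_of_mem hx]
      have hpos : 0 < f x := (hf0 x).lt_of_ne' (by rwa [← hf] at hx)
      refine tendsto_const_nhds.congr' ?_
      filter_upwards [Filter.eventually_ge_atTop ⌈(f x)⁻¹⌉₊] with j hj
      refine (Real.smoothTransition.one_of_one_le ?_).symm
      rw [← inv_mul_cancel₀ hpos.ne']
      gcongr
      exact (Nat.le_ceil _).trans (by exact_mod_cast hj)
    · rw [indicator_of_notMem hx]
      rw [← hf, Function.notMem_support] at hx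
      simp [hx]

lemma DiffForm.isTest_zero [T2Space X] : (0 : DiffForm m n X).IsTest := by
  constructor
  · intro c
    have : (0 : DiffForm m n X).inChart c = fun _ => 0 := by ext1 z; rfl
    rw [this]; exact contDiffOn_const
  · exact ⟨∅, isCompact_empty, fun x _ => rfl⟩

namespace RectCurrent

variable [IsContinuousRiemannianBundle (EuclideanSpace ℝ (Fin m))
      (fun x : X => TangentSpace (𝓡 m) x)]
  [IsRiemannianManifold (𝓡 m) X] [MeasurableSpace X] [BorelSpace X] [Fact (n = 1 ∨ n = 2)]

lemma eval_restrict_of_eq_zero (C : RectCurrent m n X) {B : Set X} (hB : MeasurableSet B)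
    {η : DiffForm m n X} (hη : η.IsTest) (h0 : ∀ x ∉ B, η x = 0) :
    (C.restrict B hB).eval η = C.eval η := by
  rw [C.eval_restrict hB hη, C.eval_eq hη]
  congr 1
  ext1 p
  by_cases hp : C.pos p ∈ B
  · rw [indicator_of_mem hp, one_mul]
  · have : C.integrand η p = 0 := by
      have := h0 _ hp
      simp only [pos] at this
      simp only [integrand, this]
      exact mul_zero _
    rw [this, mul_zero]

/-- Additivity of the mass: the contribution of a form supported in `V` off `U`. -/
lemma eval_restrict_add_eval_le (C : RectCurrent m n X) {U V : Set X} (hU : IsOpen U) (hV : IsOpen V)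
    (hUV : U ⊆ V) (hfin : (C.restrict V hV.measurableSet).mass < ⊤) {η ζ : DiffForm m n X}
    (hη : η.IsTest) (hη1 : η.ComassLEOne) (hηU : ∀ x ∈ U, η x = 0) (hηV : ∀ x ∉ V, η x = 0)
    (hζ : ζ.IsTest) (hζ1 : ζ.ComassLEOne) :
    (C.restrict U hU.measurableSet).eval ζ + C.eval η ≤
      (C.restrict V hV.measurableSet).mass.toReal := by
  -- The form `χ j ζ` vanishes off `U` and `η` vanishes on `U`, so their sum still has comass at
  -- most one; it is supported in `V` and therefore bounded by the mass there.
  obtain ⟨χ, hχ, h1, h0, hlim⟩ := exists_smooth_tendsto_indicator m hU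
  have ht := (C.tendsto_eval_fsmul hU.measurableSet hζ hχ h1 hlim).add_const (C.eval η)
  refine le_of_tendsto' ht fun j => ?_
  rw [← C.eval_add (hζ.fsmul (hχ j)) hη, ← C.eval_restrict_of_eq_zero hV.measurableSet
    ((hζ.fsmul (hχ j)).add hη)]
  · rw [← ENNReal.ofReal_le_iff_le_toReal hfin.ne]
    refine le_mass_of_comassLEOne _ ((hζ.fsmul (hχ j)).add hη) fun x v hv => ?_
    simp only [Pi.add_apply, ContinuousAlternatingMap.add_apply, DiffForm.fsmul,
      ContinuousAlternatingMap.smul_apply, smul_eq_mul]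
    by_cases hx : x ∈ U
    · have h00 : η x v = 0 := by rw [hηU x hx]; rfl
      rw [h00, add_zero, abs_mul]
      exact mul_le_one₀ (h1 j x) (abs_nonneg _) (hζ1 x v hv)
    · rw [h0 j x hx, zero_mul, zero_add]
      exact hη1 x v hv
  · intro x hx
    simp only [Pi.add_apply, DiffForm.fsmul, h0 j x fun h => hx (hUV h), hηV x hx, zero_smul,
      add_zero]

lemma eval_zero (C : RectCurrent m n X) : C.eval 0 = 0 := by
  simp [eval]

lemma comassLEOne_zero : (0 : DiffForm m n X).ComassLEOne := fun x v _ => by simp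

lemma mass_restrict_mono (C : RectCurrent m n X) {U V : Set X} (hU : IsOpen U) (hV : IsOpen V)
    (hUV : U ⊆ V) : (C.restrict U hU.measurableSet).mass ≤ (C.restrict V hV.measurableSet).mass := by
  by_cases hfin : (C.restrict V hV.measurableSet).mass < ⊤
  · refine iSup_le fun ζ => iSup_le fun hζ => iSup_le fun hζ1 => ?_
    have := C.eval_restrict_add_eval_le hU hV hUV hfin DiffForm.isTest_zero comassLEOne_zero
      (fun _ _ => rfl) (fun _ _ => rfl) hζ hζ1
    rw [C.eval_zero, add_zero] at this
    rwa [ENNReal.ofReal_le_iff_le_toReal hfin.ne]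
  · rw [not_lt, top_le_iff] at hfin
    rw [hfin]; exact le_top

/-- A form living on `V \ U`, scaled to comass one, can be added to any competitor for the mass on
`U`; the supremum over these competitors gives the bound. It is applied to thin annuli to produce
the difference quotient of the area. -/
lemma eval_le_mass_sub_mass (C : RectCurrent m n X) {U V : Set X} (hU : IsOpen U) (hV : IsOpen V)
    (hUV : U ⊆ V) (hfin : (C.restrict V hV.measurableSet).mass < ⊤) {η : DiffForm m n X}
    (hη : η.IsTest) {M : ℝ} (hM0 : 0 < M)
    (hM : ∀ x (v : Fin n → TangentSpace (𝓡 m) x), (∀ i, ‖v i‖ ≤ 1) → |η x v| ≤ M)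
    (hηU : ∀ x ∈ U, η x = 0) (hηV : ∀ x ∉ V, η x = 0) :
    C.eval η ≤ M * ((C.restrict V hV.measurableSet).mass.toReal -
      (C.restrict U hU.measurableSet).mass.toReal) := by
  set η' := η.fsmul fun _ => M⁻¹ with hη'
  have ht : η'.IsTest := hη.fsmul (contMDiff_const_fun _)
  have h1 : η'.ComassLEOne := by
    intro x v hv
    simp only [hη', DiffForm.fsmul, ContinuousAlternatingMap.smul_apply, smul_eq_mul, abs_mul, abs_inv,
      abs_of_pos hM0]
    rw [inv_mul_le_iff₀ hM0, mul_one]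
    exact hM x v hv
  have key : ∀ ζ : DiffForm m n X, ζ.IsTest → ζ.ComassLEOne →
      (C.restrict U hU.measurableSet).eval ζ + M⁻¹ * C.eval η ≤
      (C.restrict V hV.measurableSet).mass.toReal := by
    intro ζ hζ hζ1
    have := C.eval_restrict_add_eval_le hU hV hUV hfin ht h1
      (fun x hx => by simp [hη', DiffForm.fsmul, hηU x hx])
      (fun x hx => by simp [hη', DiffForm.fsmul, hηV x hx]) hζ hζ1
    rwa [hη', C.eval_const_fsmul hη] at this
  have h0 := key 0 DiffForm.isTest_zero comassLEOne_zero
  rw [eval_zero, zero_add] at h0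
  have hle : (C.restrict U hU.measurableSet).mass ≤
      ENNReal.ofReal ((C.restrict V hV.measurableSet).mass.toReal - M⁻¹ * C.eval η) := by
    refine iSup_le fun ζ => iSup_le fun hζ => iSup_le fun hζ1 => ?_
    exact ENNReal.ofReal_le_ofReal (by linarith [key ζ hζ hζ1])
  have h2 := ENNReal.toReal_mono ENNReal.ofReal_ne_top hle
  -- The case `ζ = 0`, recorded in `h0`, shows that the difference is nonnegative, so truncation at
  -- zero loses nothing.
  rw [ENNReal.toReal_ofReal (by linarith)] at h2
  have h3 : M⁻¹ * C.eval η ≤ (C.restrict V hV.measurableSet).mass.toReal -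
      (C.restrict U hU.measurableSet).mass.toReal := by linarith
  rwa [inv_mul_le_iff₀ hM0] at h3

end RectCurrent
end Mass

/-! ### The plane as a product of lines. -/

section Plane

open scoped Topology

/-- The isometry between `ℝ` and the Euclidean line. -/
def lineEquiv : EuclideanSpace ℝ (Fin 1) ≃L[ℝ] ℝ :=
  (EuclideanSpace.equiv (Fin 1) ℝ).trans (ContinuousLinearEquiv.funUnique (Fin 1) ℝ ℝ)

/-- The point of the plane with coordinates `r` and `t`. -/
def planePoint (r : ℝ) (t : EuclideanSpace ℝ (Fin 1)) : EuclideanSpace ℝ (Fin 2) := !₂[r, t 0]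

lemma planePoint_zero (r : ℝ) (t : EuclideanSpace ℝ (Fin 1)) : planePoint r t 0 = r := rfl

/-- `planePoint` as a measurable equivalence. -/
def planeEquiv : ℝ × EuclideanSpace ℝ (Fin 1) ≃ᵐ EuclideanSpace ℝ (Fin 2) :=
  ((MeasurableEquiv.refl ℝ).prodCongr
    ((MeasurableEquiv.toLp 2 (Fin 1 → ℝ)).symm.trans (MeasurableEquiv.funUnique (Fin 1) ℝ))).trans
  (MeasurableEquiv.finTwoArrow.symm.trans (MeasurableEquiv.toLp 2 (Fin 2 → ℝ)))

lemma measurePreserving_planeEquiv :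
    MeasurePreserving planeEquiv (volume.prod volume) volume := by
  have h1 : MeasurePreserving (MeasurableEquiv.toLp 2 (Fin 1 → ℝ)).symm volume volume :=
    EuclideanSpace.volume_preserving_symm_measurableEquiv_toLp (Fin 1)
  have h2 := (volume_preserving_funUnique (Fin 1) ℝ).comp h1
  have h3 := (MeasurePreserving.id (volume : Measure ℝ)).prod h2
  have h4 := (volume_preserving_finTwoArrow ℝ).symm
  have h5 : MeasurePreserving (MeasurableEquiv.toLp 2 (Fin 2 → ℝ)) volume volume :=
    (EuclideanSpace.volume_preserving_symm_measurableEquiv_toLp (Fin 2)).symm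
  exact h5.comp (h4.comp h3)

lemma lipschitzWith_planePoint (r : ℝ) : LipschitzWith 1 (planePoint r) := by
  refine LipschitzWith.of_dist_le_mul fun s t => ?_
  simp [EuclideanSpace.dist_eq, planePoint, Fin.sum_univ_two]

lemma hasFDerivAt_planePoint (r : ℝ) (t : EuclideanSpace ℝ (Fin 1)) :
    HasFDerivAt (planePoint r)
      ((EuclideanSpace.proj (𝕜 := ℝ) (0 : Fin 1)).smulRight
        (EuclideanSpace.single (1 : Fin 2) (1 : ℝ))) t := by
  have h : planePoint r = fun t => planePoint r 0 + (EuclideanSpace.proj (𝕜 := ℝ) (0 : Fin 1)).smulRight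
        (EuclideanSpace.single (1 : Fin 2) (1 : ℝ)) t := by
    ext t i
    fin_cases i <;> simp [planePoint]
  rw [h]
  exact (ContinuousLinearMap.hasFDerivAt _).const_add _

/-- On a line unique differentiability means being an accumulation point, and only countably many
points of a set are isolated from the right. So at almost every point of a slice the derivative
within it is well determined. -/
lemma countable_not_uniqueDiffWithinAt (E : Set (EuclideanSpace ℝ (Fin 1))) :
    {t ∈ E | ¬ UniqueDiffWithinAt ℝ E t}.Countable := by
  have h := countable_setOfPred_isolated_right_within (s := lineEquiv '' E)
  refine (h.preimage lineEquiv.injective).mono ?_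
  rintro t ⟨ht, hu⟩
  refine ⟨mem_image_of_mem _ ht, ?_⟩
  by_contra hne
  refine hu ?_
  have hacc : UniqueDiffWithinAt ℝ (lineEquiv '' E) (lineEquiv t) := by
    rw [uniqueDiffWithinAt_iff_accPt, accPt_principal_iff_nhdsWithin]
    have hne' : (𝓝[lineEquiv '' E ∩ Ioi (lineEquiv t)] (lineEquiv t)).NeBot := ⟨hne⟩
    refine hne'.mono (nhdsWithin_mono _ ?_)
    rintro x ⟨hx, hx'⟩
    exact ⟨hx, (mem_Ioi.1 hx').ne'⟩
  have h2 := (lineEquiv.symm.hasFDerivAt (x := lineEquiv t)).hasFDerivWithinAt.uniqueDiffWithinAt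
    hacc lineEquiv.symm.surjective.denseRange
  rwa [lineEquiv.symm_image_image, lineEquiv.symm_apply_apply] at h2

end Plane

/-! ### The tangent vector of the level curves on a surface, and its measurability. -/

section SliceVector

open scoped Topology

variable {m : ℕ} {X : Type*} [EMetricSpace X]
  [ChartedSpace (EuclideanSpace ℝ (Fin m)) X] [IsManifold (𝓡 m) ∞ X]
  [RiemannianBundle (fun x : X => TangentSpace (𝓡 m) x)]
  [IsContinuousRiemannianBundle (EuclideanSpace ℝ (Fin m))
      (fun x : X => TangentSpace (𝓡 m) x)]

/-- Slice vectors lie in varying tangent spaces. This makes their length a continuous function of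
the base point and the coordinates in a chart. -/
lemma continuousOn_norm_dsymm (c : X) : ContinuousOn
    (fun p : X × EuclideanSpace ℝ (Fin m) => ‖dsymm (m := m) c p.1 p.2‖)
    ((extChartAt (𝓡 m) c).source ×ˢ univ) := by
  have h1 : ContinuousOn (fun p : X × EuclideanSpace ℝ (Fin m) =>
      (⟨p.1, dsymm (m := m) c p.1 p.2⟩ : TotalSpace (EuclideanSpace ℝ (Fin m))
        (TangentSpace (𝓡 m) : X → Type _))) ((extChartAt (𝓡 m) c).source ×ˢ univ) := by
    have h := (trivializationAt (EuclideanSpace ℝ (Fin m))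
      (TangentSpace (𝓡 m) : X → Type _) c).continuousOn_symm
    have hs : (trivializationAt (EuclideanSpace ℝ (Fin m))
      (TangentSpace (𝓡 m) : X → Type _) c).baseSet = (extChartAt (𝓡 m) c).source := by
      simp
    rw [hs] at h
    refine h.congr fun p hp => ?_
    rw [← hs] at hp
    simp only [dsymm, Trivialization.symmL_apply _ hp.1]
  have h2 := ContinuousOn.inner_bundle h1 h1
  refine (Real.continuous_sqrt.comp_continuousOn h2).congr fun p hp => ?_
  exact norm_eq_sqrt_real_inner _

variable [IsRiemannianManifold (𝓡 m) X] [SecondCountableTopology X]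
  [MeasurableSpace X] [BorelSpace X]

variable (m) in
/-- It suffices to check measurability over the domains of charts. -/
lemma aestronglyMeasurable_of_chart {n : ℕ} {F : EuclideanSpace ℝ (Fin n) → ℝ}
    {f : EuclideanSpace ℝ (Fin n) → X} {s : Set (EuclideanSpace ℝ (Fin n))}
    (h : ∀ c : X, AEStronglyMeasurable F
      (volume.restrict (s ∩ f ⁻¹' (extChartAt (𝓡 m) c).source))) :
    AEStronglyMeasurable F (volume.restrict s) := by
  obtain ⟨T, hT, hTU⟩ := TopologicalSpace.countable_cover_nhds
    fun c : X => extChartAt_source_mem_nhds (I := 𝓡 m) c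
  have hcov : s = ⋃ c : T, s ∩ f ⁻¹' (extChartAt (𝓡 m) (c : X)).source := by
    rw [← inter_iUnion, ← preimage_iUnion,
      ← biUnion_eq_iUnion T fun c _ => (extChartAt (𝓡 m) c).source, hTU, preimage_univ, inter_univ]
  have : Countable T := hT.to_subtype
  rw [hcov, aestronglyMeasurable_iUnion_iff]
  exact fun c => h c

lemma dfun_eq_fderiv {g : X → ℝ} {c y : X} (hy : y ∈ (extChartAt (𝓡 m) c).source)
    (hg : ContMDiff (𝓡 m) 𝓘(ℝ, ℝ) ∞ g) (v : TangentSpace (𝓡 m) y) :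
    dfun g y v = fderiv ℝ (g ∘ (extChartAt (𝓡 m) c).symm) (extChartAt (𝓡 m) c y)
      (dchart c y v) := by
  rw [(hasFDerivAt_comp_chart_symm hy ((hg y).mdifferentiableAt (by simp))).fderiv,
    ContinuousLinearMap.comp_apply, dsymm_dchart hy]

variable {f : EuclideanSpace ℝ (Fin 2) → X} {s : Set (EuclideanSpace ℝ (Fin 2))} {L : ℝ≥0}
  {g : X → ℝ}

lemma aemeasurable_dfun_partials_chart (hs : MeasurableSet s) (hf : LipschitzOnWith L f s)
    (hg : ContMDiff (𝓡 m) 𝓘(ℝ, ℝ) ∞ g) (c : X) (j : Fin 2) :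
    AEMeasurable (fun u => dfun g (f u) (partials m f s u j))
      (volume.restrict (s ∩ f ⁻¹' (extChartAt (𝓡 m) c).source)) := by
  have hP : MeasurableSet (s ∩ f ⁻¹' (extChartAt (𝓡 m) c).source) :=
    measurableSet_inter_preimage_of_continuousOn hs hf.continuousOn
      (isOpen_extChartAt_source c).measurableSet
  have hD := (aemeasurable_chartDeriv (m := m) hs hf c hP inter_subset_left (fun u hu => hu.2)
    (EuclideanSpace.single j (1 : ℝ))).aestronglyMeasurable
  have h1 : AEStronglyMeasurable (fun u => fderiv ℝ (g ∘ (extChartAt (𝓡 m) c).symm)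
      (extChartAt (𝓡 m) c (f u))) (volume.restrict (s ∩ f ⁻¹' (extChartAt (𝓡 m) c).source)) := by
    refine ContinuousOn.aestronglyMeasurable (fun u hu => ?_) hP
    have h2 : ContinuousAt (fun y => fderiv ℝ (g ∘ (extChartAt (𝓡 m) c).symm)
        (extChartAt (𝓡 m) c y)) (f u) := by
      refine ContinuousAt.comp (g := fderiv ℝ (g ∘ (extChartAt (𝓡 m) c).symm)) ?_
        (continuousAt_extChartAt' hu.2)
      exact ((contDiffAt_comp_chart_symm hu.2 (hg _)).fderiv_right (m := ∞) (by simp)).continuousAt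
    exact h2.comp_continuousWithinAt ((hf.continuousOn u hu.1).mono inter_subset_left)
  have h2 := (isBoundedBilinearMap_apply (𝕜 := ℝ) (E := EuclideanSpace ℝ (Fin m))
    (F := ℝ)).continuous.comp_aestronglyMeasurable (h1.prodMk hD)
  refine h2.aemeasurable.congr ?_
  filter_upwards [ae_restrict_mem hP] with u hu
  rw [dfun_eq_fderiv hu.2 hg]; rfl

lemma aemeasurable_dfun_partials (hs : MeasurableSet s) (hf : LipschitzOnWith L f s)
    (hg : ContMDiff (𝓡 m) 𝓘(ℝ, ℝ) ∞ g) (j : Fin 2) :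
    AEMeasurable (fun u => dfun g (f u) (partials m f s u j)) (volume.restrict s) :=
  (aestronglyMeasurable_of_chart m fun c =>
    (aemeasurable_dfun_partials_chart hs hf hg c j).aestronglyMeasurable).aemeasurable

variable (m) in
/-- The tangent vector to the level sets of `g` on the surface `f`. -/
def sliceVector (g : X → ℝ) (f : EuclideanSpace ℝ (Fin 2) → X)
    (s : Set (EuclideanSpace ℝ (Fin 2))) (u : EuclideanSpace ℝ (Fin 2)) : TangentSpace (𝓡 m) (f u) :=
  kernelVector (dfun g (f u)) (partials m f s u)

lemma dchart_sliceVector (c : X) (u : EuclideanSpace ℝ (Fin 2)) :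
    dchart c (f u) (sliceVector m g f s u) =
      dfun g (f u) (partials m f s u 0) • chartDeriv c f s u (EuclideanSpace.single 1 (1 : ℝ)) -
      dfun g (f u) (partials m f s u 1) • chartDeriv c f s u (EuclideanSpace.single 0 (1 : ℝ)) := by
  rw [sliceVector, kernelVector, map_sub, map_smul, map_smul]
  rfl

lemma aemeasurable_dchart_sliceVector (hs : MeasurableSet s) (hf : LipschitzOnWith L f s)
    (hg : ContMDiff (𝓡 m) 𝓘(ℝ, ℝ) ∞ g) (c : X) :
    AEMeasurable (fun u => dchart c (f u) (sliceVector m g f s u))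
      (volume.restrict (s ∩ f ⁻¹' (extChartAt (𝓡 m) c).source)) := by
  have hP : MeasurableSet (s ∩ f ⁻¹' (extChartAt (𝓡 m) c).source) :=
    measurableSet_inter_preimage_of_continuousOn hs hf.continuousOn
      (isOpen_extChartAt_source c).measurableSet
  have hD := aemeasurable_chartDeriv (m := m) hs hf c hP inter_subset_left fun u hu => hu.2
  have hβ := aemeasurable_dfun_partials_chart hs hf hg c
  simp_rw [dchart_sliceVector]
  exact ((hβ 0).smul (hD _)).sub ((hβ 1).smul (hD _))

lemma aestronglyMeasurable_norm_sliceVector (hs : MeasurableSet s) (hf : LipschitzOnWith L f s)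
    (hg : ContMDiff (𝓡 m) 𝓘(ℝ, ℝ) ∞ g) :
    AEStronglyMeasurable (fun u => ‖sliceVector m g f s u‖) (volume.restrict s) := by
  refine aestronglyMeasurable_of_chart m (f := f) fun c => ?_
  have hP : MeasurableSet (s ∩ f ⁻¹' (extChartAt (𝓡 m) c).source) :=
    measurableSet_inter_preimage_of_continuousOn hs hf.continuousOn
      (isOpen_extChartAt_source c).measurableSet
  have hv := (aemeasurable_dchart_sliceVector hs hf hg c)
  set μ := (volume.restrict (s ∩ f ⁻¹' (extChartAt (𝓡 m) c).source)) with hμ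
  have hS : IsOpen ((extChartAt (𝓡 m) c).source ×ˢ (univ : Set (EuclideanSpace ℝ (Fin m)))) :=
    (isOpen_extChartAt_source c).prod isOpen_univ
  have hq : AEMeasurable (fun u => (f u, dchart c (f u) (sliceVector m g f s u))) μ :=
    AEMeasurable.prodMk ((hf.continuousOn.mono inter_subset_left).aemeasurable hP) hv
  have hmem : ∀ᵐ u ∂μ, (f u, dchart c (f u) (sliceVector m g f s u)) ∈
      ((extChartAt (𝓡 m) c).source ×ˢ (univ : Set (EuclideanSpace ℝ (Fin m)))) := by
    filter_upwards [ae_restrict_mem hP] with u hu using ⟨hu.2, mem_univ _⟩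
  classical
  -- Extension by zero off the domain of the chart turns continuity on an open set into global
  -- measurability.
  have hc : Measurable (((extChartAt (𝓡 m) c).source ×ˢ
      (univ : Set (EuclideanSpace ℝ (Fin m)))).indicator
      fun p => ‖dsymm (m := m) c p.1 p.2‖) := by
    rw [← piecewise_eq_indicator]
    exact (continuousOn_norm_dsymm c).measurable_piecewise continuousOn_const hS.measurableSet
  refine (hc.comp_aemeasurable hq).aestronglyMeasurable.congr ?_
  filter_upwards [hmem] with u hu
  rw [Function.comp_apply, indicator_of_mem hu]
  exact congrArg norm (dsymm_dchart hu.1 _)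

end SliceVector

/-! ### Pieces of a surface on which `g ∘ f` is a coordinate. -/

section SlicePieces

open scoped Topology

/-- The linear map of the plane with coordinates `β` and `ℓ`. -/
def pairMap (β ℓ : EuclideanSpace ℝ (Fin 2) →L[ℝ] ℝ) :
    EuclideanSpace ℝ (Fin 2) →L[ℝ] EuclideanSpace ℝ (Fin 2) :=
  β.smulRight (EuclideanSpace.single 0 1) + ℓ.smulRight (EuclideanSpace.single 1 1)

lemma pairMap_apply (β ℓ : EuclideanSpace ℝ (Fin 2) →L[ℝ] ℝ) (v : EuclideanSpace ℝ (Fin 2)) :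
    pairMap β ℓ v = β v • EuclideanSpace.single 0 1 + ℓ v • EuclideanSpace.single 1 1 := rfl

lemma det_pairMap (β ℓ : EuclideanSpace ℝ (Fin 2) →L[ℝ] ℝ) :
    (pairMap β ℓ).det = β (EuclideanSpace.single 0 1) * ℓ (EuclideanSpace.single 1 1) -
      β (EuclideanSpace.single 1 1) * ℓ (EuclideanSpace.single 0 1) := by
  rw [ContinuousLinearMap.det, ← LinearMap.det_toMatrix (EuclideanSpace.basisFun (Fin 2) ℝ).toBasis,
    Matrix.det_fin_two]
  simp [LinearMap.toMatrix_apply, pairMap_apply]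

/-- The vector mapped by `pairMap β ℓ` to a multiple of the second basis vector. -/
lemma pairMap_kernel (β ℓ : EuclideanSpace ℝ (Fin 2) →L[ℝ] ℝ) :
    pairMap β ℓ (β (EuclideanSpace.single 0 1) • EuclideanSpace.single 1 1 -
      β (EuclideanSpace.single 1 1) • EuclideanSpace.single 0 1) =
    (pairMap β ℓ).det • EuclideanSpace.single 1 1 := by
  rw [det_pairMap, pairMap_apply]
  simp only [map_sub, map_smul, smul_eq_mul]
  rw [mul_comm (β (EuclideanSpace.single 0 1)) (β (EuclideanSpace.single 1 1)), sub_self, zero_smul,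
    zero_add]

variable {m : ℕ} {X : Type*} [EMetricSpace X]
  [ChartedSpace (EuclideanSpace ℝ (Fin m)) X]

/-- The derivative of `g ∘ f` at `u`, for `f : s → X`. -/
def dcomp (m : ℕ) {X : Type*} [TopologicalSpace X] [ChartedSpace (EuclideanSpace ℝ (Fin m)) X]
    (g : X → ℝ) (f : EuclideanSpace ℝ (Fin 2) → X) (s : Set (EuclideanSpace ℝ (Fin 2)))
    (u : EuclideanSpace ℝ (Fin 2)) : EuclideanSpace ℝ (Fin 2) →L[ℝ] ℝ :=
  dfun g (f u) ∘L (mfderivWithin 𝓘(ℝ, EuclideanSpace ℝ (Fin 2)) (𝓡 m) f s u :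
      EuclideanSpace ℝ (Fin 2) →L[ℝ] TangentSpace (𝓡 m) (f u))

/-- The map of the plane with coordinates `g ∘ f` and `ℓ`. -/
def planeMap (g : X → ℝ) (f : EuclideanSpace ℝ (Fin 2) → X)
    (ℓ : EuclideanSpace ℝ (Fin 2) →L[ℝ] ℝ) (u : EuclideanSpace ℝ (Fin 2)) :
    EuclideanSpace ℝ (Fin 2) :=
  g (f u) • EuclideanSpace.single 0 1 + ℓ u • EuclideanSpace.single 1 1

lemma planeMap_zero (g : X → ℝ) (f : EuclideanSpace ℝ (Fin 2) → X)
    (ℓ : EuclideanSpace ℝ (Fin 2) →L[ℝ] ℝ) (u : EuclideanSpace ℝ (Fin 2)) :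
    planeMap g f ℓ u 0 = g (f u) := by
  simp [planeMap]

variable {f : EuclideanSpace ℝ (Fin 2) → X} {s : Set (EuclideanSpace ℝ (Fin 2))} {L : ℝ≥0}
  {g : X → ℝ}

lemma hasFDerivWithinAt_comp {u : EuclideanSpace ℝ (Fin 2)}
    (hg : MDifferentiableAt (𝓡 m) 𝓘(ℝ, ℝ) g (f u))
    (hf : MDifferentiableWithinAt 𝓘(ℝ, EuclideanSpace ℝ (Fin 2)) (𝓡 m) f s u) :
    HasFDerivWithinAt (fun u => g (f u)) (dcomp m g f s u) s u :=
  (HasMFDerivAt.comp_hasMFDerivWithinAt u hg.hasMFDerivAt hf.hasMFDerivWithinAt).hasFDerivWithinAt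

lemma hasFDerivWithinAt_planeMap {u : EuclideanSpace ℝ (Fin 2)}
    (hg : MDifferentiableAt (𝓡 m) 𝓘(ℝ, ℝ) g (f u))
    (hf : MDifferentiableWithinAt 𝓘(ℝ, EuclideanSpace ℝ (Fin 2)) (𝓡 m) f s u)
    (ℓ : EuclideanSpace ℝ (Fin 2) →L[ℝ] ℝ) :
    HasFDerivWithinAt (planeMap g f ℓ) (pairMap (dcomp m g f s u) ℓ) s u :=
  ((hasFDerivWithinAt_comp hg hf).smul_const _).add (ℓ.hasFDerivWithinAt.smul_const _)

/-- A measurable part of `s` which the map with coordinates `g ∘ f` and `ℓ` carries injectively,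
preserving the orientation and with Lipschitz inverse, to a subset of the plane. -/
structure SlicePiece (m : ℕ) {X : Type*} [EMetricSpace X]
    [ChartedSpace (EuclideanSpace ℝ (Fin m)) X] (g : X → ℝ)
    (f : EuclideanSpace ℝ (Fin 2) → X) (s : Set (EuclideanSpace ℝ (Fin 2))) where
  dom : Set (EuclideanSpace ℝ (Fin 2))
  inv : EuclideanSpace ℝ (Fin 2) → EuclideanSpace ℝ (Fin 2)
  ℓ : EuclideanSpace ℝ (Fin 2) →L[ℝ] ℝ
  measurableSet_dom : MeasurableSet dom
  dom_subset : dom ⊆ s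
  mdifferentiableWithinAt : ∀ u ∈ dom,
    MDifferentiableWithinAt 𝓘(ℝ, EuclideanSpace ℝ (Fin 2)) (𝓡 m) f s u
  lipschitz_inv : ∃ K : ℝ≥0, LipschitzWith K inv
  left_inv : ∀ u ∈ dom, inv (planeMap g f ℓ u) = u
  det_pos : ∀ u ∈ dom, 0 < (pairMap (dcomp m g f s u) ℓ).det

/-- The inverse is Lipschitz on the image and extends to the whole space. A globally Lipschitz
inverse can be restricted to any line. -/
lemma exists_lipschitz_leftInverse_of_antilipschitz {E : Type*} [NormedAddCommGroup E]
    [NormedSpace ℝ E] [FiniteDimensional ℝ E] {F : E → E} {P : Set E} {K : ℝ≥0}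
    (h : AntilipschitzWith K (P.domRestrict F)) :
    ∃ Φ : E → E, (∃ K : ℝ≥0, LipschitzWith K Φ) ∧ ∀ u ∈ P, Φ (F u) = u := by
  have hinj : InjOn F P := injOn_iff_injective.2 h.injective
  have h1 : LipschitzOnWith K (Function.invFunOn F P) (F '' P) := by
    rintro _ ⟨u, hu, rfl⟩ _ ⟨v, hv, rfl⟩
    rw [hinj.leftInvOn_invFunOn hu, hinj.leftInvOn_invFunOn hv]
    exact h ⟨u, hu⟩ ⟨v, hv⟩
  obtain ⟨Φ, hΦ, he⟩ := h1.extend_finite_dimension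
  refine ⟨Φ, ⟨_, hΦ⟩, fun u hu => ?_⟩
  rw [← he (mem_image_of_mem _ hu), hinj.leftInvOn_invFunOn hu]

/-- A map with invertible derivative splits, on countably many measurable pieces, into small
perturbations of linear isomorphisms, and such perturbations have Lipschitz inverses. -/
lemma exists_slicePieces_of_det_pos [IsManifold (𝓡 m) ∞ X] {Q : Set (EuclideanSpace ℝ (Fin 2))}
    (hQ : MeasurableSet Q) (hQs : Q ⊆ s) (hg : ContMDiff (𝓡 m) 𝓘(ℝ, ℝ) ∞ g)
    (hf : ∀ u ∈ Q, MDifferentiableWithinAt 𝓘(ℝ, EuclideanSpace ℝ (Fin 2)) (𝓡 m) f s u)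
    (ℓ : EuclideanSpace ℝ (Fin 2) →L[ℝ] ℝ)
    (hdet : ∀ u ∈ Q, 0 < (pairMap (dcomp m g f s u) ℓ).det) :
    ∃ S : ℕ → SlicePiece m g f s, Pairwise (Function.onFun Disjoint fun k => (S k).dom) ∧
      ⋃ k, (S k).dom = Q := by
  classical
  -- Half of `‖A⁻¹‖⁻¹`: an error strictly below `‖A⁻¹‖⁻¹` keeps the perturbation injective. The
  -- value `1` for singular `A` is never used.
  set r : (EuclideanSpace ℝ (Fin 2) →L[ℝ] EuclideanSpace ℝ (Fin 2)) → ℝ≥0 := fun A =>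
    if h : A.det ≠ 0 then ‖((A.toContinuousLinearEquivOfDetNeZero h).symm :
      EuclideanSpace ℝ (Fin 2) →L[ℝ] EuclideanSpace ℝ (Fin 2))‖₊⁻¹ / 2 else 1 with hr
  have hr0 : ∀ A, r A ≠ 0 := by
    intro A
    simp only [hr]
    split_ifs with h
    · have := (A.toContinuousLinearEquivOfDetNeZero h).nnnorm_symm_pos
      positivity
    · exact one_ne_zero
  obtain ⟨t, A, hd, ht, hcov, happ, hA⟩ := exists_partition_approximatesLinearOn_of_hasFDerivWithinAt
    (planeMap g f ℓ) Q (fun u => pairMap (dcomp m g f s u) ℓ)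
    (fun u hu => (hasFDerivWithinAt_planeMap ((hg _).mdifferentiableAt (by simp))
      (hf u hu) ℓ).mono hQs) r hr0
  have hanti : ∀ k, ∃ K, AntilipschitzWith K ((Q ∩ t k).domRestrict (planeMap g f ℓ)) := by
    intro k
    rcases Q.eq_empty_or_nonempty with h | h
    · have : IsEmpty ((Q ∩ t k : Set _)) := by rw [h]; simp
      exact ⟨0, fun x => isEmptyElim x⟩
    · obtain ⟨y, hy, hAy⟩ := hA h k
      have hdk : (A k).det ≠ 0 := by rw [hAy]; exact (hdet y hy).ne'
      have h1 := happ k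
      have h2 : r (A k) = ‖(((A k).toContinuousLinearEquivOfDetNeZero hdk).symm :
          EuclideanSpace ℝ (Fin 2) →L[ℝ] EuclideanSpace ℝ (Fin 2))‖₊⁻¹ / 2 := dif_pos hdk
      rw [h2] at h1
      have h3 : ApproximatesLinearOn (planeMap g f ℓ) (((A k).toContinuousLinearEquivOfDetNeZero hdk :
          EuclideanSpace ℝ (Fin 2) →L[ℝ] EuclideanSpace ℝ (Fin 2))) (Q ∩ t k) _ := h1
      refine ⟨_, h3.antilipschitz (Or.inr ?_)⟩
      exact half_lt_self (inv_pos.2 (ContinuousLinearEquiv.nnnorm_symm_pos _))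
  choose K hK using hanti
  choose Φ hΦ hinv using fun k => exists_lipschitz_leftInverse_of_antilipschitz (hK k)
  refine ⟨fun k => ⟨Q ∩ t k, Φ k, ℓ, hQ.inter (ht k), inter_subset_left.trans hQs,
    fun u hu => hf u hu.1, hΦ k, hinv k, fun u hu => hdet u hu.1⟩, fun i j hij => ?_, ?_⟩
  · exact (hd hij).mono inter_subset_right inter_subset_right
  · rw [← inter_iUnion, inter_eq_left.2 hcov]

variable [IsManifold (𝓡 m) ∞ X]
  [RiemannianBundle (fun x : X => TangentSpace (𝓡 m) x)]
  [IsContinuousRiemannianBundle (EuclideanSpace ℝ (Fin m))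
      (fun x : X => TangentSpace (𝓡 m) x)]
  [IsRiemannianManifold (𝓡 m) X] [SecondCountableTopology X]
  [MeasurableSpace X] [BorelSpace X]

/-- Where `d(g ∘ f)` does not vanish, a coordinate of the plane up to sign completes `g ∘ f` to a
coordinate system; where it vanishes, so does the slice vector. -/
lemma exists_slicePieces (hs : MeasurableSet s) (hf : LipschitzOnWith L f s)
    (hg : ContMDiff (𝓡 m) 𝓘(ℝ, ℝ) ∞ g) :
    ∃ S : Fin 4 × ℕ → SlicePiece m g f s,
      Pairwise (Function.onFun Disjoint fun k => (S k).dom) ∧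
      ∀ᵐ u ∂volume.restrict s, u ∉ ⋃ k, (S k).dom → sliceVector m g f s u = 0 := by
  have h0 := aemeasurable_dfun_partials (m := m) hs hf hg 0
  have h1 := aemeasurable_dfun_partials (m := m) hs hf hg 1
  have hd := ae_mdifferentiableWithinAt (m := m) hs hf
  have hall := (ae_restrict_iff' hs).1 (h0.ae_eq_mk.and (h1.ae_eq_mk.and hd))
  obtain ⟨N, hN, hNm, hN0⟩ := exists_measurable_superset_of_null hall
  set B0 := h0.mk _ with hB0
  set B1 := h1.mk _ with hB1
  have hm0 : Measurable B0 := h0.measurable_mk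
  have hm1 : Measurable B1 := h1.measurable_mk
  have hgood : ∀ u ∈ s \ N, dcomp m g f s u (EuclideanSpace.single 0 1) = B0 u ∧
      dcomp m g f s u (EuclideanSpace.single 1 1) = B1 u ∧
      MDifferentiableWithinAt 𝓘(ℝ, EuclideanSpace ℝ (Fin 2)) (𝓡 m) f s u := by
    intro u hu
    by_contra hc
    exact hu.2 (hN fun h => hc (h hu.1))
  have hsN := hs.diff hNm
  set Q : Fin 4 → Set (EuclideanSpace ℝ (Fin 2)) := fun q => (s \ N) ∩
    ![{u | 0 < B0 u}, {u | B0 u < 0}, {u | B0 u = 0 ∧ B1 u < 0}, {u | B0 u = 0 ∧ 0 < B1 u}] q with hQ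
  -- With `B0` and `B1` the partial derivatives of `g ∘ f`, the determinant is `B0 ℓ(e₀₁) - B1
  -- ℓ(e₀₀)`, where `e₀₀, e₀₁` is the standard basis. The four choices make it `B0`, `-B0`, `-B1`
  -- and `B1`, positive in the respective case. Positivity orients all slices coherently.
  set ℓ : Fin 4 → EuclideanSpace ℝ (Fin 2) →L[ℝ] ℝ :=
    ![EuclideanSpace.proj 1, -EuclideanSpace.proj 1, EuclideanSpace.proj 0, -EuclideanSpace.proj 0] with hℓ
  have hQm : ∀ q, MeasurableSet (Q q) := by
    intro q
    refine hsN.inter ?_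
    fin_cases q
    · exact measurableSet_lt measurable_const hm0
    · exact measurableSet_lt hm0 measurable_const
    · exact (measurableSet_eq_fun hm0 measurable_const).inter (measurableSet_lt hm1 measurable_const)
    · exact (measurableSet_eq_fun hm0 measurable_const).inter (measurableSet_lt measurable_const hm1)
  have hdet : ∀ q, ∀ u ∈ Q q, 0 < (pairMap (dcomp m g f s u) (ℓ q)).det := by
    intro q u hu
    rw [det_pairMap, (hgood u hu.1).1, (hgood u hu.1).2.1]
    have h2 := hu.2
    fin_cases q
    · simpa [hℓ] using h2
    · simpa [hℓ] using h2
    · simpa [hℓ] using h2.2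
    · simpa [hℓ] using h2.2
  have hex : ∀ q, ∃ S : ℕ → SlicePiece m g f s,
      Pairwise (Function.onFun Disjoint fun k => (S k).dom) ∧ ⋃ k, (S k).dom = Q q := fun q =>
    exists_slicePieces_of_det_pos (hQm q) (inter_subset_left.trans sdiff_subset) hg
      (fun u hu => (hgood u hu.1).2.2) (ℓ q) (hdet q)
  choose S hS hSQ using hex
  have hdisj : ∀ q q', q ≠ q' → Disjoint (Q q) (Q q') := by
    intro q q' hqq
    rw [Set.disjoint_left]
    rintro u ⟨-, hu⟩ ⟨-, hu'⟩
    fin_cases q <;> fin_cases q' <;> first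
      | exact hqq rfl
      | (simp at hu hu'; linarith)
  refine ⟨fun p => S p.1 p.2, ?_, ?_⟩
  · rintro ⟨q, k⟩ ⟨q', k'⟩ hne
    by_cases hq : q = q'
    · subst hq
      exact hS q (fun h => hne (Prod.ext rfl h))
    · refine (hdisj q q' hq).mono ?_ ?_
      · exact (subset_iUnion (fun k => (S q k).dom) k).trans (hSQ q).subset
      · exact (subset_iUnion (fun k => (S q' k).dom) k').trans (hSQ q').subset
  · rw [ae_restrict_iff' hs]
    have hNae : ∀ᵐ u : EuclideanSpace ℝ (Fin 2), u ∉ N := measure_eq_zero_iff_ae_notMem.1 hN0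
    filter_upwards [hNae] with u huN hus hu
    have hu' : ∀ q, u ∉ Q q := by
      intro q hq
      rw [← hSQ q] at hq
      obtain ⟨k, hk⟩ := mem_iUnion.1 hq
      exact hu (mem_iUnion.2 ⟨(q, k), hk⟩)
    have husN : u ∈ s \ N := ⟨hus, huN⟩
    have e0 : B0 u = 0 := by
      refine le_antisymm (not_lt.1 fun h => hu' 0 ⟨husN, h⟩) (not_lt.1 fun h => hu' 1 ⟨husN, h⟩)
    have e1 : B1 u = 0 := by
      refine le_antisymm (not_lt.1 fun h => hu' 3 ⟨husN, e0, h⟩)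
        (not_lt.1 fun h => hu' 2 ⟨husN, e0, h⟩)
    have d0 : dfun g (f u) (partials m f s u 0) = 0 := (hgood u husN).1.trans e0
    have d1 : dfun g (f u) (partials m f s u 1) = 0 := (hgood u husN).2.1.trans e1
    rw [sliceVector, kernelVector, d0, d1, zero_smul, zero_smul, sub_zero]

end SlicePieces

/-! ### The slices of a piece as Lipschitz curves. -/

section SliceCurves

open scoped Topology

variable {m : ℕ} {X : Type*} [EMetricSpace X]
  [ChartedSpace (EuclideanSpace ℝ (Fin m)) X] [IsManifold (𝓡 m) ∞ X]
  {f : EuclideanSpace ℝ (Fin 2) → X} {s : Set (EuclideanSpace ℝ (Fin 2))} {L : ℝ≥0}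
  {g : X → ℝ}

namespace SlicePiece

/-- The image of the piece in the plane. -/
def image (S : SlicePiece m g f s) : Set (EuclideanSpace ℝ (Fin 2)) := planeMap g f S.ℓ '' S.dom

/-- The parameter domain of the slice `{g = r}` of the piece. -/
def fiber (S : SlicePiece m g f s) (r : ℝ) : Set (EuclideanSpace ℝ (Fin 1)) :=
  planePoint r ⁻¹' S.image

/-- The slice `{g = r}` of the piece. -/
def curve (S : SlicePiece m g f s) (r : ℝ) (t : EuclideanSpace ℝ (Fin 1)) : X :=
  f (S.inv (planePoint r t))

/-- The Jacobian determinant of the coordinates on the piece. -/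
def jac (S : SlicePiece m g f s) (u : EuclideanSpace ℝ (Fin 2)) : ℝ :=
  (pairMap (dcomp m g f s u) S.ℓ).det

variable (S : SlicePiece m g f s)

lemma injOn : InjOn (planeMap g f S.ℓ) S.dom := fun u hu v hv h => by
  rw [← S.left_inv u hu, h, S.left_inv v hv]

lemma inv_mem {x : EuclideanSpace ℝ (Fin 2)} (hx : x ∈ S.image) :
    S.inv x ∈ S.dom ∧ planeMap g f S.ℓ (S.inv x) = x := by
  obtain ⟨u, hu, rfl⟩ := hx
  rw [S.left_inv u hu]
  exact ⟨hu, rfl⟩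

lemma apply_inv {x : EuclideanSpace ℝ (Fin 2)} (hx : x ∈ S.image) : g (f (S.inv x)) = x 0 := by
  rw [← planeMap_zero g f S.ℓ, (S.inv_mem hx).2]

lemma hasFDerivWithinAt (hg : ContMDiff (𝓡 m) 𝓘(ℝ, ℝ) ∞ g) : ∀ u ∈ S.dom,
    HasFDerivWithinAt (planeMap g f S.ℓ) (pairMap (dcomp m g f s u) S.ℓ) S.dom u := fun u hu =>
  (hasFDerivWithinAt_planeMap ((hg _).mdifferentiableAt (by simp))
    (S.mdifferentiableWithinAt u hu) S.ℓ).mono S.dom_subset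

lemma measurableSet_image (hg : ContMDiff (𝓡 m) 𝓘(ℝ, ℝ) ∞ g) : MeasurableSet S.image :=
  measurable_image_of_fderivWithin S.measurableSet_dom (S.hasFDerivWithinAt hg) S.injOn

lemma measurableSet_fiber (hg : ContMDiff (𝓡 m) 𝓘(ℝ, ℝ) ∞ g) (r : ℝ) :
    MeasurableSet (S.fiber r) :=
  (lipschitzWith_planePoint r).continuous.measurable (S.measurableSet_image hg)

lemma lipschitzOnWith_curve (hf : LipschitzOnWith L f s) (r : ℝ) :
    ∃ K : ℝ≥0, LipschitzOnWith K (S.curve r) (S.fiber r) := by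
  obtain ⟨K, hK⟩ := S.lipschitz_inv
  exact ⟨_, hf.comp ((hK.comp (lipschitzWith_planePoint r)).lipschitzOnWith (s := S.fiber r))
    fun t ht => S.dom_subset (S.inv_mem ht).1⟩

lemma hasFDerivWithinAt_inv (hg : ContMDiff (𝓡 m) 𝓘(ℝ, ℝ) ∞ g) {x : EuclideanSpace ℝ (Fin 2)}
    (hx : x ∈ S.image) : HasFDerivWithinAt S.inv
      (((pairMap (dcomp m g f s (S.inv x)) S.ℓ).toContinuousLinearEquivOfDetNeZero
        (S.det_pos _ (S.inv_mem hx).1).ne').symm :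
          EuclideanSpace ℝ (Fin 2) →L[ℝ] EuclideanSpace ℝ (Fin 2)) S.image x := by
  obtain ⟨K, hK⟩ := S.lipschitz_inv
  refine HasFDerivWithinAt.of_local_left_inverse (f := planeMap g f S.ℓ) (t := S.dom) ?_
    (S.hasFDerivWithinAt hg _ (S.inv_mem hx).1) hx ?_
  · exact tendsto_nhdsWithin_iff.2 ⟨hK.continuous.continuousWithinAt,
      by filter_upwards [self_mem_nhdsWithin] with y hy using (S.inv_mem hy).1⟩
  · filter_upwards [self_mem_nhdsWithin] with y hy using (S.inv_mem hy).2

/-- The velocity of the slices. -/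
lemma partials_curve (hg : ContMDiff (𝓡 m) 𝓘(ℝ, ℝ) ∞ g) {r : ℝ} {t : EuclideanSpace ℝ (Fin 1)}
    (ht : t ∈ S.fiber r) (hu : UniqueDiffWithinAt ℝ (S.fiber r) t) :
    partials m (S.curve r) (S.fiber r) t =
      fun _ => (S.jac (S.inv (planePoint r t)))⁻¹ • sliceVector m g f s (S.inv (planePoint r t)) := by
  set x := planePoint r t with hx
  set u := S.inv x with hux
  have hud := (S.inv_mem ht).1
  set A := (pairMap (dcomp m g f s u) S.ℓ).toContinuousLinearEquivOfDetNeZero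
    (S.det_pos _ hud).ne' with hA
  have h1 : HasFDerivWithinAt (fun t => S.inv (planePoint r t)) _ (S.fiber r) t :=
    HasFDerivWithinAt.comp t (S.hasFDerivWithinAt_inv hg ht)
      (hasFDerivAt_planePoint r t).hasFDerivWithinAt (mapsTo_preimage _ _)
  have h2 := HasMFDerivWithinAt.comp t
    (S.mdifferentiableWithinAt u hud).hasMFDerivWithinAt h1.hasMFDerivWithinAt
    (fun t ht => S.dom_subset (S.inv_mem ht).1)
  have h3 := h2.mfderivWithin (uniqueMDiffWithinAt_iff_uniqueDiffWithinAt.2 hu)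
  have hd0 : S.jac u ≠ 0 := (S.det_pos _ hud).ne'
  -- The slice runs in the second coordinate direction. Its preimage under the derivative is the
  -- kernel direction of `d(g ∘ f)`, normalised by the Jacobian as in `pairMap_kernel`.
  have hτ : A.symm (EuclideanSpace.single 1 1) = (S.jac u)⁻¹ •
      (dcomp m g f s u (EuclideanSpace.single 0 1) • EuclideanSpace.single 1 1 -
      dcomp m g f s u (EuclideanSpace.single 1 1) • EuclideanSpace.single 0 1) := by
    rw [A.symm_apply_eq, map_smul]
    change _ = (S.jac u)⁻¹ • (pairMap (dcomp m g f s u) S.ℓ) _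
    rw [pairMap_kernel, smul_smul]
    change _ = ((S.jac u)⁻¹ * S.jac u) • _
    rw [inv_mul_cancel₀ hd0, one_smul]
  ext1 j
  have hj : j = 0 := Subsingleton.elim _ _
  subst hj
  have h4 : partials m (S.curve r) (S.fiber r) t 0 =
      mfderivWithin 𝓘(ℝ, EuclideanSpace ℝ (Fin 2)) (𝓡 m) f s u
        (A.symm ((EuclideanSpace.single (0 : Fin 1) (1 : ℝ) : EuclideanSpace ℝ (Fin 1)) 0 •
          EuclideanSpace.single 1 1)) := by
    change mfderivWithin 𝓘(ℝ, EuclideanSpace ℝ (Fin 1)) (𝓡 m) (S.curve r) (S.fiber r) t _ = _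
    exact congrArg (fun D : EuclideanSpace ℝ (Fin 1) →L[ℝ] TangentSpace (𝓡 m) (f u) =>
      D (EuclideanSpace.single (0 : Fin 1) (1 : ℝ))) h3
  rw [h4]
  have e : (EuclideanSpace.single (0 : Fin 1) (1 : ℝ) : EuclideanSpace ℝ (Fin 1)) 0 = 1 := by simp
  rw [e, one_smul, hτ]
  have h5 : ∀ D : EuclideanSpace ℝ (Fin 2) →L[ℝ] TangentSpace (𝓡 m) (f u), ∀ (a b c : ℝ),
      D (a • (b • EuclideanSpace.single 1 1 - c • EuclideanSpace.single 0 1)) =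
      a • (b • D (EuclideanSpace.single 1 1) - c • D (EuclideanSpace.single 0 1)) := by
    intro D a b c
    rw [map_smul, map_sub, map_smul, map_smul]
  exact h5 _ _ _ _

end SlicePiece
end SliceCurves

/-! ### The coarea formula on one piece. -/

section SliceIntegrals

open scoped Topology

variable {m : ℕ} {X : Type*} [EMetricSpace X]
  [ChartedSpace (EuclideanSpace ℝ (Fin m)) X] [IsManifold (𝓡 m) ∞ X]
  {f : EuclideanSpace ℝ (Fin 2) → X} {s : Set (EuclideanSpace ℝ (Fin 2))} {L : ℝ≥0}
  {g : X → ℝ}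

namespace SlicePiece

variable (S : SlicePiece m g f s)

/-- A density on the piece, in the coordinates of the plane. -/
def density (w : EuclideanSpace ℝ (Fin 2) → ℝ) (x : EuclideanSpace ℝ (Fin 2)) : ℝ :=
  (S.jac (S.inv x))⁻¹ * w (S.inv x)

lemma abs_det_mul_density (w : EuclideanSpace ℝ (Fin 2) → ℝ) {u : EuclideanSpace ℝ (Fin 2)}
    (hu : u ∈ S.dom) :
    |(pairMap (dcomp m g f s u) S.ℓ).det| * S.density w (planeMap g f S.ℓ u) = w u := by
  have h := S.det_pos u hu
  rw [density, S.left_inv u hu, abs_of_pos h, ← mul_assoc, jac, mul_inv_cancel₀ h.ne', one_mul]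

lemma abs_density (w : EuclideanSpace ℝ (Fin 2) → ℝ) {x : EuclideanSpace ℝ (Fin 2)}
    (hx : x ∈ S.image) : |S.density w x| = S.density (fun u => |w u|) x := by
  have h : 0 < S.jac (S.inv x) := S.det_pos _ (S.inv_mem hx).1
  rw [density, abs_mul, abs_of_pos (inv_pos.2 h)]
  rfl

lemma integrableOn_density (hg : ContMDiff (𝓡 m) 𝓘(ℝ, ℝ) ∞ g) {w : EuclideanSpace ℝ (Fin 2) → ℝ}
    (hw : IntegrableOn w S.dom) : IntegrableOn (S.density w) S.image := by
  rw [image, integrableOn_image_iff_integrableOn_abs_det_fderiv_smul _ S.measurableSet_dom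
    (S.hasFDerivWithinAt hg) S.injOn]
  exact hw.congr_fun (fun u hu => (S.abs_det_mul_density w hu).symm) S.measurableSet_dom

lemma setIntegral_density (hg : ContMDiff (𝓡 m) 𝓘(ℝ, ℝ) ∞ g) (w : EuclideanSpace ℝ (Fin 2) → ℝ) :
    ∫ x in S.image, S.density w x = ∫ u in S.dom, w u := by
  rw [image, integral_image_eq_integral_abs_det_fderiv_smul _ S.measurableSet_dom
    (S.hasFDerivWithinAt hg) S.injOn]
  exact setIntegral_congr_fun S.measurableSet_dom fun u hu => S.abs_det_mul_density w hu

lemma setLIntegral_density (hg : ContMDiff (𝓡 m) 𝓘(ℝ, ℝ) ∞ g) (w : EuclideanSpace ℝ (Fin 2) → ℝ) :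
    ∫⁻ x in S.image, ENNReal.ofReal (S.density w x) = ∫⁻ u in S.dom, ENNReal.ofReal (w u) := by
  rw [image, lintegral_image_eq_lintegral_abs_det_fderiv_mul _ S.measurableSet_dom
    (S.hasFDerivWithinAt hg) S.injOn]
  refine setLIntegral_congr_fun S.measurableSet_dom fun u hu => ?_
  rw [← ENNReal.ofReal_mul (abs_nonneg _), S.abs_det_mul_density w hu]

/-- After the change of variables to the image in the plane, this is the integrability that Fubini
needs; the first coordinate of the plane is the value of `g`. -/
lemma integrable_indicator_density (hg : ContMDiff (𝓡 m) 𝓘(ℝ, ℝ) ∞ g)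
    {w : EuclideanSpace ℝ (Fin 2) → ℝ} (hw : IntegrableOn w S.dom) :
    Integrable (fun q : ℝ × EuclideanSpace ℝ (Fin 1) =>
      (S.fiber q.1).indicator (fun t => S.density w (planePoint q.1 t)) q.2)
      (volume.prod volume) := by
  have h := (S.integrableOn_density hg hw).integrable_indicator (S.measurableSet_image hg)
  exact (measurePreserving_planeEquiv.integrable_comp_emb planeEquiv.measurableEmbedding).2 h

lemma integrable_sliceIntegral (hg : ContMDiff (𝓡 m) 𝓘(ℝ, ℝ) ∞ g)
    {w : EuclideanSpace ℝ (Fin 2) → ℝ} (hw : IntegrableOn w S.dom) :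
    Integrable fun r => ∫ t in S.fiber r, S.density w (planePoint r t) := by
  have h := (S.integrable_indicator_density hg hw).integral_prod_left
  simp_rw [integral_indicator (S.measurableSet_fiber hg _)] at h
  exact h

lemma integral_sliceIntegral (hg : ContMDiff (𝓡 m) 𝓘(ℝ, ℝ) ∞ g)
    {w : EuclideanSpace ℝ (Fin 2) → ℝ} (hw : IntegrableOn w S.dom) :
    ∫ r, ∫ t in S.fiber r, S.density w (planePoint r t) = ∫ u in S.dom, w u := by
  rw [← S.setIntegral_density hg, ← integral_indicator (S.measurableSet_image hg),
    ← measurePreserving_planeEquiv.integral_comp planeEquiv.measurableEmbedding]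
  have h := integral_prod _ (S.integrable_indicator_density hg hw)
  simp_rw [integral_indicator (S.measurableSet_fiber hg _)] at h
  exact h.symm

lemma integral_norm_sliceIntegral_le (hg : ContMDiff (𝓡 m) 𝓘(ℝ, ℝ) ∞ g)
    {w : EuclideanSpace ℝ (Fin 2) → ℝ} (hw : IntegrableOn w S.dom) :
    ∫ r, ‖∫ t in S.fiber r, S.density w (planePoint r t)‖ ≤ ∫ u in S.dom, ‖w u‖ := by
  have hw' : IntegrableOn (fun u => ‖w u‖) S.dom := hw.norm
  rw [← S.integral_sliceIntegral hg hw']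
  refine integral_mono (S.integrable_sliceIntegral hg hw).norm
    (S.integrable_sliceIntegral hg hw') fun r => ?_
  refine (norm_integral_le_integral_norm _).trans (le_of_eq ?_)
  exact setIntegral_congr_fun (S.measurableSet_fiber hg r) fun t ht => S.abs_density w ht

lemma aemeasurable_indicator_density (hg : ContMDiff (𝓡 m) 𝓘(ℝ, ℝ) ∞ g)
    {w : EuclideanSpace ℝ (Fin 2) → ℝ} (hw : IntegrableOn w S.dom) :
    AEMeasurable (fun q : ℝ × EuclideanSpace ℝ (Fin 1) =>
      (S.fiber q.1).indicator (fun t => ENNReal.ofReal (S.density w (planePoint q.1 t))) q.2)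
      (volume.prod volume) := by
  have h := (S.integrable_indicator_density hg hw).aestronglyMeasurable.aemeasurable.ennreal_ofReal
  refine h.congr (Filter.Eventually.of_forall fun q => ?_)
  by_cases hq : q.2 ∈ S.fiber q.1
  · simp only [indicator_of_mem hq]
  · simp only [indicator_of_notMem hq, ENNReal.ofReal_zero]

lemma aemeasurable_sliceLIntegral (hg : ContMDiff (𝓡 m) 𝓘(ℝ, ℝ) ∞ g)
    {w : EuclideanSpace ℝ (Fin 2) → ℝ} (hw : IntegrableOn w S.dom) :
    AEMeasurable fun r => ∫⁻ t in S.fiber r, ENNReal.ofReal (S.density w (planePoint r t)) := by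
  have h := (S.aemeasurable_indicator_density hg hw).lintegral_prod_right'
  simp_rw [lintegral_indicator (S.measurableSet_fiber hg _)] at h
  exact h

lemma lintegral_sliceLIntegral (hg : ContMDiff (𝓡 m) 𝓘(ℝ, ℝ) ∞ g)
    {w : EuclideanSpace ℝ (Fin 2) → ℝ} (hw : IntegrableOn w S.dom) :
    ∫⁻ r, ∫⁻ t in S.fiber r, ENNReal.ofReal (S.density w (planePoint r t)) =
      ∫⁻ u in S.dom, ENNReal.ofReal (w u) := by
  rw [← S.setLIntegral_density hg, ← lintegral_indicator (S.measurableSet_image hg),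
    ← measurePreserving_planeEquiv.lintegral_comp_emb planeEquiv.measurableEmbedding]
  have h := lintegral_prod _ (S.aemeasurable_indicator_density hg hw)
  simp_rw [lintegral_indicator (S.measurableSet_fiber hg _)] at h
  exact h.symm

/-- Almost all points of the fiber are points of unique differentiability. -/
lemma ae_partials_curve (hg : ContMDiff (𝓡 m) 𝓘(ℝ, ℝ) ∞ g) (r : ℝ) :
    ∀ᵐ t ∂volume.restrict (S.fiber r), partials m (S.curve r) (S.fiber r) t =
      fun _ => (S.jac (S.inv (planePoint r t)))⁻¹ • sliceVector m g f s (S.inv (planePoint r t)) := by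
  rw [ae_restrict_iff' (S.measurableSet_fiber hg r)]
  have hc := (countable_not_uniqueDiffWithinAt (S.fiber r)).ae_notMem volume
  filter_upwards [hc] with t ht htf
  refine S.partials_curve hg htf ?_
  by_contra h
  exact ht ⟨htf, h⟩

/-- The factor `jac⁻¹` in the velocity of the slice is the same as in the change of variables. So
integrating `α` along the slice amounts to slicing the surface integral of `dg ∧ α`. -/
lemma setIntegral_curve (hg : ContMDiff (𝓡 m) 𝓘(ℝ, ℝ) ∞ g) (θ : EuclideanSpace ℝ (Fin 2) → ℤ)
    (α : DiffForm m 1 X) (r : ℝ) :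
    ∫ t in S.fiber r, (θ (S.inv (planePoint r t)) : ℝ) *
      α (S.curve r t) (partials m (S.curve r) (S.fiber r) t) =
    ∫ t in S.fiber r, S.density (fun u => (θ u : ℝ) * α (f u) fun _ => sliceVector m g f s u)
      (planePoint r t) := by
  refine integral_congr_ae ?_
  filter_upwards [S.ae_partials_curve hg r] with t ht
  rw [ht]
  have h := (α (f (S.inv (planePoint r t)))).map_update_smul (fun _ =>
    sliceVector m g f s (S.inv (planePoint r t))) 0 (S.jac (S.inv (planePoint r t)))⁻¹
    (sliceVector m g f s (S.inv (planePoint r t)))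
  have e : ∀ v : TangentSpace (𝓡 m) (f (S.inv (planePoint r t))), Function.update (fun _ : Fin 1 =>
      sliceVector m g f s (S.inv (planePoint r t))) 0 v = fun _ => v := by
    intro v; ext1 j; rw [Subsingleton.elim j 0]; simp
  rw [e, e] at h
  simp only [density]
  rw [← mul_assoc, mul_comm _ (θ _ : ℝ), mul_assoc]
  congr 1

end SlicePiece
end SliceIntegrals

/-! ### The coarea formula for a whole current. -/

section Slicing

open scoped Topology

lemma integrable_tsum_of_summable_integral_norm {ι : Type*} [Countable ι] {F : ι → ℝ → ℝ}
    (hF : ∀ i, Integrable (F i)) (hS : Summable fun i => ∫ r, ‖F i r‖) :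
    Integrable fun r => ∑' i, F i r := by
  have h1 : ∀ i, ENNReal.ofReal (∫ r, ‖F i r‖) = ∫⁻ r, ‖F i r‖ₑ := fun i =>
    ofReal_integral_norm_eq_lintegral_enorm (hF i)
  have h2 : ∑' i, ∫⁻ r, ‖F i r‖ₑ ≠ ⊤ := by
    simp_rw [← h1]
    exact hS.tsum_ofReal_ne_top
  have h3 : ∫⁻ r, ∑' i, ‖F i r‖ₑ ≠ ⊤ := by
    rwa [lintegral_tsum fun i => (hF i).aestronglyMeasurable.enorm]
  have h4 : ∀ᵐ r, ∑' i, ‖F i r‖ₑ < ⊤ :=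
    ae_lt_top' (AEMeasurable.tsum fun i => (hF i).aestronglyMeasurable.enorm) h3
  have h5 : ∀ᵐ r, Summable fun i => F i r := by
    filter_upwards [h4] with r hr
    exact Summable.of_nnnorm (ENNReal.tsum_coe_ne_top_iff_summable.1 hr.ne)
  refine ⟨?_, lt_of_le_of_lt (lintegral_mono fun r => ?_) h3.lt_top⟩
  · refine aestronglyMeasurable_of_tendsto_ae Filter.atTop
      (f := fun (t : Finset ι) r => ∑ i ∈ t, F i r) (fun t => ?_) ?_
    · exact Finset.aestronglyMeasurable_fun_sum t fun i _ => (hF i).aestronglyMeasurable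
    · filter_upwards [h5] with r hr using hr.hasSum
  · exact enorm_tsum_le_tsum_enorm

variable {m : ℕ} {X : Type*} [EMetricSpace X]
  [ChartedSpace (EuclideanSpace ℝ (Fin m)) X]
  [RiemannianBundle (fun x : X => TangentSpace (𝓡 m) x)]

/-- A decomposition of the pieces of a surface, adapted to the level sets of `g`. -/
structure Slicing (C : RectCurrent m 2 X) (g : X → ℝ) where
  piece : ∀ i, Fin 4 × ℕ → SlicePiece m g (C.f i) (C.s i)
  pairwise_disjoint : ∀ i, Pairwise (Function.onFun Disjoint fun k => (piece i k).dom)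
  ae_eq_zero : ∀ i, ∀ᵐ u ∂volume.restrict (C.s i), u ∉ ⋃ k, (piece i k).dom →
    sliceVector m g (C.f i) (C.s i) u = 0

namespace Slicing

variable {C : RectCurrent m 2 X} {g : X → ℝ} (T : Slicing C g)

/-- The pieces of a slicing, indexed by pairs. -/
def pieceAt (a : ℕ × (Fin 4 × ℕ)) : SlicePiece m g (C.f a.1) (C.s a.1) := T.piece a.1 a.2

/-- The pieces, as parts of the disjoint union of the parameter domains. -/
def part (a : ℕ × (Fin 4 × ℕ)) : Set (ℕ × EuclideanSpace ℝ (Fin 2)) := Prod.mk a.1 '' (T.pieceAt a).dom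

lemma measurableSet_part (a : ℕ × (Fin 4 × ℕ)) : MeasurableSet (T.part a) :=
  (RectCurrent.measurableEmbedding_prodMk a.1).measurableSet_image.2 (T.pieceAt a).measurableSet_dom

lemma disjoint_part : Pairwise (Function.onFun Disjoint T.part) := by
  rintro ⟨i, k⟩ ⟨j, l⟩ hne
  rw [Function.onFun, Set.disjoint_left]
  rintro ⟨j', u⟩ ⟨u', hu', h1⟩ ⟨v, hv, h2⟩
  simp only [Prod.mk.injEq] at h1 h2
  obtain ⟨rfl, rfl⟩ := h1
  obtain ⟨rfl, rfl⟩ := h2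
  refine Set.disjoint_left.1 (T.pairwise_disjoint _ fun h => hne (Prod.ext rfl h)) hu' hv

lemma restrict_part (a : ℕ × (Fin 4 × ℕ)) :
    C.meas.restrict (T.part a) = (volume.restrict (T.pieceAt a).dom).map (Prod.mk a.1) := by
  ext A hA
  have hm : ∀ i, Measurable (Prod.mk i : EuclideanSpace ℝ (Fin 2) → ℕ × EuclideanSpace ℝ (Fin 2)) :=
    fun i => (RectCurrent.measurableEmbedding_prodMk i).measurable
  rw [Measure.restrict_apply hA, RectCurrent.meas,
    Measure.sum_apply _ (hA.inter (T.measurableSet_part a)), tsum_eq_single a.1]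
  · rw [Measure.map_apply (hm _) (hA.inter (T.measurableSet_part a)), Measure.map_apply (hm _) hA,
      preimage_inter, part, preimage_image_eq _ (RectCurrent.measurableEmbedding_prodMk _).injective,
      Measure.restrict_apply (((hm _) hA).inter (T.pieceAt a).measurableSet_dom),
      Measure.restrict_apply ((hm _) hA), inter_assoc, inter_eq_left.2 (T.pieceAt a).dom_subset]
  · intro j hj
    rw [Measure.map_apply (hm _) (hA.inter (T.measurableSet_part a))]
    have : Prod.mk j ⁻¹' (A ∩ T.part a) = ∅ := by
      ext u
      simp only [part, mem_preimage, mem_inter_iff, mem_image, Prod.mk.injEq, mem_empty_iff_false,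
        iff_false, not_and]
      rintro - ⟨v, -, h, -⟩
      exact hj h.symm
    rw [this, measure_empty]

lemma setIntegral_part (a : ℕ × (Fin 4 × ℕ)) (W : ℕ × EuclideanSpace ℝ (Fin 2) → ℝ) :
    ∫ p in T.part a, W p ∂C.meas = ∫ u in (T.pieceAt a).dom, W (a.1, u) := by
  rw [T.restrict_part, (RectCurrent.measurableEmbedding_prodMk a.1).integral_map]

lemma setLIntegral_part (a : ℕ × (Fin 4 × ℕ)) (W : ℕ × EuclideanSpace ℝ (Fin 2) → ℝ≥0∞) :
    ∫⁻ p in T.part a, W p ∂C.meas = ∫⁻ u in (T.pieceAt a).dom, W (a.1, u) := by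
  rw [T.restrict_part, (RectCurrent.measurableEmbedding_prodMk a.1).lintegral_map]

lemma integrableOn_dom (a : ℕ × (Fin 4 × ℕ)) {W : ℕ × EuclideanSpace ℝ (Fin 2) → ℝ}
    (hW : Integrable W C.meas) : IntegrableOn (fun u => W (a.1, u)) (T.pieceAt a).dom := by
  have h := hW.integrableOn (s := T.part a)
  rw [IntegrableOn, T.restrict_part,
    (RectCurrent.measurableEmbedding_prodMk a.1).integrable_map_iff] at h
  exact h

/-- The functions on the parameter domains that vanish where `g` is critical on the surface. -/
def Vanishing (C : RectCurrent m 2 X) (g : X → ℝ) (W : ℕ × EuclideanSpace ℝ (Fin 2) → ℝ) : Prop :=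
  ∀ p, sliceVector m g (C.f p.1) (C.s p.1) p.2 = 0 → W p = 0

/-- Points outside all pieces contribute nothing: almost everywhere there the slice vector is zero,
hence so is `W`. -/
lemma hasSum_integral_dom {W : ℕ × EuclideanSpace ℝ (Fin 2) → ℝ} (hW : Integrable W C.meas)
    (h0 : Vanishing C g W) :
    HasSum (fun a => ∫ u in (T.pieceAt a).dom, W (a.1, u)) (∫ p, W p ∂C.meas) := by
  have h := hasSum_integral_iUnion T.measurableSet_part T.disjoint_part
    (hW.integrableOn (s := ⋃ a, T.part a))
  simp_rw [T.setIntegral_part] at h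
  have e : ∫ p in ⋃ a, T.part a, W p ∂C.meas = ∫ p, W p ∂C.meas := by
    refine setIntegral_eq_integral_of_ae_compl_eq_zero ?_
    rw [RectCurrent.ae_meas_iff]
    intro i
    filter_upwards [T.ae_eq_zero i] with u hu hmem
    refine h0 _ (hu fun h => hmem ?_)
    obtain ⟨k, hk⟩ := mem_iUnion.1 h
    exact mem_iUnion.2 ⟨(i, k), mem_image_of_mem _ hk⟩
  rwa [e] at h

lemma tsum_lintegral_dom_le (W : ℕ × EuclideanSpace ℝ (Fin 2) → ℝ≥0∞) :
    ∑' a, ∫⁻ u in (T.pieceAt a).dom, W (a.1, u) ≤ ∫⁻ p, W p ∂C.meas := by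
  simp_rw [← T.setLIntegral_part]
  rw [← lintegral_iUnion T.measurableSet_part T.disjoint_part]
  exact setLIntegral_le_lintegral _ _

variable [IsManifold (𝓡 m) ∞ X]

/-- The integral over the slice `{g = r}`. -/
def sliceIntegral (W : ℕ × EuclideanSpace ℝ (Fin 2) → ℝ) (r : ℝ) : ℝ :=
  ∑' a, ∫ t in (T.pieceAt a).fiber r, (T.pieceAt a).density (fun u => W (a.1, u)) (planePoint r t)

lemma summable_integral_norm (hg : ContMDiff (𝓡 m) 𝓘(ℝ, ℝ) ∞ g)
    {W : ℕ × EuclideanSpace ℝ (Fin 2) → ℝ} (hW : Integrable W C.meas) (h0 : Vanishing C g W) :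
    Summable fun a => ∫ r, ‖∫ t in (T.pieceAt a).fiber r,
      (T.pieceAt a).density (fun u => W (a.1, u)) (planePoint r t)‖ := by
  have h := (T.hasSum_integral_dom hW.norm fun p hp => by rw [h0 p hp, norm_zero]).summable
  exact Summable.of_nonneg_of_le (fun a => integral_nonneg fun r => norm_nonneg _)
    (fun a => (T.pieceAt a).integral_norm_sliceIntegral_le hg (T.integrableOn_dom a hW)) h

lemma integrable_sliceIntegral (hg : ContMDiff (𝓡 m) 𝓘(ℝ, ℝ) ∞ g)
    {W : ℕ × EuclideanSpace ℝ (Fin 2) → ℝ} (hW : Integrable W C.meas) (h0 : Vanishing C g W) :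
    Integrable (T.sliceIntegral W) :=
  integrable_tsum_of_summable_integral_norm
    (fun a => (T.pieceAt a).integrable_sliceIntegral hg (T.integrableOn_dom a hW))
    (T.summable_integral_norm hg hW h0)

/-- The coarea formula. -/
lemma integral_sliceIntegral (hg : ContMDiff (𝓡 m) 𝓘(ℝ, ℝ) ∞ g)
    {W : ℕ × EuclideanSpace ℝ (Fin 2) → ℝ} (hW : Integrable W C.meas) (h0 : Vanishing C g W) :
    ∫ r, T.sliceIntegral W r = ∫ p, W p ∂C.meas := by
  rw [← (T.hasSum_integral_dom hW h0).tsum_eq]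
  refine (integral_tsum_of_summable_integral_norm
    (fun a => (T.pieceAt a).integrable_sliceIntegral hg (T.integrableOn_dom a hW))
    (T.summable_integral_norm hg hW h0)).symm.trans ?_
  exact tsum_congr fun a => (T.pieceAt a).integral_sliceIntegral hg (T.integrableOn_dom a hW)

/-- On the slice `g` is constantly `r`, so `ψ ∘ g` comes out as a constant. This localises the
coarea formula in `r`. -/
lemma sliceIntegral_comp_mul (hg : ContMDiff (𝓡 m) 𝓘(ℝ, ℝ) ∞ g)
    (W : ℕ × EuclideanSpace ℝ (Fin 2) → ℝ) (ψ : ℝ → ℝ) (r : ℝ) :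
    T.sliceIntegral (fun p => ψ (g (C.pos p)) * W p) r = ψ r * T.sliceIntegral W r := by
  rw [sliceIntegral, sliceIntegral, ← tsum_mul_left]
  refine tsum_congr fun a => ?_
  rw [← integral_const_mul]
  refine setIntegral_congr_fun ((T.pieceAt a).measurableSet_fiber hg r) fun t ht => ?_
  have h := (T.pieceAt a).apply_inv ht
  rw [planePoint_zero] at h
  simp only [SlicePiece.density, RectCurrent.pos, h]
  ring

variable [IsContinuousRiemannianBundle (EuclideanSpace ℝ (Fin m))
      (fun x : X => TangentSpace (𝓡 m) x)]
  [IsRiemannianManifold (𝓡 m) X] [SecondCountableTopology X]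
  [MeasurableSpace X] [BorelSpace X]

lemma _root_.Plateau.exists_slicing (C : RectCurrent m 2 X) (hg : ContMDiff (𝓡 m) 𝓘(ℝ, ℝ) ∞ g) :
    Nonempty (Slicing C g) := by
  have h : ∀ i, ∃ S : Fin 4 × ℕ → SlicePiece m g (C.f i) (C.s i),
      Pairwise (Function.onFun Disjoint fun k => (S k).dom) ∧
      ∀ᵐ u ∂volume.restrict (C.s i), u ∉ ⋃ k, (S k).dom →
        sliceVector m g (C.f i) (C.s i) u = 0 := fun i => by
    obtain ⟨L, hL⟩ := C.lipschitz_f i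
    exact exists_slicePieces (C.measurableSet_s i) hL hg
  choose S h1 h2 using h
  exact ⟨⟨S, h1, h2⟩⟩

end Slicing
end Slicing

/-! ### Almost every slice is a rectifiable current. -/

section SliceCurrent

open scoped Topology

variable {m : ℕ} {X : Type*} [EMetricSpace X]
  [ChartedSpace (EuclideanSpace ℝ (Fin m)) X]

lemma jacobian_one [RiemannianBundle (fun x : X => TangentSpace (𝓡 m) x)]
    (f : EuclideanSpace ℝ (Fin 1) → X) (s : Set (EuclideanSpace ℝ (Fin 1)))
    (u : EuclideanSpace ℝ (Fin 1)) : jacobian m f s u = ‖partials m f s u 0‖ := by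
  rw [jacobian, det_gram_one, Real.sqrt_sq (norm_nonneg _)]

variable [IsManifold (𝓡 m) ∞ X]

/-- The form `dg ∧ α`. -/
def wedge (g : X → ℝ) (α : DiffForm m 1 X) : DiffForm m 2 X :=
  (α.fsmul g).d + α.d.fsmul fun x => -g x

/-- Writing `dg ∧ α` as `d(gα) - g dα` makes it a test form at once; the Leibniz rule recovers its
pointwise value. -/
lemma wedge_apply {g : X → ℝ} (hg : ContMDiff (𝓡 m) 𝓘(ℝ, ℝ) ∞ g) {α : DiffForm m 1 X}
    (hα : α.IsTest) (x : X) (v : Fin 2 → TangentSpace (𝓡 m) x) :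
    wedge g α x v = α x fun _ => kernelVector (dfun g x) v := by
  simp only [wedge, Pi.add_apply, ContinuousAlternatingMap.add_apply, hα.d_fsmul hg, DiffForm.fsmul,
    ContinuousAlternatingMap.smul_apply, smul_eq_mul]
  ring

lemma DiffForm.IsTest.wedge {g : X → ℝ} (hg : ContMDiff (𝓡 m) 𝓘(ℝ, ℝ) ∞ g) {α : DiffForm m 1 X}
    (hα : α.IsTest) : (wedge g α).IsTest :=
  (hα.fsmul hg).d.add (hα.d.fsmul hg.neg)

variable [RiemannianBundle (fun x : X => TangentSpace (𝓡 m) x)]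

lemma integrand_wedge (C : RectCurrent m 2 X) {g : X → ℝ} (hg : ContMDiff (𝓡 m) 𝓘(ℝ, ℝ) ∞ g)
    {α : DiffForm m 1 X} (hα : α.IsTest) (p : ℕ × EuclideanSpace ℝ (Fin 2)) :
    C.integrand (wedge g α) p =
      (C.θ p.1 p.2 : ℝ) * α (C.f p.1 p.2) fun _ => sliceVector m g (C.f p.1) (C.s p.1) p.2 := by
  rw [RectCurrent.integrand, wedge_apply hg hα]
  rfl

namespace Slicing

lemma vanishing_integrand_wedge (C : RectCurrent m 2 X) {g : X → ℝ}
    (hg : ContMDiff (𝓡 m) 𝓘(ℝ, ℝ) ∞ g) {α : DiffForm m 1 X} (hα : α.IsTest) :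
    Vanishing C g (C.integrand (wedge g α)) := by
  intro p hp
  rw [integrand_wedge C hg hα, hp, (α _).map_coord_zero 0 rfl, mul_zero]

variable {C : RectCurrent m 2 X} {g : X → ℝ} (T : Slicing C g)

/-- An enumeration of the indices of the pieces. -/
def indexEquiv : ℕ ≃ ℕ × (Fin 4 × ℕ) :=
  have : Denumerable (ℕ × (Fin 4 × ℕ)) := (nonempty_denumerable _).some
  (Denumerable.eqv _).symm

/-- The total mass over `K` of the slices of the pieces. -/
def sliceMass (K : Set X) (r : ℝ) : ℝ≥0∞ :=
  ∑' a, ∫⁻ t in (T.pieceAt a).fiber r ∩ (T.pieceAt a).curve r ⁻¹' K,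
    ENNReal.ofReal (|(C.θ a.1 ((T.pieceAt a).inv (planePoint r t)) : ℝ)| *
      jacobian m ((T.pieceAt a).curve r) ((T.pieceAt a).fiber r) t)

/-- The slice `{g = r}` has locally finite mass. -/
def Admissible (r : ℝ) : Prop := ∀ K : Set X, IsCompact K → T.sliceMass K r < ⊤

/-- The slice `{g = r}`, as a current. -/
def current (hg : ContMDiff (𝓡 m) 𝓘(ℝ, ℝ) ∞ g) (r : ℝ) (hr : T.Admissible r) :
    RectCurrent m 1 X where
  s n := (T.pieceAt (indexEquiv n)).fiber r
  f n := (T.pieceAt (indexEquiv n)).curve r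
  θ n t := C.θ (indexEquiv n).1 ((T.pieceAt (indexEquiv n)).inv (planePoint r t))
  measurableSet_s n := (T.pieceAt (indexEquiv n)).measurableSet_fiber hg r
  lipschitz_f n := by
    obtain ⟨L, hL⟩ := C.lipschitz_f (indexEquiv n).1
    exact (T.pieceAt (indexEquiv n)).lipschitzOnWith_curve hL r
  measurable_θ n := by
    obtain ⟨K, hK⟩ := (T.pieceAt (indexEquiv n)).lipschitz_inv
    exact (C.measurable_θ _).comp
      (hK.continuous.comp (lipschitzWith_planePoint r).continuous).measurable
  locally_finite K hK := by
    have h := hr K hK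
    rw [sliceMass, ← indexEquiv.tsum_eq] at h
    exact h

lemma eval_current (hg : ContMDiff (𝓡 m) 𝓘(ℝ, ℝ) ∞ g) (r : ℝ) (hr : T.Admissible r)
    {α : DiffForm m 1 X} (hα : α.IsTest) :
    (T.current hg r hr).eval α = T.sliceIntegral (C.integrand (wedge g α)) r := by
  rw [sliceIntegral, ← indexEquiv.tsum_eq]
  refine tsum_congr fun n => ?_
  simp_rw [integrand_wedge C hg hα]
  exact (T.pieceAt (indexEquiv n)).setIntegral_curve hg (C.θ (indexEquiv n).1) α r

variable [IsContinuousRiemannianBundle (EuclideanSpace ℝ (Fin m))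
      (fun x : X => TangentSpace (𝓡 m) x)]
  [IsRiemannianManifold (𝓡 m) X] [SecondCountableTopology X]
  [MeasurableSpace X] [BorelSpace X]

/-- The mass density of the slices over `K`. -/
def sliceDensity (C : RectCurrent m 2 X) (g : X → ℝ) (K : Set X)
    (p : ℕ × EuclideanSpace ℝ (Fin 2)) : ℝ :=
  K.indicator (fun _ => (1 : ℝ)) (C.pos p) *
    (|(C.θ p.1 p.2 : ℝ)| * ‖sliceVector m g (C.f p.1) (C.s p.1) p.2‖)

lemma sliceDensity_le {M : ℝ} (hM0 : 0 ≤ M)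
    (hM : ∀ x (v : TangentSpace (𝓡 m) x), |dfun g x v| ≤ M * ‖v‖) (K : Set X)
    (p : ℕ × EuclideanSpace ℝ (Fin 2)) :
    sliceDensity C g K p ≤ K.indicator (fun _ => (1 : ℝ)) (C.pos p) * (M * C.massDensity p) := by
  have : FiniteDimensional ℝ (TangentSpace (𝓡 m) (C.f p.1 p.2)) :=
    inferInstanceAs (FiniteDimensional ℝ (EuclideanSpace ℝ (Fin m)))
  have h := norm_kernelVector_le hM0 (hM _) (partials m (C.f p.1) (C.s p.1) p.2)
  have h0 : 0 ≤ K.indicator (fun _ => (1 : ℝ)) (C.pos p) :=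
    indicator_nonneg (fun _ _ => zero_le_one) _
  refine mul_le_mul_of_nonneg_left ?_ h0
  refine (mul_le_mul_of_nonneg_left h (abs_nonneg _)).trans (le_of_eq ?_)
  rw [RectCurrent.massDensity, jacobian]; ring

lemma integrable_sliceDensity (hg : ContMDiff (𝓡 m) 𝓘(ℝ, ℝ) ∞ g) {M : ℝ} (hM0 : 0 ≤ M)
    (hM : ∀ x (v : TangentSpace (𝓡 m) x), |dfun g x v| ≤ M * ‖v‖) {K : Set X} (hK : IsCompact K) :
    Integrable (sliceDensity C g K) C.meas := by
  have hKm : MeasurableSet K := hK.isClosed.measurableSet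
  refine ⟨?_, ?_⟩
  · refine AEStronglyMeasurable.mul ?_ ?_
    · exact ((measurable_const.indicator hKm).comp_aemeasurable C.aemeasurable_pos).aestronglyMeasurable
    · rw [RectCurrent.aestronglyMeasurable_meas_iff]
      intro i
      obtain ⟨L, hL⟩ := C.lipschitz_f i
      have h1 : Measurable fun u => |(C.θ i u : ℝ)| :=
        (measurable_from_top (f := fun k : ℤ => |(k : ℝ)|)).comp (C.measurable_θ i)
      have h2 := aestronglyMeasurable_norm_sliceVector (m := m) (g := g) (C.measurableSet_s i) hL hg
      exact h1.aestronglyMeasurable.mul h2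
  · have hfin : ENNReal.ofReal M * C.presMass K < ⊤ :=
      ENNReal.mul_lt_top ENNReal.ofReal_lt_top (C.locally_finite K hK)
    refine lt_of_le_of_lt ?_ hfin
    rw [RectCurrent.lintegral_meas, RectCurrent.presMass, ← ENNReal.tsum_mul_left]
    refine ENNReal.tsum_le_tsum fun i => ?_
    rw [← lintegral_const_mul' _ _ ENNReal.ofReal_ne_top,
      ← lintegral_indicator (C.measurableSet_inter_preimage hKm i),
      ← lintegral_indicator (C.measurableSet_s i)]
    refine lintegral_mono fun u => ?_
    by_cases hu : u ∈ C.s i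
    · rw [indicator_of_mem hu]
      have h0 : 0 ≤ sliceDensity C g K (i, u) :=
        mul_nonneg (indicator_nonneg (fun _ _ => zero_le_one) _)
          (mul_nonneg (abs_nonneg _) (norm_nonneg _))
      rw [← ofReal_norm, Real.norm_of_nonneg h0]
      have h1 := sliceDensity_le (C := C) hM0 hM K (i, u)
      by_cases huK : C.f i u ∈ K
      · rw [indicator_of_mem (show u ∈ C.s i ∩ C.f i ⁻¹' K from ⟨hu, huK⟩),
          ← ENNReal.ofReal_mul hM0]
        refine ENNReal.ofReal_le_ofReal (h1.trans (le_of_eq ?_))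
        rw [indicator_of_mem (show C.pos (i, u) ∈ K from huK), one_mul]
        rfl
      · rw [indicator_of_notMem (show C.pos (i, u) ∉ K from huK), zero_mul] at h1
        rw [ENNReal.ofReal_of_nonpos h1]
        exact zero_le
    · rw [indicator_of_notMem hu]
      exact zero_le

/-- By the velocity formula the length element of a slice is `jac⁻¹` times the length of the slice
vector, so the two integrands agree over `K`. -/
lemma sliceMass_le (hg : ContMDiff (𝓡 m) 𝓘(ℝ, ℝ) ∞ g) {K : Set X} (hK : MeasurableSet K) (r : ℝ) :
    T.sliceMass K r ≤ ∑' a, ∫⁻ t in (T.pieceAt a).fiber r,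
      ENNReal.ofReal ((T.pieceAt a).density (fun u => sliceDensity C g K (a.1, u))
        (planePoint r t)) := by
  refine ENNReal.tsum_le_tsum fun a => ?_
  set S := T.pieceAt a with hS
  refine le_trans (le_of_eq ?_) (lintegral_mono_set (inter_subset_left
    (t := S.curve r ⁻¹' K)))
  obtain ⟨L, hL⟩ := C.lipschitz_f a.1
  obtain ⟨L', hL'⟩ := S.lipschitzOnWith_curve hL r
  have hm := measurableSet_inter_preimage_of_continuousOn (S.measurableSet_fiber hg r)
    hL'.continuousOn hK
  refine lintegral_congr_ae ?_
  filter_upwards [ae_restrict_of_ae_restrict_of_subset inter_subset_left (S.ae_partials_curve hg r),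
    ae_restrict_mem hm] with t ht htm
  have hj : 0 < S.jac (S.inv (planePoint r t)) := S.det_pos _ (S.inv_mem htm.1).1
  have hKt : K.indicator (fun _ => (1 : ℝ)) (C.pos (a.1, S.inv (planePoint r t))) = 1 :=
    indicator_of_mem (show C.pos (a.1, S.inv (planePoint r t)) ∈ K from htm.2) _
  have hn : ‖partials m (S.curve r) (S.fiber r) t 0‖ = (S.jac (S.inv (planePoint r t)))⁻¹ *
      ‖sliceVector m g (C.f a.1) (C.s a.1) (S.inv (planePoint r t))‖ := by
    have hsm : ∀ (c : ℝ) (v : TangentSpace (𝓡 m) (C.f a.1 (S.inv (planePoint r t)))), 0 ≤ c →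
        ‖c • v‖ = c * ‖v‖ := fun c v hc => by rw [norm_smul, Real.norm_of_nonneg hc]
    rw [ht]
    exact hsm _ _ (inv_nonneg.2 hj.le)
  rw [jacobian_one, hn, SlicePiece.density, sliceDensity, hKt, one_mul]
  congr 1
  ring

/-- Integrated over `r`, the slice masses over `K` are bounded by the integral of `sliceDensity`,
which is finite because `|dg| ≤ M` and the current has finite mass over `K`. -/
lemma ae_sliceMass_lt_top (hg : ContMDiff (𝓡 m) 𝓘(ℝ, ℝ) ∞ g) {M : ℝ} (hM0 : 0 ≤ M)
    (hM : ∀ x (v : TangentSpace (𝓡 m) x), |dfun g x v| ≤ M * ‖v‖) {K : Set X} (hK : IsCompact K) :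
    ∀ᵐ r, T.sliceMass K r < ⊤ := by
  have hint := integrable_sliceDensity (C := C) hg hM0 hM hK
  have hm := fun a => (T.pieceAt a).aemeasurable_sliceLIntegral hg (T.integrableOn_dom a hint)
  have h1 : ∫⁻ r, ∑' a, ∫⁻ t in (T.pieceAt a).fiber r,
      ENNReal.ofReal ((T.pieceAt a).density (fun u => sliceDensity C g K (a.1, u))
        (planePoint r t)) ≠ ⊤ := by
    rw [lintegral_tsum hm]
    simp_rw [fun a => (T.pieceAt a).lintegral_sliceLIntegral hg (T.integrableOn_dom a hint)]
    refine ((T.tsum_lintegral_dom_le _).trans_lt (b := ∫⁻ p, ENNReal.ofReal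
      (sliceDensity C g K p) ∂C.meas) (lt_of_le_of_lt (lintegral_mono fun p => ?_) hint.2)).ne
    rw [← ofReal_norm]
    exact ENNReal.ofReal_le_ofReal (le_abs_self _)
  filter_upwards [ae_lt_top' (AEMeasurable.tsum hm) h1] with r hr
  exact (T.sliceMass_le hg hK.isClosed.measurableSet r).trans_lt hr

lemma ae_admissible (hg : ContMDiff (𝓡 m) 𝓘(ℝ, ℝ) ∞ g) {M : ℝ} (hM0 : 0 ≤ M)
    (hM : ∀ x (v : TangentSpace (𝓡 m) x), |dfun g x v| ≤ M * ‖v‖) :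
    ∀ᵐ r, T.Admissible r := by
  have := sigmaCompactSpace_of_chartedSpace m X
  have : LocallyCompactSpace X := ChartedSpace.locallyCompactSpace (EuclideanSpace ℝ (Fin m)) X
  -- The null set depends on the compact set; an exhaustion reduces to countably many.
  have h := ae_all_iff.2 fun n => T.ae_sliceMass_lt_top hg hM0 hM
    ((CompactExhaustion.choice X).isCompact n)
  filter_upwards [h] with r hr K hK
  obtain ⟨n, hn⟩ := (CompactExhaustion.choice X).exists_superset_of_isCompact hK
  refine lt_of_le_of_lt (ENNReal.tsum_le_tsum fun a => lintegral_mono_set ?_) (hr n)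
  exact inter_subset_inter_right _ (preimage_mono hn)

end Slicing
end SliceCurrent

/-! ### Separability of the test forms over a compact set. -/

section Separability

open scoped Topology

lemma finiteDimensional_continuousAlternatingMap (n : ℕ) (E : Type*) [NormedAddCommGroup E]
    [NormedSpace ℝ E] [FiniteDimensional ℝ E] : FiniteDimensional ℝ (E [⋀^Fin n]→L[ℝ] ℝ) := by
  let F : (E [⋀^Fin n]→L[ℝ] ℝ) →ₗ[ℝ] MultilinearMap ℝ (fun _ : Fin n => E) ℝ :=
    { toFun := fun η => η.toContinuousMultilinearMap.toMultilinearMap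
      map_add' := fun _ _ => rfl
      map_smul' := fun _ _ => rfl }
  refine Module.Finite.of_injective F fun η ζ h => ?_
  ext v
  exact congrArg (fun G : MultilinearMap ℝ (fun _ : Fin n => E) ℝ => G v) h

lemma secondCountableTopology_continuousAlternatingMap (n : ℕ) (E : Type*) [NormedAddCommGroup E]
    [NormedSpace ℝ E] [FiniteDimensional ℝ E] :
    SecondCountableTopology (E [⋀^Fin n]→L[ℝ] ℝ) := by
  have := finiteDimensional_continuousAlternatingMap n E
  have : ProperSpace (E [⋀^Fin n]→L[ℝ] ℝ) := FiniteDimensional.proper ℝ _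
  infer_instance

variable {m n : ℕ} {X : Type*} [EMetricSpace X]
  [ChartedSpace (EuclideanSpace ℝ (Fin m)) X] [IsManifold (𝓡 m) ∞ X]

lemma DiffForm.IsTest.sub {η ζ : DiffForm m n X} (hη : η.IsTest) (hζ : ζ.IsTest) :
    (η - ζ).IsTest := by
  have h := hη.add (hζ.fsmul (contMDiff_const (c := (-1 : ℝ))))
  have e : η + ζ.fsmul (fun _ => -1) = η - ζ := by
    ext x v
    simp [DiffForm.fsmul, sub_eq_add_neg]
  rwa [e] at h

variable [RiemannianBundle (fun x : X => TangentSpace (𝓡 m) x)]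
  [IsContinuousRiemannianBundle (EuclideanSpace ℝ (Fin m))
      (fun x : X => TangentSpace (𝓡 m) x)]

/-- The expression of a test form and its derivative over a compact part of a chart. -/
def chartCoeff {K : Set X} (c : X) (κ : Set X) (hκ : κ ⊆ (extChartAt (𝓡 m) c).source)
    (α : {α : DiffForm m n X // α.IsTest ∧ ∀ x ∉ K, α x = 0}) :
    C(κ, (EuclideanSpace ℝ (Fin m) [⋀^Fin n]→L[ℝ] ℝ) ×
      (EuclideanSpace ℝ (Fin m) [⋀^Fin (n + 1)]→L[ℝ] ℝ)) where
  toFun y := (α.1.inChart c (extChartAt (𝓡 m) c y), α.1.d.inChart c (extChartAt (𝓡 m) c y))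
  continuous_toFun := by
    have h : ContinuousOn (extChartAt (𝓡 m) c) κ := (continuousOn_extChartAt c).mono hκ
    have hm : MapsTo (extChartAt (𝓡 m) c) κ (extChartAt (𝓡 m) c).target := fun y hy =>
      (extChartAt (𝓡 m) c).map_source (hκ hy)
    have h1 := ((α.2.1.smooth c).continuousOn.comp h hm).domRestrict
    have h2 := ((α.2.1.d.smooth c).continuousOn.comp h hm).domRestrict
    exact h1.prodMk h2

lemma DiffForm.abs_sub_le_norm_inChart {B : ℝ} {c y : X}
    (hy : y ∈ (extChartAt (𝓡 m) c).source)
    (hB : ∀ v : TangentSpace (𝓡 m) y, ‖dchart c y v‖ ≤ B * ‖v‖) (hB0 : 0 ≤ B)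
    (η ζ : DiffForm m n X) (v : Fin n → TangentSpace (𝓡 m) y) (hv : ∀ i, ‖v i‖ ≤ 1) :
    |η y v - ζ y v| ≤ ‖η.inChart c (extChartAt (𝓡 m) c y) - ζ.inChart c (extChartAt (𝓡 m) c y)‖ *
      B ^ n :=
  DiffForm.abs_apply_le_norm_inChart hy hB hB0 (η - ζ) v hv

/-- The test forms supported in a compact set are separable, in the `C¹` norm. -/
lemma exists_countable_dense_testForms [SecondCountableTopology X] {K : Set X} (hK : IsCompact K) :
    ∃ D : Set (DiffForm m n X), D.Countable ∧ (∀ β ∈ D, β.IsTest ∧ ∀ x ∉ K, β x = 0) ∧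
      ∀ α : DiffForm m n X, α.IsTest → (∀ x ∉ K, α x = 0) → ∀ δ > 0, ∃ β ∈ D,
        (∀ x (v : Fin n → TangentSpace (𝓡 m) x), (∀ i, ‖v i‖ ≤ 1) → |β x v - α x v| ≤ δ) ∧
        ∀ x (v : Fin (n + 1) → TangentSpace (𝓡 m) x), (∀ i, ‖v i‖ ≤ 1) →
          |β.d x v - α.d x v| ≤ δ := by
  have : LocallyCompactSpace X := ChartedSpace.locallyCompactSpace (EuclideanSpace ℝ (Fin m)) X
  choose U hcU hU hUs B hB0 hB using exists_norm_dchart_le (X := X) m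
  choose κ hκc hκU hκ using fun c => local_compact_nhds ((hU c).mem_nhds (hcU c))
  obtain ⟨t, -, ht⟩ := hK.elim_nhds_subcover κ fun c _ => hκc c
  have := secondCountableTopology_continuousAlternatingMap n (EuclideanSpace ℝ (Fin m))
  have := secondCountableTopology_continuousAlternatingMap (n + 1) (EuclideanSpace ℝ (Fin m))
  have : ∀ c, CompactSpace (κ c) := fun c => isCompact_iff_compactSpace.1 (hκ c)
  -- Forms are recorded by the coefficients of `α` and `dα` over finitely many compact sets covering
  -- `K`. The target is a separable metric space, so the range of `F` has a countable dense subset;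
  -- preimages of its points form `D`.
  let F : {α : DiffForm m n X // α.IsTest ∧ ∀ x ∉ K, α x = 0} →
      ∀ c : t, C(κ c, (EuclideanSpace ℝ (Fin m) [⋀^Fin n]→L[ℝ] ℝ) ×
        (EuclideanSpace ℝ (Fin m) [⋀^Fin (n + 1)]→L[ℝ] ℝ)) :=
    fun α c => chartCoeff (c : X) (κ c) ((hκU c).trans (hUs c)) α
  obtain ⟨D, hD, hDd⟩ := TopologicalSpace.exists_countable_dense (range F)
  refine ⟨(fun y : range F => y.2.choose.1) '' D, hD.image _, ?_, fun α hα h0 δ hδ => ?_⟩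
  · rintro _ ⟨y, -, rfl⟩
    exact y.2.choose.2
  -- A common bound for the factors converting coefficient norms to comass in degrees `n` and `n +
  -- 1`; the summand `1` keeps it positive.
  set R : ℝ := ∑ c ∈ t, (B c ^ n + B c ^ (n + 1)) + 1 with hR
  have hterm : ∀ c ∈ t, 0 ≤ B c ^ n + B c ^ (n + 1) := fun c _ =>
    add_nonneg (pow_nonneg (hB0 c) _) (pow_nonneg (hB0 c) _)
  have hR0 : 0 < R := by linarith [Finset.sum_nonneg hterm]
  have hle : ∀ c ∈ t, B c ^ n ≤ R ∧ B c ^ (n + 1) ≤ R := by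
    intro c hc
    have h1 := Finset.single_le_sum hterm hc
    constructor <;> linarith [pow_nonneg (hB0 c) n, pow_nonneg (hB0 c) (n + 1)]
  obtain ⟨y, hyD, hy⟩ := hDd.exists_dist_lt
    (⟨F ⟨α, hα, h0⟩, mem_range_self _⟩ : range F) (div_pos hδ hR0)
  set β := y.2.choose with hβ
  have hβ' : dist (F ⟨α, hα, h0⟩) (F β) < δ / R := by rw [hβ, y.2.choose_spec]; exact hy
  have key : ∀ c ∈ t, ∀ y ∈ κ c,
      ‖β.1.inChart c (extChartAt (𝓡 m) c y) - α.inChart c (extChartAt (𝓡 m) c y)‖ ≤ δ / R ∧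
      ‖β.1.d.inChart c (extChartAt (𝓡 m) c y) - α.d.inChart c (extChartAt (𝓡 m) c y)‖ ≤ δ / R := by
    intro c hc y hy
    have h1 := (dist_le_pi_dist (F ⟨α, hα, h0⟩) (F β) ⟨c, hc⟩).trans hβ'.le
    have h2 := (ContinuousMap.dist_apply_le_dist (⟨y, hy⟩ : κ c)).trans h1
    rw [Prod.dist_eq, dist_comm, dist_eq_norm, dist_comm, dist_eq_norm] at h2
    exact ⟨(le_max_left _ _).trans h2, (le_max_right _ _).trans h2⟩
  have hδR : ∀ {b q : ℝ}, b ≤ δ / R → 0 ≤ q → q ≤ R → b * q ≤ δ := by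
    intro b q hb hq hqR
    calc b * q ≤ δ / R * q := by gcongr
      _ ≤ δ / R * R := by gcongr
      _ = δ := div_mul_cancel₀ _ hR0.ne'
  refine ⟨β.1, mem_image_of_mem _ hyD, fun x v hv => ?_, fun x v hv => ?_⟩
  · by_cases hx : x ∈ K
    · obtain ⟨c, hc, hxc⟩ := mem_iUnion₂.1 (ht hx)
      exact (DiffForm.abs_sub_le_norm_inChart (hUs c (hκU c hxc)) (hB c x (hκU c hxc)) (hB0 c)
        β.1 α v hv).trans (hδR (key c hc x hxc).1 (pow_nonneg (hB0 c) _) (hle c hc).1)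
    · rw [h0 x hx, β.2.2 x hx, sub_self, abs_zero]; exact hδ.le
  · by_cases hx : x ∈ K
    · obtain ⟨c, hc, hxc⟩ := mem_iUnion₂.1 (ht hx)
      exact (DiffForm.abs_sub_le_norm_inChart (hUs c (hκU c hxc)) (hB c x (hκU c hxc)) (hB0 c)
        β.1.d α.d v hv).trans (hδR (key c hc x hxc).2 (pow_nonneg (hB0 c) _) (hle c hc).2)
    · rw [DiffForm.d_eq_zero hK h0 hx, DiffForm.d_eq_zero hK β.2.2 hx, sub_self, abs_zero]
      exact hδ.le

end Separability

/-! ### The slice is the boundary of the sublevel restriction. -/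

section SliceTheorem

open scoped Topology

/-- The primitive of `-ψ` that vanishes at infinity. -/
def tailIntegral (ψ : ℝ → ℝ) (x : ℝ) : ℝ := ∫ r, (Ioi x).indicator ψ r

lemma hasDerivAt_tailIntegral {ψ : ℝ → ℝ} (hψ : Continuous ψ) (hc : HasCompactSupport ψ) (x : ℝ) :
    HasDerivAt (tailIntegral ψ) (-ψ x) x := by
  have hint : Integrable ψ := hψ.integrable_of_hasCompactSupport hc
  have h1 : tailIntegral ψ = fun y => (∫ r, ψ r) - (∫ r in Iic (0 : ℝ), ψ r) - ∫ r in (0 : ℝ)..y, ψ r := by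
    ext y
    rw [← intervalIntegral.integral_Iic_sub_Iic hint.integrableOn hint.integrableOn, tailIntegral,
      integral_indicator measurableSet_Ioi, ← integral_add_compl measurableSet_Iic hint (s := Iic y),
      compl_Iic]
    ring
  rw [h1]
  exact (hψ.integral_hasStrictDerivAt 0 x).hasDerivAt.const_sub _

lemma contDiff_tailIntegral {ψ : ℝ → ℝ} (hψ : ContDiff ℝ ∞ ψ) (hc : HasCompactSupport ψ) :
    ContDiff ℝ ∞ (tailIntegral ψ) := by
  rw [contDiff_infty_iff_deriv]
  refine ⟨fun x => (hasDerivAt_tailIntegral hψ.continuous hc x).differentiableAt, ?_⟩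
  have : deriv (tailIntegral ψ) = fun x => -ψ x := by
    ext x; exact (hasDerivAt_tailIntegral hψ.continuous hc x).deriv
  rw [this]
  exact hψ.neg

variable {m : ℕ} {X : Type*} [EMetricSpace X]
  [ChartedSpace (EuclideanSpace ℝ (Fin m)) X] [IsManifold (𝓡 m) ∞ X]

lemma d_fsmul_comp {g : X → ℝ} (hg : ContMDiff (𝓡 m) 𝓘(ℝ, ℝ) ∞ g) {h : ℝ → ℝ}
    (hh : ContDiff ℝ ∞ h) {α : DiffForm m 1 X} (hα : α.IsTest) :
    (α.fsmul fun x => h (g x)).d =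
      α.d.fsmul (fun x => h (g x)) + (wedge g α).fsmul fun x => deriv h (g x) := by
  ext x v
  have hhg : ContMDiff (𝓡 m) 𝓘(ℝ, ℝ) ∞ fun x => h (g x) := hh.contMDiff.comp hg
  rw [hα.d_fsmul hhg]
  simp only [Pi.add_apply, ContinuousAlternatingMap.add_apply, DiffForm.fsmul,
    ContinuousAlternatingMap.smul_apply, smul_eq_mul, wedge_apply hg hα, add_right_inj]
  have e : kernelVector (dfun (fun x => h (g x)) x) v =
      deriv h (g x) • kernelVector (dfun g x) v := by
    simp only [kernelVector, dfun_comp ((hg x).mdifferentiableAt (by simp))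
      (hh.differentiable (by simp) _), smul_sub, smul_smul]
  rw [e]
  have h1 := (α x).map_update_smul (fun _ => kernelVector (dfun g x) v) 0 (deriv h (g x))
    (kernelVector (dfun g x) v)
  have e2 : ∀ w : TangentSpace (𝓡 m) x, Function.update (fun _ : Fin 1 =>
      kernelVector (dfun g x) v) 0 w = fun _ => w := by
    intro w; ext1 j; rw [Subsingleton.elim j 0]; simp
  rwa [e2, e2] at h1

variable [RiemannianBundle (fun x : X => TangentSpace (𝓡 m) x)]
  [IsContinuousRiemannianBundle (EuclideanSpace ℝ (Fin m))
      (fun x : X => TangentSpace (𝓡 m) x)]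
  [IsRiemannianManifold (𝓡 m) X] [SecondCountableTopology X]
  [MeasurableSpace X] [BorelSpace X]

namespace RectCurrent

/-- The value of the restriction of `C` to `{g < r}`, as a function of `r`. -/
def sublevelEval (C : RectCurrent m 2 X) (g : X → ℝ) (η : DiffForm m 2 X) (r : ℝ) : ℝ :=
  ∫ p, (Ioi (g (C.pos p))).indicator (fun _ => (1 : ℝ)) r * C.integrand η p ∂C.meas

lemma eval_restrict_sublevel (C : RectCurrent m 2 X) {g : X → ℝ} {r : ℝ}
    (hB : MeasurableSet {x | g x < r}) {η : DiffForm m 2 X} (hη : η.IsTest) :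
    (C.restrict {x | g x < r} hB).eval η = C.sublevelEval g η r := by
  rw [C.eval_restrict hB hη]
  rfl

lemma integrable_sublevel (C : RectCurrent m 2 X) {g : X → ℝ} (hg : Continuous g)
    {η : DiffForm m 2 X} (hη : η.IsTest) {ψ : ℝ → ℝ} (hψ : Integrable ψ) :
    Integrable (fun q : ℝ × (ℕ × EuclideanSpace ℝ (Fin 2)) =>
      ψ q.1 * ((Ioi (g (C.pos q.2))).indicator (fun _ => (1 : ℝ)) q.1 * C.integrand η q.2))
      (volume.prod C.meas) := by
  have h1 := hψ.mul_prod (C.integrable_integrand hη.isContTest)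
  have h2 : AEMeasurable (fun q : ℝ × (ℕ × EuclideanSpace ℝ (Fin 2)) => (q.1, g (C.pos q.2)))
      (volume.prod C.meas) :=
    measurable_fst.aemeasurable.prodMk
      ((hg.measurable.comp_aemeasurable C.aemeasurable_pos).comp_snd)
  have h3 : Measurable fun q : ℝ × ℝ => (Ioi q.2).indicator (fun _ => (1 : ℝ)) q.1 :=
    (measurable_const (a := (1 : ℝ))).indicator (measurableSet_lt measurable_snd measurable_fst)
  have h4 := h3.comp_aemeasurable h2
  refine (h1.bdd_mul h4.aestronglyMeasurable (c := 1) (Filter.Eventually.of_forall fun q => ?_)).congr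
    (Filter.Eventually.of_forall fun q => ?_)
  · simp only [Function.comp_apply]
    by_cases h : q.1 ∈ Ioi (g (C.pos q.2))
    · simp [indicator_of_mem h]
    · simp [indicator_of_notMem h]
  · simp only [Function.comp_apply]
    ring

lemma integrable_mul_sublevelEval (C : RectCurrent m 2 X) {g : X → ℝ} (hg : Continuous g)
    {η : DiffForm m 2 X} (hη : η.IsTest) {ψ : ℝ → ℝ} (hψ : Integrable ψ) :
    Integrable fun r => ψ r * C.sublevelEval g η r := by
  have h := (C.integrable_sublevel hg hη hψ).integral_prod_left
  simp_rw [integral_const_mul] at h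
  exact h

/-- Fubini: integrating `ψ(r)` over all `r > g(x)` gives the tail integral of `ψ` at `g(x)`. -/
lemma integral_mul_sublevelEval (C : RectCurrent m 2 X) {g : X → ℝ} (hg : Continuous g)
    {η : DiffForm m 2 X} (hη : η.IsTest) {ψ : ℝ → ℝ} (hψ : Integrable ψ) :
    ∫ r, ψ r * C.sublevelEval g η r =
      ∫ p, tailIntegral ψ (g (C.pos p)) * C.integrand η p ∂C.meas := by
  have h := integral_integral_swap (f := fun r p => ψ r *
    ((Ioi (g (C.pos p))).indicator (fun _ => (1 : ℝ)) r * C.integrand η p))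
    (C.integrable_sublevel hg hη hψ)
  simp_rw [integral_const_mul] at h
  refine h.trans (integral_congr_ae (Filter.Eventually.of_forall fun p => ?_))
  simp only
  rw [tailIntegral, ← integral_mul_const]
  congr 1
  ext1 r
  by_cases h : r ∈ Ioi (g (C.pos p))
  · simp [indicator_of_mem h]
  · simp [indicator_of_notMem h]

lemma locallyIntegrable_sublevelEval (C : RectCurrent m 2 X) {g : X → ℝ} (hg : Continuous g)
    {η : DiffForm m 2 X} (hη : η.IsTest) : LocallyIntegrable (C.sublevelEval g η) := by
  rw [locallyIntegrable_iff]
  intro K hK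
  have h1 : Integrable (K.indicator fun _ => (1 : ℝ)) :=
    (integrable_indicator_iff hK.measurableSet).2 (integrableOn_const hK.measure_lt_top.ne)
  have h2 := C.integrable_mul_sublevelEval hg hη h1
  rw [← integrable_indicator_iff hK.measurableSet]
  refine h2.congr (Filter.Eventually.of_forall fun r => ?_)
  by_cases h : r ∈ K
  · simp [indicator_of_mem h]
  · simp [indicator_of_notMem h]

/-- With `Ψ` the tail integral, `Ψ' = -ψ`, and `∂C = 0` is tested on `Ψ(g) α`: `0 = C(Ψ(g) dα) -
C(ψ(g) dg ∧ α)`. -/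
lemma eval_fsmul_tailIntegral {C : RectCurrent m 2 X} (hC : C.IsCycle)
    {g : X → ℝ} (hg : ContMDiff (𝓡 m) 𝓘(ℝ, ℝ) ∞ g) {ψ : ℝ → ℝ} (hψ : ContDiff ℝ ∞ ψ)
    (hψc : HasCompactSupport ψ) {α : DiffForm m 1 X} (hα : α.IsTest) :
    C.eval (α.d.fsmul fun x => tailIntegral ψ (g x)) =
      C.eval ((wedge g α).fsmul fun x => ψ (g x)) := by
  have hh := contDiff_tailIntegral hψ hψc
  have hhg : ContMDiff (𝓡 m) 𝓘(ℝ, ℝ) ∞ fun x => tailIntegral ψ (g x) := hh.contMDiff.comp hg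
  have hψg : ContMDiff (𝓡 m) 𝓘(ℝ, ℝ) ∞ fun x => ψ (g x) := hψ.contMDiff.comp hg
  have hdg : ContMDiff (𝓡 m) 𝓘(ℝ, ℝ) ∞ fun x => -ψ (g x) := hψg.neg
  have hd : deriv (tailIntegral ψ) = fun x => -ψ x := by
    ext x; exact (hasDerivAt_tailIntegral hψ.continuous hψc x).deriv
  have h1 := hC _ (hα.fsmul hhg)
  rw [d_fsmul_comp hg hh hα, hd, C.eval_add (hα.d.fsmul hhg) ((hα.wedge hg).fsmul hdg),
    C.eval_fsmul (hα.wedge hg) hdg] at h1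
  rw [C.eval_fsmul (hα.wedge hg) hψg]
  simp_rw [neg_mul] at h1
  rw [integral_neg] at h1
  linarith

end RectCurrent

/-- Both sides have the same integral against every smooth compactly supported `ψ(r)`: the left by
Fubini, the right by the coarea formula, the two values agreeing because `C` is a cycle. -/
lemma Slicing.ae_sublevelEval_eq {C : RectCurrent m 2 X} (hC : C.IsCycle) {g : X → ℝ}
    (hg : ContMDiff (𝓡 m) 𝓘(ℝ, ℝ) ∞ g) (T : Slicing C g) {α : DiffForm m 1 X} (hα : α.IsTest) :
    ∀ᵐ r, C.sublevelEval g α.d r = T.sliceIntegral (C.integrand (wedge g α)) r := by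
  have hw : Integrable (C.integrand (wedge g α)) C.meas :=
    C.integrable_integrand (hα.wedge hg).isContTest
  have hv := Slicing.vanishing_integrand_wedge C hg hα
  have h0 : ∀ᵐ r, C.sublevelEval g α.d r - T.sliceIntegral (C.integrand (wedge g α)) r = 0 := by
    refine ae_eq_zero_of_integral_contDiff_smul_eq_zero
      ((C.locallyIntegrable_sublevelEval hg.continuous hα.d).sub
        (T.integrable_sliceIntegral hg hw hv).locallyIntegrable) fun ψ hψ hψc => ?_
    have hψi : Integrable ψ := hψ.continuous.integrable_of_hasCompactSupport hψc
    have hψg : ContMDiff (𝓡 m) 𝓘(ℝ, ℝ) ∞ fun x => ψ (g x) := hψ.contMDiff.comp hg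
    have hWi : Integrable (fun p => ψ (g (C.pos p)) * C.integrand (wedge g α) p) C.meas := by
      refine (C.integrable_integrand ((hα.wedge hg).fsmul hψg).isContTest).congr
        (Filter.Eventually.of_forall fun p => ?_)
      exact C.integrand_fsmul _ _ p
    have hWv : Slicing.Vanishing C g fun p => ψ (g (C.pos p)) * C.integrand (wedge g α) p :=
      fun p hp => by simp only [hv p hp, mul_zero]
    have hco := T.integral_sliceIntegral hg hWi hWv
    have hcoi := T.integrable_sliceIntegral hg hWi hWv
    rw [funext (T.sliceIntegral_comp_mul hg (C.integrand (wedge g α)) ψ)] at hco hcoi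
    simp_rw [smul_eq_mul, mul_sub]
    rw [integral_sub (C.integrable_mul_sublevelEval hg.continuous hα.d hψi) hcoi, hco,
      C.integral_mul_sublevelEval hg.continuous hα.d hψi]
    have hhg : ContMDiff (𝓡 m) 𝓘(ℝ, ℝ) ∞ fun x => tailIntegral ψ (g x) :=
      (contDiff_tailIntegral hψ hψc).contMDiff.comp hg
    rw [← C.eval_fsmul hα.d hhg, ← C.eval_fsmul (hα.wedge hg) hψg,
      RectCurrent.eval_fsmul_tailIntegral hC hg hψ hψc hα, sub_self]
  filter_upwards [h0] with r hr using sub_eq_zero.1 hr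

namespace RectCurrent

lemma eval_sub {n : ℕ} [Fact (n = 1 ∨ n = 2)] (C : RectCurrent m n X) {η ζ : DiffForm m n X}
    (hη : η.IsTest) (hζ : ζ.IsTest) : C.eval (η - ζ) = C.eval η - C.eval ζ := by
  have h := C.eval_add (hη.sub hζ) hζ
  rw [sub_add_cancel] at h
  linarith

lemma abs_eval_sub_le {n : ℕ} [Fact (n = 1 ∨ n = 2)] (C : RectCurrent m n X)
    {η ζ : DiffForm m n X} (hη : η.IsTest) (hζ : ζ.IsTest) {δ : ℝ} (hδ : 0 ≤ δ) {K : Set X}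
    (hK : IsCompact K) (h0 : ∀ x ∉ K, η x = 0) (h0' : ∀ x ∉ K, ζ x = 0)
    (hle : ∀ x (v : Fin n → TangentSpace (𝓡 m) x), (∀ i, ‖v i‖ ≤ 1) → |η x v - ζ x v| ≤ δ) :
    |C.eval η - C.eval ζ| ≤ δ * (C.presMass K).toReal := by
  rw [← C.eval_sub hη hζ]
  refine C.abs_eval_le (hη.sub hζ) hδ hK (fun x hx => ?_) hle
  rw [Pi.sub_apply, h0 x hx, h0' x hx, sub_zero]

end RectCurrent

/-- For almost every `r`, the boundary of the restriction of a cycle to `{g < r}` is a rectifiable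
current. -/
theorem ae_exists_hasBoundary_restrict_sublevel {C : RectCurrent m 2 X} (hC : C.IsCycle)
    {g : X → ℝ} (hg : ContMDiff (𝓡 m) 𝓘(ℝ, ℝ) ∞ g) {M : ℝ} (hM0 : 0 ≤ M)
    (hM : ∀ x (v : TangentSpace (𝓡 m) x), |dfun g x v| ≤ M * ‖v‖)
    (hB : ∀ r : ℝ, MeasurableSet {x | g x < r}) :
    ∀ᵐ r, ∃ γ : RectCurrent m 1 X, (C.restrict {x | g x < r} (hB r)).HasBoundary γ := by
  obtain ⟨T⟩ := exists_slicing C hg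
  have := sigmaCompactSpace_of_chartedSpace m X
  have : LocallyCompactSpace X := ChartedSpace.locallyCompactSpace (EuclideanSpace ℝ (Fin m)) X
  have hKc := (CompactExhaustion.choice X).isCompact
  choose D hDc hDt hD using fun k => exists_countable_dense_testForms (m := m) (n := 1) (hKc k)
  -- The exceptional null set depends on the form, so the identity is first secured for countably
  -- many forms.
  have hae : ∀ᵐ r, ∀ k, ∀ β ∈ D k,
      C.sublevelEval g β.d r = T.sliceIntegral (C.integrand (wedge g β)) r := by
    rw [ae_all_iff]
    intro k
    rw [ae_ball_iff (hDc k)]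
    exact fun β hβ => T.ae_sublevelEval_eq hC hg (hDt k β hβ).1
  filter_upwards [hae, T.ae_admissible hg hM0 hM] with r hr hadm
  refine ⟨T.current hg r hadm, fun α hα => ?_⟩
  set γ := T.current hg r hadm with hγ
  set C' := C.restrict {x | g x < r} (hB r) with hC'
  obtain ⟨K, hK, h0⟩ := hα.compact_support
  obtain ⟨k, hk⟩ := (CompactExhaustion.choice X).exists_superset_of_isCompact hK
  set K' := (CompactExhaustion.choice X) k with hK'
  have h0' : ∀ x ∉ K', α x = 0 := fun x hx => h0 x fun h => hx (hk h)
  rw [← sub_eq_zero, ← abs_eq_zero]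
  refine le_antisymm (le_of_forall_pos_le_add fun ε hε => ?_) (abs_nonneg _)
  set R := (C'.presMass K').toReal + (γ.presMass K').toReal + 1 with hR
  have hR0 : 0 < R := by positivity
  -- Both currents have finite mass over `K'`, and `β` is close to `α` together with its
  -- differential, so the identity passes from `β` to `α` with total error at most `ε`.
  obtain ⟨β, hβD, hβ1, hβ2⟩ := hD k α hα h0' (ε / R) (div_pos hε hR0)
  obtain ⟨hβt, hβ0⟩ := hDt k β hβD
  have heq : C'.eval β.d = γ.eval β := by
    rw [hC', C.eval_restrict_sublevel (hB r) hβt.d, hr k β hβD, hγ, T.eval_current hg r hadm hβt]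
  have hε0 : 0 ≤ ε / R := (div_pos hε hR0).le
  have e1 := C'.abs_eval_sub_le hβt.d hα.d hε0 (hKc k)
    (fun x hx => DiffForm.d_eq_zero (hKc k) hβ0 hx)
    (fun x hx => DiffForm.d_eq_zero (hKc k) h0' hx) hβ2
  have e2 := γ.abs_eval_sub_le hβt hα hε0 (hKc k) hβ0 h0' hβ1
  have e3 : ε / R * (C'.presMass K').toReal + ε / R * (γ.presMass K').toReal ≤ ε := by
    rw [← mul_add]
    calc _ ≤ ε / R * R := by gcongr; rw [hR]; linarith
      _ = ε := div_mul_cancel₀ _ hR0.ne'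
  have e4 : C'.eval α.d - γ.eval α = -(C'.eval β.d - C'.eval α.d) + (γ.eval β - γ.eval α) := by
    rw [heq]; ring
  rw [e4, zero_add]
  refine (abs_add_le _ _).trans ?_
  rw [abs_neg]
  linarith

end SliceTheorem

/-! ### The mass of the slice is bounded by the derivative of the area. -/

section SliceMass

open scoped Topology

/-- A normalised bump centred at `r - δ/2`, with support of radius `δ/2` and plateau of radius
`qδ/2`; its height is at most the inverse length `(qδ)⁻¹` of the plateau. -/
lemma exists_cutoff {r δ q : ℝ} (hδ : 0 < δ) (hq0 : 0 < q) (hq1 : q < 1) :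
    ∃ ψ : ℝ → ℝ, ContDiff ℝ ∞ ψ ∧ HasCompactSupport ψ ∧ (∀ x, 0 ≤ ψ x) ∧
      (∀ x, ψ x ≤ (q * δ)⁻¹) ∧ (∀ x ≤ r - δ, ψ x = 0) ∧ (∀ x, r ≤ x → ψ x = 0) ∧
      ∫ x, ψ x = 1 := by
  let φ : ContDiffBump (r - δ / 2) := ⟨q * (δ / 2), δ / 2, by positivity, by nlinarith⟩
  have hs : ∀ x, x ∉ Metric.ball (r - δ / 2) (δ / 2) → φ.normed volume x = 0 := by
    intro x hx
    have h := φ.support_normed_eq (μ := volume)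
    rw [← Function.notMem_support, h]
    exact hx
  refine ⟨φ.normed volume, φ.contDiff_normed, φ.hasCompactSupport_normed, φ.nonneg_normed,
    fun x => ?_, fun x hx => hs x ?_, fun x hx => hs x ?_, φ.integral_normed⟩
  · have h := φ.normed_le_div_measure_closedBall_rIn volume x
    rw [Measure.real, Real.volume_closedBall, ENNReal.toReal_ofReal] at h
    · refine h.trans (le_of_eq ?_)
      change 1 / (2 * (q * (δ / 2))) = _
      rw [one_div]
      congr 1
      ring
    · change 0 ≤ 2 * (q * (δ / 2)); positivity
  · rw [Metric.mem_ball, Real.dist_eq, not_lt, le_abs]; right; linarith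
  · rw [Metric.mem_ball, Real.dist_eq, not_lt, le_abs]; left; linarith

lemma tailIntegral_eq_integral {ψ : ℝ → ℝ} {x : ℝ} (h : ∀ y ≤ x, ψ y = 0) :
    tailIntegral ψ x = ∫ y, ψ y := by
  refine integral_congr_ae (Filter.Eventually.of_forall fun y => ?_)
  by_cases hy : y ∈ Ioi x
  · exact indicator_of_mem hy _
  · rw [indicator_of_notMem hy, h y (not_lt.1 hy)]

lemma tailIntegral_eq_zero {ψ : ℝ → ℝ} {x : ℝ} (h : ∀ y, x ≤ y → ψ y = 0) :
    tailIntegral ψ x = 0 := by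
  rw [tailIntegral, ← integral_zero ℝ ℝ]
  refine integral_congr_ae (Filter.Eventually.of_forall fun y => ?_)
  by_cases hy : y ∈ Ioi x
  · rw [indicator_of_mem hy, h y (le_of_lt hy)]
  · rw [indicator_of_notMem hy]

lemma abs_tailIntegral_le {ψ : ℝ → ℝ} (h0 : ∀ y, 0 ≤ ψ y) (hi : Integrable ψ) (x : ℝ) :
    |tailIntegral ψ x| ≤ ∫ y, ψ y := by
  rw [tailIntegral, abs_of_nonneg (integral_nonneg fun y => indicator_nonneg (fun y _ => h0 y) y)]
  exact integral_mono (hi.indicator measurableSet_Ioi) hi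
    fun y => indicator_le_self' (fun y _ => h0 y) y

variable {m : ℕ} {X : Type*} [EMetricSpace X]
  [ChartedSpace (EuclideanSpace ℝ (Fin m)) X] [IsManifold (𝓡 m) ∞ X]
  [RiemannianBundle (fun x : X => TangentSpace (𝓡 m) x)]

lemma abs_wedge_le {g : X → ℝ} (hg : ContMDiff (𝓡 m) 𝓘(ℝ, ℝ) ∞ g) {M : ℝ} (hM0 : 0 ≤ M)
    (hM : ∀ x (v : TangentSpace (𝓡 m) x), |dfun g x v| ≤ M * ‖v‖) {α : DiffForm m 1 X}
    (hα : α.IsTest) (hα1 : α.ComassLEOne) (x : X) (v : Fin 2 → TangentSpace (𝓡 m) x)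
    (hv : ∀ i, ‖v i‖ ≤ 1) : |wedge g α x v| ≤ M := by
  have : FiniteDimensional ℝ (TangentSpace (𝓡 m) x) :=
    inferInstanceAs (FiniteDimensional ℝ (EuclideanSpace ℝ (Fin m)))
  rw [wedge_apply hg hα]
  have h1 := abs_alternating_one_le (hα1 x) fun _ => kernelVector (dfun g x) v
  rw [one_mul, det_gram_one, Real.sqrt_sq (norm_nonneg _)] at h1
  have h2 := norm_kernelVector_le hM0 (hM x) v
  calc _ ≤ _ := h1
    _ ≤ _ := h2
    _ ≤ M * 1 := by gcongr; exact sqrt_det_gram_le_one hv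
    _ = M := mul_one M

variable [IsContinuousRiemannianBundle (EuclideanSpace ℝ (Fin m))
      (fun x : X => TangentSpace (𝓡 m) x)]
  [IsRiemannianManifold (𝓡 m) X] [SecondCountableTopology X]
  [MeasurableSpace X] [BorelSpace X]

namespace RectCurrent

/-- Dual to `d ∘ d = 0`; a filling function applies only to cycles. -/
lemma HasBoundary.isCycle {C : RectCurrent m 2 X} {γ : RectCurrent m 1 X} (h : C.HasBoundary γ) :
    γ.IsCycle := by
  intro α hα
  rw [← h _ hα.d]
  have : α.d.d = 0 := funext fun x => hα.d_d x
  rw [this]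
  exact C.eval_zero

/-- The restriction of `C` to the sublevel set `{g < r}`. -/
def sublevel (C : RectCurrent m 2 X) (g : X → ℝ) (hB : ∀ r : ℝ, MeasurableSet {x | g x < r})
    (r : ℝ) : RectCurrent m 2 X :=
  C.restrict {x | g x < r} (hB r)

/-- The mass of the slice is at most the derivative of the mass of the sublevel sets. -/
theorem mass_le_of_hasDerivAt {C : RectCurrent m 2 X} (hC : C.IsCycle)
    {g : X → ℝ} (hg : ContMDiff (𝓡 m) 𝓘(ℝ, ℝ) ∞ g) {M : ℝ} (hM0 : 0 < M)
    (hM : ∀ x (v : TangentSpace (𝓡 m) x), |dfun g x v| ≤ M * ‖v‖)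
    (hB : ∀ r : ℝ, MeasurableSet {x | g x < r}) {r : ℝ} {γ : RectCurrent m 1 X}
    (hγ : (C.sublevel g hB r).HasBoundary γ) (hfin : (C.sublevel g hB r).mass < ⊤) {A' : ℝ}
    (hA : HasDerivAt (fun r => (C.sublevel g hB r).mass.toReal) A' r) :
    γ.mass ≤ ENNReal.ofReal (M * A') := by
  refine iSup_le fun α => iSup_le fun hα => iSup_le fun hα1 => ENNReal.ofReal_le_ofReal ?_
  rw [← hγ α hα]
  have hopen : ∀ r, IsOpen {x | g x < r} := fun r => isOpen_lt hg.continuous continuous_const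
  set A : ℝ → ℝ := fun r => (C.sublevel g hB r).mass.toReal with hAdef
  -- The factor `q` pays for the smoothness of the cutoff, whose height exceeds `1/δ`; it tends to
  -- one at the end.
  have key : ∀ q ∈ Ioo (0 : ℝ) 1, (C.sublevel g hB r).eval α.d * q ≤ M * A' := by
    rintro q ⟨hq0, hq1⟩
    set δ : ℕ → ℝ := fun j => 1 / ((j : ℝ) + 1) with hδ
    have hδ0 : ∀ j, 0 < δ j := fun j => Nat.one_div_pos_of_nat
    have hδlim : Filter.Tendsto δ Filter.atTop (𝓝 0) := tendsto_one_div_add_atTop_nhds_zero_nat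
    choose ψ hψ hψc hψ0 hψle hψl hψr hψi using fun j => exists_cutoff (r := r) (hδ0 j) hq0 hq1
    have hint : ∀ j, Integrable (ψ j) := fun j =>
      (hψ j).continuous.integrable_of_hasCompactSupport (hψc j)
    have hlim := C.tendsto_eval_fsmul (hB r) hα.d (l := Filter.atTop)
      (χ := fun j x => tailIntegral (ψ j) (g x))
      (fun j => (contDiff_tailIntegral (hψ j) (hψc j)).contMDiff.comp hg)
      (fun j x => (abs_tailIntegral_le (hψ0 j) (hint j) _).trans (hψi j).le) (fun x => by
        by_cases hx : g x < r
        · rw [indicator_of_mem (show x ∈ {x | g x < r} from hx)]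
          refine tendsto_const_nhds.congr' ?_
          filter_upwards [hδlim.eventually_lt_const (sub_pos.2 hx)] with j hj
          rw [← hψi j]
          exact (tailIntegral_eq_integral fun y hy => hψl j y (by linarith)).symm
        · rw [indicator_of_notMem (show x ∉ {x | g x < r} from hx)]
          refine tendsto_const_nhds.congr fun j => ?_
          exact (tailIntegral_eq_zero fun y hy => hψr j y ((not_lt.1 hx).trans hy)).symm)
    have hslope : Filter.Tendsto (fun j => M * ((A (r - δ j) - A r) / (-δ j))) Filter.atTop
        (𝓝 (M * A')) := by
      refine Filter.Tendsto.const_mul M ?_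
      have h1 := hasDerivAt_iff_tendsto_slope_zero.1 hA
      have h2 : Filter.Tendsto (fun j => -δ j) Filter.atTop (𝓝[≠] 0) := by
        refine tendsto_nhdsWithin_iff.2 ⟨by simpa using hδlim.neg, Filter.Eventually.of_forall
          fun j => ?_⟩
        exact neg_ne_zero.2 (hδ0 j).ne'
      refine (h1.comp h2).congr fun j => ?_
      simp only [Function.comp_apply, smul_eq_mul, ← sub_eq_add_neg]
      rw [div_eq_inv_mul]
    refine le_of_tendsto_of_tendsto' (hlim.mul_const q) hslope fun j => ?_
    rw [eval_fsmul_tailIntegral hC hg (hψ j) (hψc j) hα]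
    have hψg : ContMDiff (𝓡 m) 𝓘(ℝ, ℝ) ∞ fun x => ψ j (g x) := (hψ j).contMDiff.comp hg
    have hqδ : 0 < (q * δ j)⁻¹ := inv_pos.2 (mul_pos hq0 (hδ0 j))
    -- The form `ψ(g) dg ∧ α` lives on the annulus `r - δ ≤ g < r` and has comass at most `M /
    -- (qδ)`, which gives the left difference quotient of the area.
    have h3 := C.eval_le_mass_sub_mass (hopen (r - δ j)) (hopen r)
      (fun x (hx : g x < r - δ j) => show g x < r by linarith [hδ0 j]) hfin
      ((hα.wedge hg).fsmul hψg) (M := (q * δ j)⁻¹ * M) (by positivity)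
      (fun x v hv => by
        simp only [DiffForm.fsmul, ContinuousAlternatingMap.smul_apply, smul_eq_mul, abs_mul]
        rw [abs_of_nonneg (hψ0 j _)]
        exact mul_le_mul (hψle j _) (abs_wedge_le hg hM0.le hM hα hα1 x v hv) (abs_nonneg _) hqδ.le)
      (fun x hx => by
        simp only [DiffForm.fsmul, hψl j (g x) (le_of_lt hx), zero_smul])
      (fun x hx => by
        simp only [DiffForm.fsmul, hψr j (g x) (not_lt.1 hx), zero_smul])
    have h4 : M * ((A (r - δ j) - A r) / -δ j) = (q * δ j)⁻¹ * M * (A r - A (r - δ j)) * q := by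
      have := (hδ0 j).ne'
      field_simp
      ring
    rw [h4]
    exact mul_le_mul_of_nonneg_right h3 hq0.le
  have hlim : Filter.Tendsto (fun q : ℝ => (C.sublevel g hB r).eval α.d * q) (𝓝[<] 1)
      (𝓝 ((C.sublevel g hB r).eval α.d * 1)) :=
    (Filter.Tendsto.const_mul _ Filter.tendsto_id).mono_left nhdsWithin_le_nhds
  rw [mul_one] at hlim
  refine le_of_tendsto hlim ?_
  filter_upwards [Ioo_mem_nhdsLT zero_lt_one] with q hq using key q hq

end RectCurrent
end SliceMass

/-! ### Smoothing Lipschitz functions in a chart. -/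

section LocalApprox

open scoped Topology

lemma abs_le_of_hasFDerivAt_of_abs_sub_le {E : Type*} [NormedAddCommGroup E] [NormedSpace ℝ E]
    {G : E → ℝ} {G' : E →L[ℝ] ℝ} {z : E} (hG : HasFDerivAt G G' z) {N : E → ℝ}
    (hN0 : ∀ w, 0 ≤ N w) (hN : ∀ (s : ℝ) w, N (s • w) = |s| * N w)
    (h : ∀ᶠ w in 𝓝 z, |G w - G z| ≤ N (w - z)) (v : E) : |G' v| ≤ N v := by
  have hl : HasDerivAt (fun s : ℝ => z + s • v) v 0 := by
    simpa using ((hasDerivAt_id (0 : ℝ)).smul_const v).const_add z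
  have hz : z + (0 : ℝ) • v = z := by simp
  have hd : HasDerivAt (fun s : ℝ => G (z + s • v)) (G' v) 0 := by
    have hG2 : HasFDerivAt G G' (z + (0 : ℝ) • v) := by rwa [hz]
    exact hG2.comp_hasDerivAt (0 : ℝ) hl
  rw [← Real.norm_eq_abs]
  refine hd.le_of_lip' (hN0 v) ?_
  have ht : Filter.Tendsto (fun s : ℝ => z + s • v) (𝓝 0) (𝓝 z) := by
    have := hl.continuousAt.tendsto
    rwa [hz] at this
  filter_upwards [ht.eventually h] with s hs
  have e : z + s • v - z = s • v := by abel
  rw [e, hN] at hs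
  rw [hz, Real.norm_eq_abs, Real.norm_eq_abs, sub_zero]
  linarith [mul_comm (N v) |s|]

/-- Convolution with a bump averages translates of `R`, each satisfying the same Lipschitz estimate
for `N`, so that estimate survives with no loss. The radius `δ ≤ r/2` keeps the translates in the
ball; `δ ≤ ε/(L+1)` gives closeness. -/
lemma exists_contDiff_approx {E : Type*} [NormedAddCommGroup E] [NormedSpace ℝ E]
    [FiniteDimensional ℝ E] [MeasurableSpace E] [BorelSpace E] {R : E → ℝ} {N : E → ℝ} {z₀ : E}
    {r : ℝ} {L : ℝ≥0} (hN : ∀ w, N w ≤ L * ‖w‖)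
    (hR : ∀ z ∈ Metric.ball z₀ r, ∀ w ∈ Metric.ball z₀ r, |R w - R z| ≤ N (w - z))
    (hr : 0 < r) {ε : ℝ} (hε : 0 < ε) :
    ∃ G : E → ℝ, ContDiff ℝ ∞ G ∧ (∀ z ∈ Metric.ball z₀ (r / 2), |G z - R z| ≤ ε) ∧
      ∀ z ∈ Metric.ball z₀ (r / 2), ∀ w ∈ Metric.ball z₀ (r / 2), |G w - G z| ≤ N (w - z) := by
  have hRL : LipschitzOnWith L R (Metric.ball z₀ r) := by
    refine LipschitzOnWith.of_dist_le_mul fun w hw z hz => ?_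
    rw [Real.dist_eq, dist_eq_norm]
    exact (hR z hz w hw).trans (hN _)
  obtain ⟨S, hS, hRS⟩ := hRL.extend_real
  set δ : ℝ := min (r / 2) (ε / (L + 1)) with hδ
  have hδ0 : 0 < δ := lt_min (by positivity) (by positivity)
  have hδr : δ ≤ r / 2 := min_le_left _ _
  have hδε : L * δ ≤ ε := by
    have h1 : δ ≤ ε / (L + 1) := min_le_right _ _
    rw [le_div_iff₀ (by positivity)] at h1
    nlinarith
  let φ : ContDiffBump (0 : E) := ⟨δ / 2, δ, by positivity, by linarith⟩
  let μ : Measure E := Measure.addHaar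
  have hφc : Continuous (φ.normed μ) := φ.continuous_normed
  have hint : ∀ x, Integrable (fun t => φ.normed μ t * S (x - t)) μ := fun x =>
    (hφc.mul (hS.continuous.comp (continuous_const.sub continuous_id))).integrable_of_hasCompactSupport
      (φ.hasCompactSupport_normed.mul_right)
  have hval : ∀ x, MeasureTheory.convolution (φ.normed μ) S (ContinuousLinearMap.lsmul ℝ ℝ) μ x =
      ∫ t, φ.normed μ t * S (x - t) ∂μ := fun x => by
    simp [MeasureTheory.convolution_def]
  refine ⟨MeasureTheory.convolution (φ.normed μ) S (ContinuousLinearMap.lsmul ℝ ℝ) μ,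
    φ.hasCompactSupport_normed.contDiff_convolution_left _ φ.contDiff_normed
      hS.continuous.locallyIntegrable, fun z hz => ?_, fun z hz w hw => ?_⟩
  · rw [hRS (Metric.ball_subset_ball (by linarith) hz), ← Real.dist_eq]
    refine φ.dist_normed_convolution_le hS.continuous.aestronglyMeasurable fun x hx => ?_
    refine (hS.dist_le_mul x z).trans (le_trans ?_ hδε)
    have : dist x z < δ := hx
    gcongr
  · rw [hval, hval, ← integral_sub (hint w) (hint z)]
    have hmem : ∀ x ∈ Metric.ball z₀ (r / 2), ∀ t ∈ Metric.ball (0 : E) δ,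
        x - t ∈ Metric.ball z₀ r := by
      intro x hx t ht
      rw [Metric.mem_ball, dist_eq_norm] at *
      rw [sub_zero] at ht
      calc ‖x - t - z₀‖ = ‖(x - z₀) - t‖ := by congr 1; abel
        _ ≤ ‖x - z₀‖ + ‖t‖ := norm_sub_le _ _
        _ < r := by linarith
    rw [← Real.norm_eq_abs]
    calc ‖∫ t, (φ.normed μ t * S (w - t) - φ.normed μ t * S (z - t)) ∂μ‖
        ≤ ∫ t, φ.normed μ t * N (w - z) ∂μ := by
          refine norm_integral_le_of_norm_le (φ.integrable_normed.mul_const _)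
            (Filter.Eventually.of_forall fun t => ?_)
          rw [← mul_sub, Real.norm_eq_abs, abs_mul, abs_of_nonneg (φ.nonneg_normed t)]
          by_cases ht : t ∈ Metric.ball (0 : E) δ
          · refine mul_le_mul_of_nonneg_left ?_ (φ.nonneg_normed t)
            rw [← hRS (hmem w hw t ht), ← hRS (hmem z hz t ht)]
            refine (hR _ (hmem z hz t ht) _ (hmem w hw t ht)).trans (le_of_eq ?_)
            congr 1; abel
          · have h0 : φ.normed μ t = 0 := by
              rw [← Function.notMem_support, φ.support_normed_eq]
              exact ht
            simp [h0]
      _ = N (w - z) := by rw [integral_mul_const, φ.integral_normed, one_mul]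

variable {m : ℕ} {X : Type*} [EMetricSpace X]
  [ChartedSpace (EuclideanSpace ℝ (Fin m)) X] [IsManifold (𝓡 m) ∞ X]
  [RiemannianBundle (fun x : X => TangentSpace (𝓡 m) x)]
  [IsContinuousRiemannianBundle (EuclideanSpace ℝ (Fin m)) (fun x : X => TangentSpace (𝓡 m) x)]
  [IsRiemannianManifold (𝓡 m) X]

/-- One factor `κ` comes from reading `ρ` in the chart, the other from returning to the Riemannian
norm. `U` and `K` are chosen before `ε`, so that `ε` may later depend on bounds over `K`. -/
lemma exists_local_smooth_approx {ρ : X → ℝ} (hρ : ∀ x y, ENNReal.ofReal |ρ x - ρ y| ≤ edist x y)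
    {κ : ℝ} (hκ : 1 < κ) (c : X) :
    ∃ U K : Set X, c ∈ U ∧ IsOpen U ∧ IsCompact K ∧ U ⊆ K ∧ ∀ ε : ℝ, 0 < ε →
      ∃ G : X → ℝ, ContMDiffOn (𝓡 m) 𝓘(ℝ, ℝ) ∞ G U ∧ (∀ x ∈ U, |G x - ρ x| ≤ ε) ∧
        ∀ x ∈ U, ∀ v, |dfun (m := m) G x v| ≤ κ ^ 2 * ‖v‖ := by
  obtain ⟨U₀, hcU₀, hU₀⟩ := exists_isAdapted (m := m) hκ c
  set e := extChartAt (𝓡 m) c with he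
  have hκ0 : 0 < κ := by linarith
  have hnhds : e.target ∩ e.symm ⁻¹' U₀ ∈ 𝓝 (e c) := by
    refine Filter.inter_mem ((isOpen_target c).mem_nhds (mem_extChartAt_target c)) ?_
    refine (continuousAt_extChartAt_symm c).preimage_mem_nhds ?_
    rw [extChartAt_to_inv c]
    exact hU₀.isOpen.mem_nhds hcU₀
  obtain ⟨r, hr, hball⟩ := Metric.mem_nhds_iff.1 hnhds
  obtain ⟨L, hL0, hL⟩ := chartNorm_le (m := m) c
  have hlip : ∀ z ∈ Metric.ball (e c) r, ∀ w ∈ Metric.ball (e c) r,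
      |(ρ ∘ e.symm) w - (ρ ∘ e.symm) z| ≤ κ * chartNorm c (w - z) := by
    intro z hz w hw
    have h := (hρ (e.symm z) (e.symm w)).trans
      (edist_extChartAt_symm_le hU₀ (fun z hz => hball hz) hz hw)
    rw [ENNReal.ofReal_le_ofReal_iff (mul_nonneg hκ0.le (chartNorm_nonneg _ _))] at h
    rwa [abs_sub_comm]
  have hopen : IsOpen (e.source ∩ e ⁻¹' Metric.ball (e c) (r / 2)) :=
    isOpen_extChartAt_preimage' c Metric.isOpen_ball
  have hsub : Metric.closedBall (e c) (r / 2) ⊆ e.target ∩ e.symm ⁻¹' U₀ :=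
    (Metric.closedBall_subset_ball (by linarith)).trans hball
  refine ⟨e.source ∩ e ⁻¹' Metric.ball (e c) (r / 2), e.symm '' Metric.closedBall (e c) (r / 2),
    ⟨mem_extChartAt_source c, Metric.mem_ball_self (by positivity)⟩, hopen,
    (isCompact_closedBall _ _).image_of_continuousOn
      ((continuousOn_extChartAt_symm c).mono fun z hz => (hsub hz).1),
    fun x hx => ⟨e x, Metric.ball_subset_closedBall hx.2, e.left_inv hx.1⟩, fun ε hε => ?_⟩
  obtain ⟨G, hG, hGR, hGN⟩ := exists_contDiff_approx (N := fun w => κ * chartNorm c w)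
    (L := ⟨κ * L, by positivity⟩) (fun w => by
      change κ * chartNorm c w ≤ κ * L * ‖w‖
      rw [mul_assoc]; gcongr; exact hL w) hlip hr hε
  refine ⟨G ∘ e, ?_, fun x hx => ?_, fun x hx v => ?_⟩
  · exact hG.contMDiff.comp_contMDiffOn ((contMDiffOn_extChartAt (I := 𝓡 m) (n := ∞)).mono
      fun x hx => by simpa [he] using hx.1)
  · have := hGR _ hx.2
    simpa [e.left_inv hx.1] using this
  · have hd : HasFDerivAt G (fderiv ℝ G (e x)) (e x) :=
      (hG.contDiffAt.differentiableAt (by simp)).hasFDerivAt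
    have h1 : HasMFDerivAt (𝓡 m) 𝓘(ℝ, ℝ) (G ∘ e) x (fderiv ℝ G (e x) ∘L dchart c x) :=
      hd.hasMFDerivAt.comp x (hasMFDerivAt_extChartAt hx.1)
    have h2 : dfun (m := m) (G ∘ e) x v = fderiv ℝ G (e x) (dchart c x v) := by
      unfold dfun; rw [h1.mfderiv]; rfl
    rw [h2]
    have hxU : x ∈ U₀ := by
      have := (hsub (Metric.ball_subset_closedBall hx.2)).2
      rwa [mem_preimage, e.left_inv hx.1] at this
    calc |fderiv ℝ G (e x) (dchart c x v)| ≤ κ * chartNorm c (dchart c x v) := by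
          refine abs_le_of_hasFDerivAt_of_abs_sub_le hd (N := fun w => κ * chartNorm c w)
            (fun w => mul_nonneg hκ0.le (chartNorm_nonneg c w))
            (fun s w => by rw [chartNorm_smul]; ring) ?_ _
          filter_upwards [Metric.isOpen_ball.mem_nhds hx.2] with w hw
          exact hGN _ hx.2 _ hw
      _ ≤ κ * (κ * ‖v‖) := by gcongr; exact hU₀.chartNorm_dchart_le x hxU v
      _ = κ ^ 2 * ‖v‖ := by ring

end LocalApprox

/-! ### Gluing the local approximations. -/

section SmoothApprox

open scoped Topology

variable {m : ℕ} {X : Type*} [EMetricSpace X]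
  [ChartedSpace (EuclideanSpace ℝ (Fin m)) X] [IsManifold (𝓡 m) ∞ X]

/-- Subtracting a constant `t`, later the value `ρ x`, makes the terms with `dχ i` carry the small
factor `G i x - ρ x`. -/
lemma dfun_eq_sum_of_partition {ι : Type*} (F : Finset ι) {χ G : ι → X → ℝ} {g : X → ℝ} {x : X}
    {t : ℝ} (hχ : ∀ i ∈ F, MDifferentiableAt (𝓡 m) 𝓘(ℝ, ℝ) (χ i) x)
    (hG : ∀ i ∈ F, MDifferentiableAt (𝓡 m) 𝓘(ℝ, ℝ) (G i) x)
    (hg : MDifferentiableAt (𝓡 m) 𝓘(ℝ, ℝ) g x)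
    (h : ∀ᶠ y in 𝓝 x, g y = t + ∑ i ∈ F, χ i y * (G i y - t)) (v : TangentSpace (𝓡 m) x) :
    dfun g x v = ∑ i ∈ F, (χ i x * dfun (G i) x v + (G i x - t) * dfun (χ i) x v) := by
  have hx := mem_extChartAt_source (I := 𝓡 m) x
  set e := extChartAt (𝓡 m) x with he
  have hex : e.symm (e x) = x := extChartAt_to_inv x
  have h1 := hasFDerivAt_comp_chart_symm hx hg
  have h2 : HasFDerivAt (fun z => t + ∑ i ∈ F, (χ i ∘ e.symm) z * ((G i ∘ e.symm) z - t))
      (∑ i ∈ F, ((χ i ∘ e.symm) (e x) • (dfun (G i) x ∘L dsymm x x) +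
        ((G i ∘ e.symm) (e x) - t) • (dfun (χ i) x ∘L dsymm x x))) (e x) := by
    refine HasFDerivAt.const_add _ (HasFDerivAt.fun_sum fun i hi => ?_)
    exact (hasFDerivAt_comp_chart_symm hx (hχ i hi)).mul
      ((hasFDerivAt_comp_chart_symm hx (hG i hi)).sub_const t)
  have hev : g ∘ e.symm =ᶠ[𝓝 (e x)]
      fun z => t + ∑ i ∈ F, (χ i ∘ e.symm) z * ((G i ∘ e.symm) z - t) := by
    have hc : Filter.Tendsto e.symm (𝓝 (e x)) (𝓝 x) := by
      have := (continuousAt_extChartAt_symm (I := 𝓡 m) x).tendsto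
      rwa [hex] at this
    exact hc.eventually h
  have h3 := congrArg (fun A => A (dchart x x v)) (h1.unique (h2.congr_of_eventuallyEq hev))
  simpa [hex, dsymm_dchart hx] using h3

variable [RiemannianBundle (fun x : X => TangentSpace (𝓡 m) x)]
  [IsContinuousRiemannianBundle (EuclideanSpace ℝ (Fin m)) (fun x : X => TangentSpace (𝓡 m) x)]
  [IsRiemannianManifold (𝓡 m) X] [SecondCountableTopology X]

/-- A `1`-Lipschitz function is uniformly close to a smooth function with almost the same
Lipschitz constant. -/
lemma exists_smooth_approx {ρ : X → ℝ} (hρ : ∀ x y, ENNReal.ofReal |ρ x - ρ y| ≤ edist x y)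
    {ε : ℝ} (hε : 0 < ε) :
    ∃ g : X → ℝ, ContMDiff (𝓡 m) 𝓘(ℝ, ℝ) ∞ g ∧ (∀ x, |g x - ρ x| ≤ ε) ∧
      ∀ x v, |dfun (m := m) g x v| ≤ (1 + ε) * ‖v‖ := by
  have := sigmaCompactSpace_of_chartedSpace m X
  set κ : ℝ := √(1 + ε / 2) with hκ
  have hκ1 : 1 < κ := by rw [hκ, Real.lt_sqrt zero_le_one]; linarith
  have hκ2 : κ ^ 2 = 1 + ε / 2 := Real.sq_sqrt (by linarith)
  choose U K hcU hUo hK hUK hG using exists_local_smooth_approx (m := m) hρ hκ1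
  obtain ⟨T, hT, hTU⟩ := TopologicalSpace.countable_cover_nhds fun x => (hUo x).mem_nhds (hcU x)
  have : Encodable T := hT.toEncodable
  obtain ⟨χ, hχ⟩ := SmoothPartitionOfUnity.exists_isSubordinate (𝓡 m) isClosed_univ
    (fun i : T => U i) (fun i => hUo i) (by
      intro x _
      have : x ∈ ⋃ x ∈ T, U x := hTU ▸ mem_univ x
      obtain ⟨i, hi, hx⟩ := mem_iUnion₂.1 this
      exact mem_iUnion.2 ⟨⟨i, hi⟩, hx⟩)
  choose M hM0 hM using fun i : T => exists_abs_dfun_le (m := m) (χ i).contMDiff (hK i)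
  obtain ⟨w, hw0, W, hW, hWε⟩ := posSumOfEncodable (half_pos hε) T
  -- The `i`-th approximation is made so good that its error times the bound for `dχ i` is at most
  -- `w i`, and the `w i` sum to at most `ε/2`. The other half of `ε` is in `κ ^ 2 = 1 + ε/2`.
  set δ : T → ℝ := fun i => min ε (w i / (M i + 1)) with hδ
  have hδ0 : ∀ i, 0 < δ i := fun i =>
    lt_min hε (div_pos (hw0 i) (by linarith [hM0 i]))
  have hδM : ∀ i, δ i * M i ≤ w i := fun i => by
    have h1 : δ i ≤ w i / (M i + 1) := min_le_right _ _
    rw [le_div_iff₀ (by linarith [hM0 i])] at h1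
    nlinarith [hδ0 i]
  choose G hGs hGρ hGd using fun i : T => hG i (δ i) (hδ0 i)
  have hGat : ∀ i, ∀ x ∈ tsupport (χ i), ContMDiffAt (𝓡 m) 𝓘(ℝ, ℝ) ∞ (G i) x := fun i x hx =>
    (hGs i).contMDiffAt ((hUo i).mem_nhds (hχ i hx))
  set g : X → ℝ := fun x => ∑ᶠ i, χ i x • G i x with hg
  have hgs : ContMDiff (𝓡 m) 𝓘(ℝ, ℝ) ∞ g := χ.contMDiff_finsum_smul (n := ⊤) hGat
  have hgF : ∀ (x y : X) (t : ℝ), χ.finsupport y ⊆ χ.fintsupport x →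
      g y = t + ∑ i ∈ χ.fintsupport x, χ i y * (G i y - t) := by
    intro x y t hy
    have h1 : g y = ∑ i ∈ χ.fintsupport x, χ i y * G i y := by
      rw [hg]
      simp only
      rw [← χ.sum_finsupport_smul_eq_finsum]
      refine Finset.sum_subset hy fun i _ hi => ?_
      have : χ i y = 0 := by simpa using hi
      simp [this]
    have h2 := χ.sum_finsupport' _ (mem_univ y) hy
    simp_rw [mul_sub]
    rw [Finset.sum_sub_distrib, ← Finset.sum_mul, h2, h1]
    ring
  have hmem : ∀ x, ∀ i ∈ χ.fintsupport x, x ∈ U i := fun x i hi =>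
    hχ i ((χ.mem_fintsupport_iff x i).1 hi)
  have hsum : ∀ x, ∑ i ∈ χ.fintsupport x, χ i x = 1 := fun x =>
    χ.sum_finsupport' _ (mem_univ x) (χ.finsupport_subset_fintsupport x)
  refine ⟨g, hgs, fun x => ?_, fun x v => ?_⟩
  · rw [hgF x x (ρ x) (χ.finsupport_subset_fintsupport x), add_sub_cancel_left]
    calc |∑ i ∈ χ.fintsupport x, χ i x * (G i x - ρ x)|
        ≤ ∑ i ∈ χ.fintsupport x, χ i x * ε := by
          refine (Finset.abs_sum_le_sum_abs _ _).trans (Finset.sum_le_sum fun i hi => ?_)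
          rw [abs_mul, abs_of_nonneg (χ.nonneg i x)]
          exact mul_le_mul_of_nonneg_left ((hGρ i x (hmem x i hi)).trans (min_le_left _ _))
            (χ.nonneg i x)
      _ = ε := by rw [← Finset.sum_mul, hsum, one_mul]
  · have hd := dfun_eq_sum_of_partition (χ.fintsupport x) (χ := fun i => χ i) (G := G) (t := ρ x)
      (fun i _ => (χ i).contMDiff.mdifferentiableAt (by simp))
      (fun i hi => (hGat i x ((χ.mem_fintsupport_iff x i).1 hi)).mdifferentiableAt (by simp))
      (hgs.mdifferentiableAt (by simp))
      ((χ.eventually_finsupport_subset x).mono fun y hy => hgF x y (ρ x) hy) v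
    rw [hd]
    calc |∑ i ∈ χ.fintsupport x, (χ i x * dfun (G i) x v + (G i x - ρ x) * dfun (χ i) x v)|
        ≤ ∑ i ∈ χ.fintsupport x, (χ i x * ((1 + ε / 2) * ‖v‖) + w i * ‖v‖) := by
          refine (Finset.abs_sum_le_sum_abs _ _).trans (Finset.sum_le_sum fun i hi => ?_)
          refine (abs_add_le _ _).trans (add_le_add ?_ ?_)
          · rw [abs_mul, abs_of_nonneg (χ.nonneg i x), ← hκ2]
            exact mul_le_mul_of_nonneg_left (hGd i x (hmem x i hi) v) (χ.nonneg i x)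
          · rw [abs_mul]
            calc _ ≤ δ i * (M i * ‖v‖) :=
                  mul_le_mul (hGρ i x (hmem x i hi)) (hM i x (hUK i (hmem x i hi)) v)
                    (abs_nonneg _) (hδ0 i).le
              _ ≤ w i * ‖v‖ := by rw [← mul_assoc]; gcongr; exact hδM i
      _ = (1 + ε / 2) * ‖v‖ + (∑ i ∈ χ.fintsupport x, w i) * ‖v‖ := by
          rw [Finset.sum_add_distrib, ← Finset.sum_mul, hsum, one_mul, Finset.sum_mul]
      _ ≤ (1 + ε / 2) * ‖v‖ + (ε / 2) * ‖v‖ := by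
          gcongr
          exact (sum_le_hasSum _ (fun i _ => (hw0 i).le) hW).trans hWε
      _ = (1 + ε) * ‖v‖ := by ring

end SmoothApprox

/-! ### The differential inequality for the area and its integration. -/

section AreaBound

open scoped Topology

lemma extInv_mono (φ : ℝ≥0 → ℝ≥0) : Monotone (extInv φ) := fun _ _ h =>
  iInf_mono fun _ => iInf_mono' fun h' => ⟨h.trans h', le_rfl⟩

lemma inverseIntegral_lt_top {φ : ℝ≥0 → ℝ≥0} {Q : ℝ≥0} {s₀ s : ℝ}
    (h : 0 < extInv φ (s₀ / Q)) : inverseIntegral φ Q s₀ s < ⊤ := by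
  calc inverseIntegral φ Q s₀ s
      ≤ ∫⁻ _ in Ioc s₀ s, (extInv φ (s₀ / Q))⁻¹ := by
        refine setLIntegral_mono' measurableSet_Ioc fun t ht => ENNReal.inv_le_inv.2 ?_
        exact extInv_mono φ (div_le_div_of_nonneg_right ht.1.le Q.2)
    _ < ⊤ := by
        rw [setLIntegral_const]
        exact ENNReal.mul_lt_top (ENNReal.inv_lt_top.2 h) (by simp)

/-- A change of variables: if the monotone function `A` satisfies `1 ≤ M A'(r) u(A(r))` almost
everywhere, then `(b - a) / M` is at most the integral of `u` over the range of `A`. -/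
lemma ofReal_sub_le_lintegral_of_monotoneOn {A : ℝ → ℝ} {a b s t M : ℝ}
    (hA : MonotoneOn A (Ioo a b)) (hst : ∀ r ∈ Ioo a b, A r ∈ Icc s t) {u : ℝ → ℝ≥0∞}
    (h : ∀ᵐ r, r ∈ Ioo a b → ∀ A', HasDerivAt A A' r →
      1 ≤ ENNReal.ofReal (M * A') * u (A r)) (hM : 0 ≤ M) :
    ENNReal.ofReal (b - a) ≤ ENNReal.ofReal M * ∫⁻ x in Ioc s t, u x := by
  have hdiff : ∀ᵐ r, r ∈ Ioo a b → HasDerivAt A (deriv A r) r := by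
    filter_upwards [hA.ae_differentiableWithinAt_of_mem] with r hr hrm
    exact ((hr hrm).differentiableAt (isOpen_Ioo.mem_nhds hrm)).hasDerivAt
  set P : ℝ → Prop := fun r => r ∈ Ioo a b → HasDerivAt A (deriv A r) r ∧
    1 ≤ ENNReal.ofReal (M * deriv A r) * u (A r) with hP
  have hae : ∀ᵐ r, P r := by
    filter_upwards [h, hdiff] with r h1 h2 hr using ⟨h2 hr, h1 hr _ (h2 hr)⟩
  -- Removing a measurable null set makes the inequality hold everywhere on `S`, as the change of
  -- variables needs.
  set Z := toMeasurable volume {r | ¬ P r} with hZ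
  have hZ0 : volume Z = 0 := by rw [hZ, measure_toMeasurable]; exact hae
  set S := Ioo a b \ Z with hS
  have hSm : MeasurableSet S := measurableSet_Ioo.diff (measurableSet_toMeasurable _ _)
  have hSP : ∀ r ∈ S, HasDerivAt A (deriv A r) r ∧
      1 ≤ ENNReal.ofReal (M * deriv A r) * u (A r) := by
    intro r hr
    by_contra hcon
    exact hr.2 (subset_toMeasurable _ _ fun hp => hcon (hp hr.1))
  have hvol : volume S = ENNReal.ofReal (b - a) := by
    rw [hS, measure_sdiff_null hZ0, Real.volume_Ioo]
  calc ENNReal.ofReal (b - a) = ∫⁻ _ in S, 1 := by rw [setLIntegral_one, hvol]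
    _ ≤ ∫⁻ r in S, ENNReal.ofReal M * (ENNReal.ofReal (deriv A r) * u (A r)) := by
        refine setLIntegral_mono' hSm fun r hr => (hSP r hr).2.trans_eq ?_
        rw [ENNReal.ofReal_mul hM, mul_assoc]
    _ = ENNReal.ofReal M * ∫⁻ r in S, ENNReal.ofReal (deriv A r) * u (A r) :=
        lintegral_const_mul' _ _ ENNReal.ofReal_ne_top
    _ = ENNReal.ofReal M * ∫⁻ x in A '' S, u x := by
        rw [lintegral_image_eq_lintegral_deriv_mul_of_monotoneOn hSm
          (fun r hr => (hSP r hr).1.hasDerivWithinAt) (hA.mono sdiff_subset)]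
    -- The image of `A` misses its jumps; including them only enlarges the integral.
    _ ≤ ENNReal.ofReal M * ∫⁻ x in Icc s t, u x := by
        gcongr
        rintro _ ⟨r, hr, rfl⟩
        exact hst r hr.1
    _ = ENNReal.ofReal M * ∫⁻ x in Ioc s t, u x := by
        rw [setLIntegral_congr Ioc_ae_eq_Icc]

variable {m : ℕ} {X : Type*} [EMetricSpace X]
  [ChartedSpace (EuclideanSpace ℝ (Fin m)) X] [IsManifold (𝓡 m) ∞ X]
  [RiemannianBundle (fun x : X => TangentSpace (𝓡 m) x)]
  [IsContinuousRiemannianBundle (EuclideanSpace ℝ (Fin m)) (fun x : X => TangentSpace (𝓡 m) x)]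
  [IsRiemannianManifold (𝓡 m) X] [SecondCountableTopology X] [MeasurableSpace X] [BorelSpace X]

namespace RectCurrent

/-- The mass bounds values only from above, so it is applied to `α` and to `-α`. -/
lemma eval_eq_zero_of_mass_eq_zero {γ : RectCurrent m 1 X} (h : γ.mass = 0)
    {α : DiffForm m 1 X} (hα : α.IsTest) : γ.eval α = 0 := by
  have key : ∀ β : DiffForm m 1 X, β.IsTest → γ.eval β ≤ 0 := by
    intro β hβ
    obtain ⟨M, hM0, hM⟩ := hβ.isContTest.exists_comass_le
    have := γ.eval_le_mul_mass (by simp [h]) hβ hM hM0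
    simpa [h] using this
  have h1 := key _ (hα.fsmul (contMDiff_const (c := (-1 : ℝ))))
  rw [γ.eval_const_fsmul hα] at h1
  linarith [key α hα]

/-- Any filling of `γ` has the same boundary as `C ⌞ B` and is a competitor; the `ε` in the
definition of a filling function tends to zero. -/
lemma IsQuasiminimizing.mass_le_filling {C : RectCurrent m 2 X} {Q : ℝ≥0}
    (hC : C.IsQuasiminimizing Q) {φ : ℝ≥0 → ℝ≥0} (hφ : IsFillingFunction m X φ) {B : Set X}
    (hB : MeasurableSet B) (hfin : (C.restrict B hB).mass < ⊤) {γ : RectCurrent m 1 X}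
    (hγ : (C.restrict B hB).HasBoundary γ) (hγfin : γ.mass < ⊤) :
    (C.restrict B hB).mass ≤ Q * φ γ.mass.toNNReal := by
  have key : ∀ ε : ℝ≥0, 0 < ε → (C.restrict B hB).mass ≤ Q * (φ γ.mass.toNNReal + ε) := by
    intro ε hε
    obtain ⟨C', hC', hlt⟩ := hφ ε hε γ hγfin hγ.isCycle
    refine (hC.mass_le B hB hfin C' (hlt.trans (by simp)) fun α hα => ?_).trans (by gcongr)
    rw [hγ α hα, hC' α hα]
  refine ENNReal.le_of_forall_pos_le_add fun ε hε _ => ?_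
  refine (key (ε / (Q + 1)) (by positivity)).trans ?_
  rw [mul_add]
  gcongr
  norm_cast
  rw [mul_div_assoc', div_le_iff₀ (by positivity), mul_comm]
  gcongr
  simp

/-- Here the competitor is the zero current, presented as `C ⌞ ∅`. This excludes slices of zero
length even when `φ 0 > 0`. -/
lemma IsQuasiminimizing.mass_eq_zero {C : RectCurrent m 2 X} {Q : ℝ≥0}
    (hC : C.IsQuasiminimizing Q) {B : Set X} (hB : MeasurableSet B)
    (hfin : (C.restrict B hB).mass < ⊤) {γ : RectCurrent m 1 X}
    (hγ : (C.restrict B hB).HasBoundary γ) (h0 : γ.mass = 0) : (C.restrict B hB).mass = 0 := by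
  set Z := C.restrict ∅ MeasurableSet.empty with hZ
  have hZ0 : ∀ η : DiffForm m 2 X, Z.eval η = 0 := fun η => by simp [hZ, eval, restrict]
  have hZm : Z.mass = 0 := by simp [mass, hZ0]
  have := hC.mass_le B hB hfin Z (by simp [hZm]) fun α hα => by
    rw [hγ α hα, hZ0, eval_eq_zero_of_mass_eq_zero h0 hα]
  simpa [hZm] using this

/-- The differential inequality `1 ≤ A'(r) / φ⁻¹(A(r) / Q)` for the areas `A(r)` of sublevel sets,
up to the Lipschitz constant. -/
lemma one_le_deriv_mul_inv_extInv {C : RectCurrent m 2 X} {Q : ℝ≥0} (hQ : 1 ≤ Q)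
    (hC : C.IsQuasiminimizing Q) {φ : ℝ≥0 → ℝ≥0} (hφ : IsFillingFunction m X φ)
    {g : X → ℝ} (hg : ContMDiff (𝓡 m) 𝓘(ℝ, ℝ) ∞ g) {M : ℝ} (hM0 : 0 < M)
    (hM : ∀ x (v : TangentSpace (𝓡 m) x), |dfun g x v| ≤ M * ‖v‖)
    (hB : ∀ r : ℝ, MeasurableSet {x | g x < r}) {r : ℝ} {γ : RectCurrent m 1 X}
    (hγ : (C.sublevel g hB r).HasBoundary γ) (hfin : (C.sublevel g hB r).mass < ⊤)
    (hpos : 0 < (C.sublevel g hB r).mass) {A' : ℝ}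
    (hA : HasDerivAt (fun r => (C.sublevel g hB r).mass.toReal) A' r) :
    1 ≤ ENNReal.ofReal (M * A') * (extInv φ ((C.sublevel g hB r).mass.toReal / Q))⁻¹ := by
  have hle := mass_le_of_hasDerivAt hC.isCycle hg hM0 hM hB hγ hfin hA
  have hγfin : γ.mass < ⊤ := hle.trans_lt ENNReal.ofReal_lt_top
  have hγ0 : γ.mass ≠ 0 := fun h => hpos.ne' (hC.mass_eq_zero (hB r) hfin hγ h)
  have hfill := hC.mass_le_filling hφ (hB r) hfin hγ hγfin
  have hext : extInv φ ((C.sublevel g hB r).mass.toReal / Q) ≤ ENNReal.ofReal (M * A') := by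
    refine le_trans (iInf₂_le γ.mass.toNNReal ?_) ((ENNReal.coe_toNNReal hγfin.ne).trans_le hle)
    rw [div_le_iff₀ (by exact_mod_cast zero_lt_one.trans_le hQ), mul_comm]
    have := ENNReal.toReal_mono (by finiteness) hfill
    simpa [sublevel] using this
  -- With `A' = 0` the product would be `0 * ∞ = 0`; a slice of positive mass rules this out.
  have ht0 : ENNReal.ofReal (M * A') ≠ 0 := fun h => hγ0 (le_antisymm (h ▸ hle) zero_le)
  calc 1 = ENNReal.ofReal (M * A') * (ENNReal.ofReal (M * A'))⁻¹ :=
        (ENNReal.mul_inv_cancel ht0 ENNReal.ofReal_ne_top).symm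
    _ ≤ _ := by gcongr

/-- The lower area bound for the sublevel sets of a smooth function. -/
lemma ofReal_sub_le_mul_inverseIntegral {C : RectCurrent m 2 X} {Q : ℝ≥0} (hQ : 1 ≤ Q)
    (hC : C.IsQuasiminimizing Q) {φ : ℝ≥0 → ℝ≥0} (hφ : IsFillingFunction m X φ)
    {g : X → ℝ} (hg : ContMDiff (𝓡 m) 𝓘(ℝ, ℝ) ∞ g) {M : ℝ} (hM0 : 0 < M)
    (hM : ∀ x (v : TangentSpace (𝓡 m) x), |dfun g x v| ≤ M * ‖v‖) {a b : ℝ} {U V : Set X}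
    (hU : IsOpen U) (hV : IsOpen V) (hUg : U ⊆ {x | g x < a}) (hgV : {x | g x < b} ⊆ V)
    (hpos : 0 < (C.restrict U hU.measurableSet).mass)
    (hfin : (C.restrict V hV.measurableSet).mass < ⊤) :
    ENNReal.ofReal (b - a) ≤ ENNReal.ofReal M *
      inverseIntegral φ Q (C.restrict U hU.measurableSet).mass.toReal
        (C.restrict V hV.measurableSet).mass.toReal := by
  have hopen : ∀ r, IsOpen {x | g x < r} := fun r => isOpen_lt hg.continuous continuous_const
  have hB : ∀ r, MeasurableSet {x | g x < r} := fun r => (hopen r).measurableSet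
  have hleV : ∀ r ≤ b, (C.sublevel g hB r).mass ≤ (C.restrict V hV.measurableSet).mass :=
    fun r hr => C.mass_restrict_mono (hopen r) hV
      (Subset.trans (fun x (hx : g x < r) => lt_of_lt_of_le hx hr) hgV)
  have hleU : ∀ r, a ≤ r → (C.restrict U hU.measurableSet).mass ≤ (C.sublevel g hB r).mass :=
    fun r hr => C.mass_restrict_mono hU (hopen r) (hUg.trans fun x (hx : g x < a) => lt_of_lt_of_le hx hr)
  have hfinr : ∀ r ≤ b, (C.sublevel g hB r).mass < ⊤ := fun r hr => (hleV r hr).trans_lt hfin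
  refine ofReal_sub_le_lintegral_of_monotoneOn
    (A := fun r => (C.sublevel g hB r).mass.toReal) (fun r _ r' hr' hrr' => ?_)
    (fun r hr => ⟨?_, ?_⟩) ?_ hM0.le
  · exact ENNReal.toReal_mono (hfinr r' hr'.2.le).ne (C.mass_restrict_mono (hopen r) (hopen r')
      fun x (hx : g x < r) => lt_of_lt_of_le hx hrr')
  · exact ENNReal.toReal_mono (hfinr r hr.2.le).ne (hleU r hr.1.le)
  · exact ENNReal.toReal_mono hfin.ne (hleV r hr.2.le)
  · filter_upwards [ae_exists_hasBoundary_restrict_sublevel hC.isCycle hg hM0.le hM hB]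
      with r ⟨γ, hγ⟩ hr A' hA'
    exact one_le_deriv_mul_inv_extInv hQ hC hφ hg hM0 hM hB hγ (hfinr r hr.2.le)
      (hpos.trans_le (hleU r hr.1.le)) hA'

end RectCurrent

/-- The truncated distance to `p`. -/
def truncDist (p : X) (R : ℝ) (x : X) : ℝ := (min (edist x p) (ENNReal.ofReal R)).toReal

/-- Truncation keeps the distance finite when `X` is disconnected and preserves the Lipschitz
constant one. -/
lemma truncDist_lipschitz (p : X) (R : ℝ) (x y : X) :
    ENNReal.ofReal |truncDist p R x - truncDist p R y| ≤ edist x y := by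
  have hne : ∀ x, min (edist x p) (ENNReal.ofReal R) ≠ ⊤ := fun x =>
    (min_lt_of_right_lt ENNReal.ofReal_lt_top).ne
  by_cases htop : edist x y = ⊤
  · simp [htop]
  have key : ∀ x y, edist x y ≠ ⊤ →
      truncDist p R x ≤ truncDist p R y + (edist x y).toReal := by
    intro x y h
    rw [truncDist, truncDist, ← ENNReal.toReal_add (hne y) h]
    refine ENNReal.toReal_mono (ENNReal.add_ne_top.2 ⟨hne y, h⟩) ?_
    rw [min_add]
    refine le_min ((min_le_left _ _).trans ?_) ((min_le_right _ _).trans le_self_add)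
    rw [add_comm]
    exact edist_triangle x y p
  rw [ENNReal.ofReal_le_iff_le_toReal htop, abs_le]
  have h1 := key x y htop
  have h2 := key y x (by rwa [edist_comm])
  rw [edist_comm] at h2
  constructor <;> linarith

lemma truncDist_lt_of_mem_eball {p : X} {R r : ℝ} {x : X}
    (h : x ∈ Metric.eball p (ENNReal.ofReal r)) : truncDist p R x < r := by
  have h1 : min (edist x p) (ENNReal.ofReal R) < ENNReal.ofReal r := min_lt_of_left_lt h
  have := (ENNReal.toReal_lt_toReal h1.ne_top ENNReal.ofReal_ne_top).2 h1
  rwa [ENNReal.toReal_ofReal] at this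
  by_contra hr
  simp [ENNReal.ofReal_of_nonpos (not_le.1 hr).le] at h1

lemma mem_eball_of_truncDist_lt {p : X} {R r : ℝ} {x : X} (hrR : r ≤ R)
    (h : truncDist p R x < r) : x ∈ Metric.eball p (ENNReal.ofReal r) := by
  rw [truncDist, ← ENNReal.lt_ofReal_iff_toReal_lt (min_lt_of_right_lt ENNReal.ofReal_lt_top).ne,
    min_lt_iff] at h
  exact h.resolve_right (not_lt.2 (ENNReal.ofReal_le_ofReal hrR))

lemma ofReal_le_of_forall_approx {d : ℝ} {I : ℝ≥0∞}
    (h : ∀ ε : ℝ, 0 < ε → ENNReal.ofReal (d - 2 * ε) ≤ ENNReal.ofReal (1 + ε) * I) :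
    ENNReal.ofReal d ≤ I := by
  by_cases hI : I = ⊤
  · simp [hI]
  refine ENNReal.ofReal_le_of_le_toReal ?_
  have h' : ∀ ε : ℝ, 0 < ε → d - 2 * ε ≤ (1 + ε) * I.toReal := fun ε hε => by
    have := h ε hε
    rwa [ENNReal.ofReal_le_iff_le_toReal (by finiteness), ENNReal.toReal_mul,
      ENNReal.toReal_ofReal (by linarith)] at this
  have hl : Filter.Tendsto (fun ε : ℝ => d - 2 * ε) (𝓝[>] 0) (𝓝 d) := by
    have : Continuous fun ε : ℝ => d - 2 * ε := by fun_prop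
    simpa using (this.tendsto 0).mono_left nhdsWithin_le_nhds
  have hr : Filter.Tendsto (fun ε : ℝ => (1 + ε) * I.toReal) (𝓝[>] 0) (𝓝 I.toReal) := by
    have : Continuous fun ε : ℝ => (1 + ε) * I.toReal := by fun_prop
    simpa using (this.tendsto 0).mono_left nhdsWithin_le_nhds
  refine le_of_tendsto_of_tendsto hl hr ?_
  filter_upwards [self_mem_nhdsWithin] with ε hε using h' ε hε

end AreaBound
end Plateau
end

theorem proposition2p15 {m : ℕ} {X : Type*} [EMetricSpace X] [SecondCountableTopology X]
    [ChartedSpace (EuclideanSpace ℝ (Fin m)) X] [IsManifold (𝓡 m) ∞ X]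
    [RiemannianBundle (fun x : X => TangentSpace (𝓡 m) x)]
    [IsContMDiffRiemannianBundle (𝓡 m) ∞ (EuclideanSpace ℝ (Fin m))
      (fun x : X => TangentSpace (𝓡 m) x)]
    [IsRiemannianManifold (𝓡 m) X] [MeasurableSpace X] [BorelSpace X]
    (φ : ℝ≥0 → ℝ≥0) (hφ : Plateau.IsFillingFunction m X φ) (hmono : StrictMono φ)
    (Q : ℝ≥0) (hQ : 1 ≤ Q) (C : Plateau.RectCurrent m 2 X) (hC : C.IsQuasiminimizing Q)
    (p : X) (a : ℝ) (ha : 0 < a) (hA : 0 < (C.restrictBall p a).mass)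
    (b : ℝ) (hab : a < b) (hfin : (C.restrictBall p b).mass < ⊤) :
    ENNReal.ofReal (b - a) ≤
      Plateau.inverseIntegral φ Q (C.restrictBall p a).mass.toReal
        (C.restrictBall p b).mass.toReal ∧
    (0 < Plateau.extInv φ ((C.restrictBall p a).mass.toReal / Q) →
      Plateau.inverseIntegral φ Q (C.restrictBall p a).mass.toReal
        (C.restrictBall p b).mass.toReal < ⊤) := by
  have := Plateau.isContinuousRiemannianBundle_of_contMDiff (m := m) (X := X)
  refine ⟨Plateau.ofReal_le_of_forall_approx fun ε hε => ?_, Plateau.inverseIntegral_lt_top⟩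
  -- Truncating at `b` changes no sublevel set up to level `b`.
  obtain ⟨g, hg, hgρ, hgd⟩ := Plateau.exists_smooth_approx (m := m)
    (Plateau.truncDist_lipschitz p b) hε
  -- Since `g` is within `ε` of the truncated distance, the ball of radius `a` lies in `{g < a +
  -- ε}`, and `{g < b - ε}` lies in the ball of radius `b`.
  have h := Plateau.RectCurrent.ofReal_sub_le_mul_inverseIntegral hQ hC hφ hg
    (M := 1 + ε) (by linarith) hgd (a := a + ε) (b := b - ε)
    (U := Metric.eball p (ENNReal.ofReal a)) (V := Metric.eball p (ENNReal.ofReal b))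
    Metric.isOpen_eball Metric.isOpen_eball
    (fun x hx => by
      have h1 := Plateau.truncDist_lt_of_mem_eball (R := b) hx
      have h2 := (abs_le.1 (hgρ x)).2
      change g x < a + ε
      linarith)
    (fun x hx => by
      refine Plateau.mem_eball_of_truncDist_lt le_rfl ?_
      have h2 := (abs_le.1 (hgρ x)).1
      have h3 : g x < b - ε := hx
      linarith) hA hfin
  have e : b - ε - (a + ε) = b - a - 2 * ε := by ring
  rwa [e] at h
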